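/- Let $k$ be a field, $H$ a Hopf algebra over $k$ with bijective antipode $S$, and let ${}^H_H\mathcal{YD}$ be the braided category of left Yetter–Drinfeld modules over $H$, i.e. left $H$-modules and left $H$-comodules $M$ with $\delta(h\cdot m)=h_{(1)}m_{(-1)}S(h_{(3)})\otimes h_{(2)}\cdot m_{(0)}$, with diagonal tensor products and braiding $c(m\otimes n)=m_{(-1)}\cdot n\otimes m_{(0)}$. For $V$ in ${}^H_H\mathcal{YD}$ let $T(V)$ be the tensor algebra, regarded as a Hopf algebra in ${}^H_H\mathcal{YD}$ with the elements of $V$ primitive, and let $\mathfrak S^n=\sum_{x\in S_n}s(x)$ on $V^{\otimes n}$ be the quantum symmetrizer, where $s(x)=\sigma_{i_1}\cdots\sigma_{i_r}$ for a reduced word $x=\tau_{i_1}\cdots\tau_{i_r}$ in the transpositions $\tau_i=(i,i+1)$, and $\sigma_i$ is $c_{V,V}$ acting on the factors $i,i+1$. The Nichols algebra of $V$ is the quotient Hopf algebra $\mathfrak B(V)=T(V)/\bigoplus_{n\ge 0}\ker\mathfrak S^n$. For a finite-dimensional $M$ in ${}^H_H\mathcal{YD}$ the left dual ${}^*M$ is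 the linear dual of $M$ with $(h\cdot f)(m)=f(S^{-1}(h)\cdot m)$ and $f_{(-1)}f_{(0)}(m)=S(m_{(-1)})f(m_{(0)})$. If $R$ is a finite-dimensional Hopf algebra in ${}^H_H\mathcal{YD}$, then ${}^*R$ is a Hopf algebra in ${}^H_H\mathcal{YD}$ with multiplication ${}^*\Delta_R\circ\sigma$ and comultiplication $\sigma^{-1}\circ{}^*m_R$, where $\sigma=\phi\circ c^{-1}:{}^*R\otimes{}^*R\to{}^*(R\otimes R)$ and $\phi(f\otimes g)(r\otimes s)=g(r)f(s)$, and with unit, counit and antipode the transposes of the counit, unit and antipode of $R$. For a Hopf algebra $R$ in ${}^H_H\mathcal{YD}$, $R^{\mathrm{bop}}$ is $R$ with multiplication $m_R\circ c_{R,R}$ and comultiplication $c_{R,R}^{-1}\circ\Delta_R$, and unchanged unit, counit and antipode. **Proposition.** Let $V$ be a finite-dimensional Yetter–Drinfeld module over $H$ such that $\mathfrak B(V)$ is finite dimensional. Then $\bigoplus_n\ker\mathfrak S^n$ is a Hopf ideal of $T(V)$ and of $T({}^*V)$, so that $\mathfrak B(V)$ and $\mathfrak B({}^*V)$ are well defined;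 $\mathfrak B(V)$, $\mathfrak B({}^*V)$ and $({}^*\mathfrak B(V))^{\mathrm{bop}}$ are Hopf algebras in ${}^H_H\mathcal{YD}$; and $$\mathfrak B({}^*V)\simeq({}^*\mathfrak B(V))^{\mathrm{bop}}$$ as Hopf algebras in ${}^H_H\mathcal{YD}$. -/

import Mathlib

open scoped TensorProduct

noncomputable section

namespace BraidedHopf

universe u v w w₁ w₂

section YetterDrinfeld

variable (k : Type u) (H : Type v) [Field k] [Ring H] [HopfAlgebra k H]

/-- An action and a coaction of `H` on a vector space `M` (no axioms yet). -/
structure YDData (M : Type w) [AddCommGroup M] [Module k M] where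
  /-- the action `h ⊗ m ↦ h · m` -/
  act : H →ₗ[k] M →ₗ[k] M
  /-- the coaction `m ↦ m₍₋₁₎ ⊗ m₍₀₎` -/
  coact : M →ₗ[k] H ⊗[k] M

/-- The antipode of `H` is bijective. -/
class BijectiveAntipode : Prop where
  bijective : Function.Bijective (HopfAlgebra.antipode k : H →ₗ[k] H)

/-- The inverse of the antipode of `H`. -/
def antipodeInv [h : BijectiveAntipode k H] : H →ₗ[k] H :=
  ((LinearEquiv.ofBijective (HopfAlgebra.antipode k : H →ₗ[k] H) h.bijective).symm :
    H →ₗ[k] H)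

variable {k H}

namespace YDData

variable {M : Type w} [AddCommGroup M] [Module k M]
variable {N : Type w₁} [AddCommGroup N] [Module k N]

/-- `(a ⊗ b ⊗ c) ⊗ (g ⊗ m) ↦ a g S(c) ⊗ b · m`. -/
def sandwich (s : YDData k H M) : (H ⊗[k] (H ⊗[k] H)) ⊗[k] (H ⊗[k] M) →ₗ[k] H ⊗[k] M :=
  TensorProduct.map
      (LinearMap.mul' k H ∘ₗ
        TensorProduct.map LinearMap.id (LinearMap.mul' k H ∘ₗ
          (TensorProduct.comm k H H).toLinearMap ∘ₗ
            TensorProduct.map (HopfAlgebra.antipode k) LinearMap.id) ∘ₗ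
        (TensorProduct.assoc k H H H).toLinearMap)
      (TensorProduct.lift s.act) ∘ₗ
    (TensorProduct.tensorTensorTensorComm k (H ⊗[k] H) H H M).toLinearMap ∘ₗ
    TensorProduct.map
      ((TensorProduct.assoc k H H H).symm.toLinearMap ∘ₗ
        TensorProduct.map LinearMap.id (TensorProduct.comm k H H).toLinearMap) LinearMap.id

theorem sandwich_tmul (s : YDData k H M) (a b c g : H) (m : M) :
    s.sandwich ((a ⊗ₜ (b ⊗ₜ c)) ⊗ₜ (g ⊗ₜ m)) =
      (a * (g * HopfAlgebra.antipode k c)) ⊗ₜ[k] s.act b m := rfl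

/-- Left Yetter-Drinfeld modules over `H`: a left module and a left comodule such that
`δ(h · m) = h₍₁₎ m₍₋₁₎ S(h₍₃₎) ⊗ h₍₂₎ · m₍₀₎`. -/
structure IsYetterDrinfeld (s : YDData k H M) : Prop where
  one_act : ∀ m, s.act 1 m = m
  mul_act : ∀ g h m, s.act (g * h) m = s.act g (s.act h m)
  coassoc :
    (TensorProduct.assoc k H H M).toLinearMap ∘ₗ
        TensorProduct.map Coalgebra.comul LinearMap.id ∘ₗ s.coact =
      TensorProduct.map LinearMap.id s.coact ∘ₗ s.coact
  counit_coact :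
    (TensorProduct.lid k M).toLinearMap ∘ₗ
      TensorProduct.map Coalgebra.counit LinearMap.id ∘ₗ s.coact = LinearMap.id
  coact_act : ∀ h m,
    s.coact (s.act h m) =
      s.sandwich ((TensorProduct.map LinearMap.id Coalgebra.comul (Coalgebra.comul (R := k) h))
        ⊗ₜ s.coact m)

/-- Morphisms: `H`-linear and `H`-colinear maps. -/
structure IsHom (s : YDData k H M) (t : YDData k H N) (f : M →ₗ[k] N) : Prop where
  map_act : ∀ h m, f (s.act h m) = t.act h (f m)
  coact_map : t.coact ∘ₗ f = TensorProduct.map LinearMap.id f ∘ₗ s.coact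

/-- The unit object: `h · 1 = ε(h)` and `δ(1) = 1 ⊗ 1`. -/
def unitObj : YDData k H k where
  act := LinearMap.mul k k ∘ₗ (Coalgebra.counit : H →ₗ[k] k)
  coact := TensorProduct.mk k H k 1

/-- The tensor product, with the diagonal action and the codiagonal coaction. -/
def tensor (s : YDData k H M) (t : YDData k H N) : YDData k H (M ⊗[k] N) where
  act := TensorProduct.homTensorHomMap (RingHom.id k) M N M N ∘ₗ
    TensorProduct.map s.act t.act ∘ₗ Coalgebra.comul
  coact := TensorProduct.map (LinearMap.mul' k H) LinearMap.id ∘ₗ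
    (TensorProduct.tensorTensorTensorComm k H M H N).toLinearMap ∘ₗ
    TensorProduct.map s.coact t.coact

/-- The braiding `c : M ⊗ N → N ⊗ M`, `m ⊗ n ↦ m₍₋₁₎ · n ⊗ m₍₀₎`. -/
def braiding (s : YDData k H M) (t : YDData k H N) : M ⊗[k] N →ₗ[k] N ⊗[k] M :=
  TensorProduct.map (TensorProduct.lift t.act) LinearMap.id ∘ₗ
    (TensorProduct.rightComm k H M N).toLinearMap ∘ₗ
    TensorProduct.map s.coact LinearMap.id

/-- The inverse braiding `c⁻¹ : M ⊗ N → N ⊗ M`, `m ⊗ n ↦ n₍₀₎ ⊗ S⁻¹(n₍₋₁₎) · m`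
(the inverse of the braiding `N ⊗ M → M ⊗ N`). -/
def braidingInv [BijectiveAntipode k H] (s : YDData k H M) (t : YDData k H N) :
    M ⊗[k] N →ₗ[k] N ⊗[k] M :=
  (TensorProduct.comm k M N).toLinearMap ∘ₗ
    TensorProduct.map (TensorProduct.lift (s.act ∘ₗ antipodeInv k H)) LinearMap.id ∘ₗ
    (TensorProduct.rightComm k H N M).toLinearMap ∘ₗ
    TensorProduct.map t.coact LinearMap.id ∘ₗ
    (TensorProduct.comm k M N).toLinearMap

/-- The left dual of a finite-dimensional Yetter-Drinfeld module: the linear dual with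
`(h · f)(m) = f(S⁻¹(h) · m)` and `δ(f) = ∑ᵢ S((bᵢ)₍₋₁₎) ⊗ f((bᵢ)₍₀₎) bⁱ`, where `(bᵢ)`, `(bⁱ)` are
dual bases. -/
def leftDual [BijectiveAntipode k H] [Module.Finite k M] (s : YDData k H M) :
    YDData k H (Module.Dual k M) where
  act :=
    { toFun := fun h => (s.act (antipodeInv k H h)).dualMap
      map_add' := fun g h => by ext; simp
      map_smul' := fun a h => by ext; simp }
  coact :=
    { toFun := fun f => ∑ i, TensorProduct.map (HopfAlgebra.antipode k)
        (LinearMap.smulRight f ((Module.finBasis k M).coord i)) (s.coact (Module.finBasis k M i))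
      map_add' := fun f g => by
        rw [← Finset.sum_add_distrib]
        refine Finset.sum_congr rfl fun i _ => ?_
        rw [← LinearMap.add_apply, ← TensorProduct.map_add_right]
        congr 2
        ext m n
        simp [add_mul]
      map_smul' := fun a f => by
        rw [RingHom.id_apply, Finset.smul_sum]
        refine Finset.sum_congr rfl fun i _ => ?_
        rw [← LinearMap.smul_apply, ← TensorProduct.map_smul_right]
        congr 2
        ext m n
        simp [mul_assoc] }

end YDData

/-! ### Hopf algebras in the category of Yetter-Drinfeld modules -/

variable (k H) in
/-- The structure maps of a Hopf algebra in the category of Yetter-Drinfeld modules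
(no axioms yet). -/
structure HopfData (R : Type w) [AddCommGroup R] [Module k R] extends YDData k H R where
  mul : R ⊗[k] R →ₗ[k] R
  unit : k →ₗ[k] R
  comul : R →ₗ[k] R ⊗[k] R
  counit : R →ₗ[k] k
  antipode : R →ₗ[k] R

/-- `id ⊗ c ⊗ id : (A ⊗ B) ⊗ (C ⊗ D) → (A ⊗ C) ⊗ (B ⊗ D)` for `c : B ⊗ C → C ⊗ B`; all four
factors are the same space. -/
def middle {R : Type w} [AddCommGroup R] [Module k R] (c : R ⊗[k] R →ₗ[k] R ⊗[k] R) :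
    (R ⊗[k] R) ⊗[k] (R ⊗[k] R) →ₗ[k] (R ⊗[k] R) ⊗[k] (R ⊗[k] R) :=
  (TensorProduct.assoc k R R (R ⊗[k] R)).symm.toLinearMap ∘ₗ
    TensorProduct.map LinearMap.id
      ((TensorProduct.assoc k R R R).toLinearMap ∘ₗ
        TensorProduct.map c LinearMap.id ∘ₗ
        (TensorProduct.assoc k R R R).symm.toLinearMap) ∘ₗ
    (TensorProduct.assoc k R R (R ⊗[k] R)).toLinearMap

namespace HopfData

variable {R : Type w} [AddCommGroup R] [Module k R]
variable {R' : Type w₁} [AddCommGroup R'] [Module k R']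

/-- Hopf algebras in the category of (not necessarily finite-dimensional) Yetter-Drinfeld
modules. -/
structure IsHopfAlgebra (A : HopfData k H R) : Prop where
  isYetterDrinfeld : A.toYDData.IsYetterDrinfeld
  mul_hom : (A.toYDData.tensor A.toYDData).IsHom A.toYDData A.mul
  unit_hom : YDData.unitObj.IsHom A.toYDData A.unit
  comul_hom : A.toYDData.IsHom (A.toYDData.tensor A.toYDData) A.comul
  counit_hom : A.toYDData.IsHom YDData.unitObj A.counit
  antipode_hom : A.toYDData.IsHom A.toYDData A.antipode
  mul_assoc :
    A.mul ∘ₗ TensorProduct.map A.mul LinearMap.id =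
      A.mul ∘ₗ TensorProduct.map LinearMap.id A.mul ∘ₗ (TensorProduct.assoc k R R R).toLinearMap
  unit_mul : ∀ x, A.mul (A.unit 1 ⊗ₜ x) = x
  mul_unit : ∀ x, A.mul (x ⊗ₜ A.unit 1) = x
  coassoc :
    (TensorProduct.assoc k R R R).toLinearMap ∘ₗ TensorProduct.map A.comul LinearMap.id ∘ₗ
      A.comul = TensorProduct.map LinearMap.id A.comul ∘ₗ A.comul
  counit_comul :
    (TensorProduct.lid k R).toLinearMap ∘ₗ TensorProduct.map A.counit LinearMap.id ∘ₗ A.comul =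
      LinearMap.id
  comul_counit :
    (TensorProduct.rid k R).toLinearMap ∘ₗ TensorProduct.map LinearMap.id A.counit ∘ₗ A.comul =
      LinearMap.id
  counit_unit : A.counit (A.unit 1) = 1
  counit_mul : ∀ x y, A.counit (A.mul (x ⊗ₜ y)) = A.counit x * A.counit y
  comul_unit : A.comul (A.unit 1) = A.unit 1 ⊗ₜ A.unit 1
  comul_mul :
    A.comul ∘ₗ A.mul =
      TensorProduct.map A.mul A.mul ∘ₗ middle (A.toYDData.braiding A.toYDData) ∘ₗ
        TensorProduct.map A.comul A.comul
  antipode_left :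
    A.mul ∘ₗ TensorProduct.map A.antipode LinearMap.id ∘ₗ A.comul = A.unit ∘ₗ A.counit
  antipode_right :
    A.mul ∘ₗ TensorProduct.map LinearMap.id A.antipode ∘ₗ A.comul = A.unit ∘ₗ A.counit

/-- Morphisms of Hopf algebras in the category of Yetter-Drinfeld modules. -/
structure IsHom (A : HopfData k H R) (B : HopfData k H R') (f : R →ₗ[k] R') : Prop where
  yd_hom : A.toYDData.IsHom B.toYDData f
  map_mul : f ∘ₗ A.mul = B.mul ∘ₗ TensorProduct.map f f
  map_unit : f ∘ₗ A.unit = B.unit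
  map_comul : B.comul ∘ₗ f = TensorProduct.map f f ∘ₗ A.comul
  map_counit : B.counit ∘ₗ f = A.counit
  map_antipode : f ∘ₗ A.antipode = B.antipode ∘ₗ f

/-- `A` and `B` are isomorphic as Hopf algebras in the category of Yetter-Drinfeld modules. -/
def Isomorphic (A : HopfData k H R) (B : HopfData k H R') : Prop :=
  ∃ e : R ≃ₗ[k] R', A.IsHom B e.toLinearMap

/-- `Rᵇᵒᵖ`: multiplication `m ∘ c`, comultiplication `c⁻¹ ∘ Δ`, the rest unchanged. -/
def bop [BijectiveAntipode k H] (A : HopfData k H R) : HopfData k H R where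
  toYDData := A.toYDData
  mul := A.mul ∘ₗ A.toYDData.braiding A.toYDData
  unit := A.unit
  comul := A.toYDData.braidingInv A.toYDData ∘ₗ A.comul
  counit := A.counit
  antipode := A.antipode

/-- The isomorphism `φ : *M ⊗ *N ≃ *(N ⊗ M)`, `φ(f ⊗ g)(n ⊗ m) = g(n) f(m)`. -/
def dualTensor (k : Type u) (M : Type w) (N : Type w₁) [Field k] [AddCommGroup M] [Module k M]
    [Module.Finite k M] [AddCommGroup N] [Module k N] [Module.Finite k N] :
    Module.Dual k M ⊗[k] Module.Dual k N ≃ₗ[k] Module.Dual k (N ⊗[k] M) :=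
  (TensorProduct.comm k (Module.Dual k M) (Module.Dual k N)).trans
    (TensorProduct.dualDistribEquiv k N M)

/-- The left dual `*R` in the braided category of finite-dimensional Yetter-Drinfeld modules:
with `σ = φ ∘ c⁻¹ : *R ⊗ *R → *(R ⊗ R)`, the multiplication is `*Δ ∘ σ`, the comultiplication is
`σ⁻¹ ∘ *m = c ∘ φ⁻¹ ∘ *m`, and unit, counit and antipode are the transposes of counit, unit and
antipode. -/
def leftDual [BijectiveAntipode k H] [Module.Finite k R] (A : HopfData k H R) :
    HopfData k H (Module.Dual k R) where
  toYDData := A.toYDData.leftDual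
  mul := A.comul.dualMap ∘ₗ (dualTensor k R R).toLinearMap ∘ₗ
    A.toYDData.leftDual.braidingInv A.toYDData.leftDual
  unit := A.counit.dualMap ∘ₗ LinearMap.toSpanSingleton k (Module.Dual k k) LinearMap.id
  comul := A.toYDData.leftDual.braiding A.toYDData.leftDual ∘ₗ
    (dualTensor k R R).symm.toLinearMap ∘ₗ A.mul.dualMap
  counit := Module.Dual.eval k k 1 ∘ₗ A.unit.dualMap
  antipode := A.antipode.dualMap

/-- `I` is a two-sided ideal, coideal and Yetter-Drinfeld submodule, stable under the antipode. -/
structure IsHopfIdeal (A : HopfData k H R) (I : Submodule k R) : Prop where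
  act_mem : ∀ h, ∀ x ∈ I, A.act h x ∈ I
  coact_mem : ∀ x ∈ I, TensorProduct.map LinearMap.id I.mkQ (A.coact x) = 0
  mul_mem_left : ∀ x, ∀ y ∈ I, A.mul (x ⊗ₜ y) ∈ I
  mul_mem_right : ∀ x ∈ I, ∀ y, A.mul (x ⊗ₜ y) ∈ I
  comul_mem : ∀ x ∈ I, TensorProduct.map I.mkQ I.mkQ (A.comul x) = 0
  counit_mem : ∀ x ∈ I, A.counit x = 0
  antipode_mem : ∀ x ∈ I, A.antipode x ∈ I

/-- The quotient by a Hopf ideal, with the induced structure maps. -/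
def quotient (A : HopfData k H R) (I : Submodule k R) (hI : A.IsHopfIdeal I) :
    HopfData k H (R ⧸ I) where
  act :=
    { toFun := fun h => I.mapQ I (A.act h) fun x hx => hI.act_mem h x hx
      map_add' := fun g h => by ext; simp
      map_smul' := fun a h => by ext; simp }
  coact := I.liftQ (TensorProduct.map LinearMap.id I.mkQ ∘ₗ A.coact)
    fun x hx => hI.coact_mem x hx
  mul := TensorProduct.lift <| I.liftQ
    { toFun := fun x => I.mapQ I (A.mul ∘ₗ TensorProduct.mk k R R x)
        fun y hy => hI.mul_mem_left x y hy
      map_add' := fun x y => by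
        ext z
        change I.mkQ (A.mul ((x + y) ⊗ₜ z)) = I.mkQ (A.mul (x ⊗ₜ z)) + I.mkQ (A.mul (y ⊗ₜ z))
        rw [TensorProduct.add_tmul, map_add, map_add]
      map_smul' := fun a x => by
        ext z
        change I.mkQ (A.mul ((a • x) ⊗ₜ z)) = a • I.mkQ (A.mul (x ⊗ₜ z))
        rw [← TensorProduct.smul_tmul', map_smul, map_smul] }
    fun x hx => by
      ext y
      exact (Submodule.Quotient.mk_eq_zero I).2 (hI.mul_mem_right x hx y)
  unit := I.mkQ ∘ₗ A.unit
  comul := I.liftQ (TensorProduct.map I.mkQ I.mkQ ∘ₗ A.comul) fun x hx => hI.comul_mem x hx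
  counit := I.liftQ A.counit fun x hx => hI.counit_mem x hx
  antipode := I.mapQ I A.antipode fun x hx => hI.antipode_mem x hx

end HopfData

/-! ### The tensor algebra as a Hopf algebra in Yetter-Drinfeld modules -/

namespace YDData

variable {V : Type w} [AddCommGroup V] [Module k V]

/-- The action on `T(V)` with `h · 1 = ε(h)` and `h · (xy) = (h₍₁₎ · x)(h₍₂₎ · y)`: the map
`x ↦ (h ↦ h · x)` is the algebra map to the convolution algebra `Hom(H, T(V))` extending the
action on `V`. -/
def tensorAct (s : YDData k H V) : H →ₗ[k] TensorAlgebra k V →ₗ[k] TensorAlgebra k V :=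
  LinearMap.flip
    { toFun := fun x => (TensorAlgebra.lift k
        ({ toFun := fun v => WithConv.toConv (TensorAlgebra.ι k ∘ₗ s.act.flip v)
           map_add' := fun v w => by ext; simp
           map_smul' := fun a v => by ext; simp } :
          V →ₗ[k] WithConv (H →ₗ[k] TensorAlgebra k V)) x).ofConv
      map_add' := fun x y => by simp
      map_smul' := fun a x => by simp }

/-- The coaction on `T(V)`: the algebra map `T(V) → H ⊗ T(V)` extending the coaction on `V`. -/
def tensorCoact (s : YDData k H V) : TensorAlgebra k V →ₗ[k] H ⊗[k] TensorAlgebra k V :=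
  (TensorAlgebra.lift k (TensorProduct.map LinearMap.id (TensorAlgebra.ι k) ∘ₗ s.coact)).toLinearMap

/-- Left multiplication by `v ⊗ 1 + 1 ⊗ v` in the braided tensor product algebra `T(V) ⊗ T(V)`:
`a ⊗ b ↦ va ⊗ b + (v₍₋₁₎ · a) ⊗ v₍₀₎b`. -/
def primitiveMul (s : YDData k H V) :
    V →ₗ[k] Module.End k (TensorAlgebra k V ⊗[k] TensorAlgebra k V) :=
  (TensorProduct.mapBilinear (RingHom.id k) _ _ _ _).flip LinearMap.id ∘ₗ
      LinearMap.mul k (TensorAlgebra k V) ∘ₗ TensorAlgebra.ι k +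
    TensorProduct.homTensorHomMap (RingHom.id k) _ _ _ _ ∘ₗ
      TensorProduct.map s.tensorAct (LinearMap.mul k (TensorAlgebra k V) ∘ₗ TensorAlgebra.ι k) ∘ₗ
      s.coact

/-- The comultiplication of `T(V)`: the algebra map to the braided tensor product algebra with
`Δ(v) = v ⊗ 1 + 1 ⊗ v`, i.e. `Δ(1) = 1 ⊗ 1` and `Δ(v x) = (v ⊗ 1 + 1 ⊗ v) Δ(x)`. -/
def tensorComul (s : YDData k H V) :
    TensorAlgebra k V →ₗ[k] TensorAlgebra k V ⊗[k] TensorAlgebra k V :=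
  LinearMap.applyₗ (1 ⊗ₜ 1) ∘ₗ (TensorAlgebra.lift k s.primitiveMul).toLinearMap

/-- `y ↦ m(S ⊗ S)c(v ⊗ x) = -(v₍₋₁₎ · y) v₍₀₎`, where `y = S(x)`. -/
def antipodeStep (s : YDData k H V) : V →ₗ[k] Module.End k (TensorAlgebra k V) :=
  -(TensorProduct.lift (LinearMap.mk₂ k
      (fun (h : H) (v : V) =>
        (LinearMap.mulRight k (TensorAlgebra.ι k v) ∘ₗ s.tensorAct h :
          Module.End k (TensorAlgebra k V)))
      (fun g h v => by ext; simp [add_mul]) (fun a h v => by ext; simp)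
      (fun h v w => by ext; simp [mul_add]) (fun a h v => by ext; simp)) ∘ₗ s.coact)

/-- The antipode of `T(V)`: `S(1) = 1`, `S(v) = -v` and `S ∘ m = m ∘ (S ⊗ S) ∘ c`, i.e.
`S(v x) = -(v₍₋₁₎ · S(x)) v₍₀₎`. -/
def tensorAntipode (s : YDData k H V) : TensorAlgebra k V →ₗ[k] TensorAlgebra k V :=
  LinearMap.applyₗ 1 ∘ₗ (TensorAlgebra.lift k s.antipodeStep).toLinearMap

/-- The tensor algebra of a Yetter-Drinfeld module, in which the elements of `V` are primitive. -/
def tensorHopf (s : YDData k H V) : HopfData k H (TensorAlgebra k V) where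
  act := s.tensorAct
  coact := s.tensorCoact
  mul := LinearMap.mul' k (TensorAlgebra k V)
  unit := Algebra.linearMap k (TensorAlgebra k V)
  comul := s.tensorComul
  counit := TensorAlgebra.algebraMapInv.toLinearMap
  antipode := s.tensorAntipode

end YDData

/-! ### Quantum symmetrizers -/

section Symmetrizer

variable {V : Type w} [AddCommGroup V] [Module k V]

/-- `x ⊗ y ↦ v₀ ⊗ ⋯ ⊗ x ⊗ ⋯ ⊗ y ⊗ ⋯ ⊗ vₙ₋₁`, with `x` in position `a` and `y` in position `b`. -/
def insertPair {n : ℕ} (a b : Fin n) (hab : a ≠ b) (v : Fin n → V) :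
    V ⊗[k] V →ₗ[k] ⨂[k]^n V :=
  TensorProduct.lift (LinearMap.mk₂ k
    (fun x y => PiTensorProduct.tprod k (Function.update (Function.update v a x) b y))
    (fun x x' y => by simp [Function.update_comm hab])
    (fun c x y => by simp [Function.update_comm hab])
    (fun x y y' => by simp)
    (fun c x y => by simp))

theorem insertPair_update {n : ℕ} (a b : Fin n) (hab : a ≠ b) (v : Fin n → V) (i : Fin n)
    (hi : i = a ∨ i = b) (z : V) :
    insertPair (k := k) a b hab (Function.update v i z) = insertPair a b hab v := by
  ext x y
  rcases hi with rfl | rfl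
  · simp [insertPair]
  · simp [insertPair, Function.update_comm hab]

theorem insertPair_update_add {n : ℕ} (a b : Fin n) (hab : a ≠ b) (v : Fin n → V) (i : Fin n)
    (ha : i ≠ a) (hb : i ≠ b) (z z' : V) :
    insertPair (k := k) a b hab (Function.update v i (z + z')) =
      insertPair a b hab (Function.update v i z) +
        insertPair a b hab (Function.update v i z') := by
  ext x y
  simp [insertPair, Function.update_comm ha, Function.update_comm hb]

theorem insertPair_update_smul {n : ℕ} (a b : Fin n) (hab : a ≠ b) (v : Fin n → V) (i : Fin n)
    (ha : i ≠ a) (hb : i ≠ b) (r : k) (z : V) :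
    insertPair (k := k) a b hab (Function.update v i (r • z)) =
      r • insertPair a b hab (Function.update v i z) := by
  ext x y
  simp [insertPair, Function.update_comm ha, Function.update_comm hb]

/-- The endomorphism `id ⊗ ⋯ ⊗ c ⊗ ⋯ ⊗ id` of `V^{⊗n}`, with `c` acting on the distinct factors
in positions `a` and `b`. -/
def applyAt (c : V ⊗[k] V →ₗ[k] V ⊗[k] V) {n : ℕ} (a b : Fin n) (hab : a ≠ b) :
    Module.End k (⨂[k]^n V) :=
  PiTensorProduct.lift <| MultilinearMap.mk' (fun v => insertPair a b hab v (c (v a ⊗ₜ v b)))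
    (fun v i x y => by
      by_cases ha : i = a
      · subst ha
        simp [insertPair_update, hab.symm, TensorProduct.add_tmul]
      by_cases hb : i = b
      · subst hb
        simp [insertPair_update, hab, TensorProduct.tmul_add]
      simp [insertPair_update_add a b hab v i ha hb, Ne.symm ha, Ne.symm hb])
    (fun v i r x => by
      by_cases ha : i = a
      · subst ha
        simp [insertPair_update, hab.symm, ← TensorProduct.smul_tmul']
      by_cases hb : i = b
      · subst hb
        simp [insertPair_update, hab]
      simp [insertPair_update_smul a b hab v i ha hb, Ne.symm ha, Ne.symm hb])

/-- The generator `σᵢ` of the braid group acting on `V^{⊗n}`: `c` acts on the factors in positions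
`i` and `i + 1` (counted from `0`); only the values for `i + 1 < n` are used. -/
def braidGen (c : V ⊗[k] V →ₗ[k] V ⊗[k] V) (n i : ℕ) : Module.End k (⨂[k]^n V) :=
  if h : i + 1 < n then
    applyAt c ⟨i, Nat.lt_of_succ_lt h⟩ ⟨i + 1, h⟩ (by simp)
  else 1

/-- A reduced word of `x ∈ Sₙ` in the adjacent transpositions `τᵢ = (i, i + 1)`, `0 ≤ i < n - 1`:
the concatenation for `j = 0, …, n - 1` of the runs `τ_{j-1} τ_{j-2} ⋯ τ_{j-r}`, where
`r = #{i < j | x⁻¹(i) > x⁻¹(j)}`. Its length is the number of inversions of `x`. -/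
def reducedWord {n : ℕ} (x : Equiv.Perm (Fin n)) : List ℕ :=
  (List.finRange n).flatMap fun j =>
    (List.range (Finset.univ.filter fun i => i < j ∧ x.symm j < x.symm i).card).map
      fun t => (j : ℕ) - 1 - t

/-- The endomorphism `σ_{i₁} ∘ ⋯ ∘ σ_{iᵣ}` of `V^{⊗n}` attached to `x ∈ Sₙ` with reduced word
`τ_{i₁} ⋯ τ_{iᵣ}`, that is, the action of the Matsumoto section of `x` in the braid group. -/
def braidLift (c : V ⊗[k] V →ₗ[k] V ⊗[k] V) {n : ℕ} (x : Equiv.Perm (Fin n)) :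
    Module.End k (⨂[k]^n V) :=
  ((reducedWord x).map (braidGen c n)).prod

/-- The quantum symmetrizer `𝔖ⁿ = ∑_{x ∈ Sₙ} s(x)` on `V^{⊗n}`. -/
def symmetrizer (c : V ⊗[k] V →ₗ[k] V ⊗[k] V) (n : ℕ) : Module.End k (⨂[k]^n V) :=
  ∑ x : Equiv.Perm (Fin n), braidLift c x

end Symmetrizer

/-! ### Nichols algebras -/

namespace YDData

variable {V : Type w} [AddCommGroup V] [Module k V]

/-- The subspace `⨁ₙ ker 𝔖ⁿ` of `T(V)`. -/
def nicholsIdeal (s : YDData k H V) : Submodule k (TensorAlgebra k V) :=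
  ⨆ n : ℕ, (LinearMap.ker (symmetrizer (s.braiding s) n)).map TensorPower.toTensorAlgebra

/-- The underlying space `T(V) / ⨁ₙ ker 𝔖ⁿ` of the Nichols algebra of `V`. -/
abbrev NicholsSpace (s : YDData k H V) : Type (max u w) := TensorAlgebra k V ⧸ s.nicholsIdeal

/-- The Nichols algebra of `V`, as a quotient Hopf algebra of `T(V)`. -/
def nichols (s : YDData k H V) (hs : s.tensorHopf.IsHopfIdeal s.nicholsIdeal) :
    HopfData k H s.NicholsSpace :=
  s.tensorHopf.quotient s.nicholsIdeal hs

end YDData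

end YetterDrinfeld

end BraidedHopf

end

/-! The skew derivations `∂_f = (id ⊗ f)Δ` of `T(V)`, with `f` in the dual of `V`, define a pairing
of `T(*V)` with `T(V)` by `⟨f₁ ⋯ fₙ, x⟩ = ε(∂_{fₙ} ⋯ ∂_{f₁} x)`. The Nichols algebras of `V` and
`*V` are the quotients by the two radicals of this one pairing, and the induced pairing of the
quotients identifies the second with the dual of the first.

Radicals. The quantum symmetrizer factors as `𝔖ⁿ⁺¹ = (𝔖ⁿ ⊗ id) ∘ shuffle`, and contracting the last
factor of the shuffle with `f` yields `∂_f` (`contractLast_symmetrizer`,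
`contractLast_braidShuffle`). By induction on the degree, `⨁ ker 𝔖ⁿ` is the radical in `T(V)`
(`mem_nicholsIdeal`). Left multiplication by `v` on `T(V)` is adjoint to the skew derivation `∂_v`
of `T(*V)`, so the pairing built from `*V` with the roles exchanged is the same form (`pair_dual`);
its other radical is therefore the Nichols ideal of `*V`.

Hopf structure. The pairing exchanges products and coproducts in crossed order (`pair_mul`,
`pair_apply_mul`) and is compatible with actions, coactions and antipodes (`pair_act`, `pair_coact`,
`pair_antipode`). Hence the radical is a Hopf ideal, and `F ↦ ⟨F, ·⟩` is a morphism `T(*V) →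
(*𝔅(V))ᵇᵒᵖ`: the braiding in `bop` cancels the `c⁻¹` in the structure of `*R`, so product and
coproduct of `(*R)ᵇᵒᵖ` are plain transposes along `φ`. Since `𝔅(V)` is finite dimensional the
morphism is onto, and its kernel is the Nichols ideal of `*V`. The Hopf axioms are proved for tensor
algebras only and carried along surjections, which also gives them for `(*𝔅(V))ᵇᵒᵖ`.

Sweedler notation for elements of `H` is replaced by matrices `t` with `Δ(tᵢⱼ) = ∑ tᵢₗ ⊗ tₗⱼ`, whose
entries span `H`. -/

open scoped TensorProduct

noncomputable section

namespace BraidedHopf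

universe u v w w₁ w₂

/-! ### Comatrices: Sweedler calculus in matrix form -/

section Comatrix

variable {k : Type u} {H : Type v} [Field k] [Ring H] [HopfAlgebra k H]
variable {ι : Type*} [Fintype ι] [DecidableEq ι]

/-- A square matrix of elements of `H` with `Δ(tᵢⱼ) = ∑ₗ tᵢₗ ⊗ tₗⱼ` and `ε(tᵢⱼ) = δᵢⱼ`. -/
structure IsComatrix (k : Type u) {H : Type v} [Field k] [Ring H] [HopfAlgebra k H]
    {ι : Type*} [Fintype ι] [DecidableEq ι] (t : ι → ι → H) : Prop where
  comul : ∀ i j, Coalgebra.comul (R := k) (t i j) = ∑ l, t i l ⊗ₜ[k] t l j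
  counit : ∀ i j, Coalgebra.counit (R := k) (t i j) = if i = j then 1 else 0

/-- The coefficients of a left coaction in a family with dual functionals form a comatrix. -/
theorem isComatrix_of_coaction {M : Type w} [AddCommGroup M] [Module k M]
    (δ : M →ₗ[k] H ⊗[k] M)
    (hδ : (TensorProduct.assoc k H H M).toLinearMap ∘ₗ
        TensorProduct.map Coalgebra.comul LinearMap.id ∘ₗ δ =
      TensorProduct.map LinearMap.id δ ∘ₗ δ)
    (hε : (TensorProduct.lid k M).toLinearMap ∘ₗ
      TensorProduct.map Coalgebra.counit LinearMap.id ∘ₗ δ = LinearMap.id)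
    (m : ι → M) (φ : ι → Module.Dual k M) (hφ : ∀ i j, φ i (m j) = if i = j then 1 else 0)
    (t : ι → ι → H) (ht : ∀ j, δ (m j) = ∑ i, t j i ⊗ₜ m i) : IsComatrix k t where
  comul i j := by
    -- Applying `φ j` to the last leg of the coassociativity law isolates one matrix entry.
    have h := congrArg ((TensorProduct.rid k (H ⊗[k] H)).toLinearMap ∘ₗ
      TensorProduct.map LinearMap.id (φ j) ∘ₗ
      (TensorProduct.assoc k H H M).symm.toLinearMap) (LinearMap.congr_fun hδ (m i))
    simpa [ht, map_sum, hφ, TensorProduct.sum_tmul, TensorProduct.tmul_sum] using h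
  counit i j := by
    have h := congrArg (φ j) (LinearMap.congr_fun hε (m i))
    simpa [ht, map_sum, hφ, eq_comm] using h

/-- Every element of `H` is a combination of entries of comatrices. -/
theorem mem_span_comatrix (h : H) :
    ∃ (n : ℕ) (t : Fin n → Fin n → H), IsComatrix k t ∧
      h ∈ Submodule.span k (Set.range fun p : Fin n × Fin n => t p.1 p.2) := by
  classical
  set e := Module.Basis.ofVectorSpace k H with he
  obtain ⟨a, ha⟩ := TensorProduct.eq_repr_basis_left e (Coalgebra.comul (R := k) h)
  -- With `Δ h = ∑ eᵢ ⊗ aᵢ`, the `aᵢ` span a finite-dimensional left coideal containing `h`. The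
  -- comatrix sought consists of its matrix coefficients.
  set W : Submodule k H := Submodule.span k (a.support.image a : Set H) with hW
  have haW : ∀ i, a i ∈ W := fun i => by
    by_cases hi : a i = 0
    · rw [hi]; exact W.zero_mem
    · exact Submodule.subset_span
        (Finset.mem_coe.2 (Finset.mem_image_of_mem _ (Finsupp.mem_support_iff.2 hi)))
  have hfin : Module.Finite k W := Module.Finite.iff_fg.2 ⟨_, rfl⟩
  obtain ⟨π, hπ⟩ := W.subtype.exists_leftInverse_of_injective W.ker_subtype
  -- the coefficients of `Δ h`
  have hac : ∀ i, a i = TensorProduct.lid k H ((e.coord i).rTensor H (Coalgebra.comul h)) := by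
    intro i
    rw [← ha, Finsupp.sum, map_sum, map_sum, Finset.sum_eq_single i]
    · simp
    · intro j _ hj; simp [hj]
    · intro hi; simp [Finsupp.notMem_support_iff.1 hi]
  -- Compare the coefficients of `e i` in `(id ⊗ Δ)Δ h = (Δ ⊗ id)Δ h`: the right-hand side has its
  -- last leg in `W`.
  have hstable : ∀ i, (Coalgebra.comul (R := k) (a i)) ∈ LinearMap.range (W.subtype.lTensor H) := by
    intro i
    have h1 : Coalgebra.comul (R := k) (a i) =
        TensorProduct.lid k (H ⊗[k] H) ((e.coord i).rTensor (H ⊗[k] H)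
          (Coalgebra.comul.lTensor H (Coalgebra.comul h))) := by
      rw [hac i]
      generalize (Coalgebra.comul (R := k) h) = z
      induction z with
      | zero => simp
      | tmul x y => simp
      | add x y hx hy => simp only [map_add, hx, hy]
    rw [h1, ← Coalgebra.coassoc_apply, ← ha, Finsupp.sum, map_sum, map_sum, map_sum, map_sum]
    refine Submodule.sum_mem _ fun j _ => ?_
    simp only [LinearMap.rTensor_tmul]
    generalize (Coalgebra.comul (R := k) (e j)) = z
    induction z with
    | zero => simp
    | tmul x y =>
      simp only [TensorProduct.assoc_tmul, LinearMap.rTensor_tmul, TensorProduct.lid_tmul]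
      exact ⟨(e.coord i x • y) ⊗ₜ ⟨a j, haW j⟩, by simp [TensorProduct.smul_tmul']⟩
    | add x y hx hy =>
      simp only [TensorProduct.add_tmul, map_add]
      exact Submodule.add_mem _ hx hy
  have hWstable : ∀ w ∈ W, (Coalgebra.comul (R := k) w) ∈
      LinearMap.range (W.subtype.lTensor H) := by
    intro w hw
    induction hw using Submodule.span_induction with
    | mem x hx =>
      obtain ⟨i, _, rfl⟩ : ∃ i, a i ≠ 0 ∧ a i = x := by simpa using hx
      exact hstable i
    | zero => simp
    | add x y _ _ hx hy => rw [map_add]; exact Submodule.add_mem _ hx hy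
    | smul c x _ hx => rw [map_smul]; exact Submodule.smul_mem _ c hx
  set b := Module.finBasis k W
  set m : Fin (Module.finrank k W) → H := fun i => b i
  set φ : Fin (Module.finrank k W) → Module.Dual k H := fun i => b.coord i ∘ₗ π
  have hπ' : ∀ x : W, π x = x := fun x => LinearMap.congr_fun hπ x
  have hφ : ∀ i j, φ i (m j) = if i = j then 1 else 0 := fun i j => by
    simp [φ, m, hπ', Finsupp.single_apply, eq_comm]
  set t : Fin (Module.finrank k W) → Fin (Module.finrank k W) → H := fun j i =>
    TensorProduct.rid k H ((φ i).lTensor H (Coalgebra.comul (m j)))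
  have ht : ∀ j, Coalgebra.comul (R := k) (m j) = ∑ i, t j i ⊗ₜ m i := by
    intro j
    obtain ⟨z, hz⟩ := hWstable (m j) (b j).2
    simp only [t, ← hz]
    clear hz
    induction z with
    | zero => simp
    | tmul x y =>
      have hy : (y : H) = ∑ i, b.repr y i • m i := by
        conv_lhs => rw [← b.sum_repr y]
        rw [AddSubmonoidClass.coe_finsetSum]
        rfl
      rw [LinearMap.lTensor_tmul, Submodule.subtype_apply]
      conv_lhs => rw [hy]
      simp [φ, hπ', TensorProduct.tmul_sum, TensorProduct.smul_tmul']
    | add x y hx hy =>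
      rw [map_add]
      conv_lhs => rw [hx, hy]
      rw [← Finset.sum_add_distrib]
      refine Finset.sum_congr rfl fun i _ => ?_
      rw [map_add, map_add, TensorProduct.add_tmul]
  refine ⟨_, t, isComatrix_of_coaction Coalgebra.comul ?_ ?_ m φ hφ t ht, ?_⟩
  · exact Coalgebra.coassoc
  · ext x; simpa [LinearMap.rTensor] using
      congrArg (TensorProduct.lid k H) (Coalgebra.rTensor_counit_comul (R := k) x)
  · have hmem : ∀ w ∈ W, w ∈ Submodule.span k
        (Set.range fun p : Fin (Module.finrank k W) × Fin (Module.finrank k W) => t p.1 p.2) := by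
      intro w hw
      have : w = ∑ j, b.repr ⟨w, hw⟩ j • m j := by
        conv_lhs => rw [show w = ((⟨w, hw⟩ : W) : H) from rfl, ← b.sum_repr ⟨w, hw⟩]
        rw [AddSubmonoidClass.coe_finsetSum]
        rfl
      rw [this]
      refine Submodule.sum_mem _ fun j _ => Submodule.smul_mem _ _ ?_
      -- The counit on the second leg gives `mⱼ = ∑ ε(mᵢ) tⱼᵢ`, so `W` lies in the span of the
      -- entries.
      have h2 := congrArg (TensorProduct.rid k H) (Coalgebra.lTensor_counit_comul (R := k) (m j))
      rw [ht] at h2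
      simp only [map_sum, LinearMap.lTensor_tmul, TensorProduct.rid_tmul, one_smul] at h2
      rw [← h2]
      exact Submodule.sum_mem _ fun i _ => Submodule.smul_mem _ _ (Submodule.subset_span ⟨(j, i), rfl⟩)
    refine hmem h ?_
    -- The counit on the first leg gives `h = ∑ ε(eᵢ) aᵢ`, which is in `W`.
    have h2 := congrArg (TensorProduct.lid k H) (Coalgebra.rTensor_counit_comul (R := k) h)
    rw [← ha, Finsupp.sum] at h2
    simp only [map_sum, LinearMap.rTensor_tmul, TensorProduct.lid_tmul, one_smul] at h2
    rw [← h2]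
    exact Submodule.sum_mem _ fun i _ => Submodule.smul_mem _ _ (haW i)

/-- Linear maps out of `H` which agree on entries of comatrices are equal. -/
theorem linearMap_ext_comatrix {X : Type*} [AddCommGroup X] [Module k X] {f g : H →ₗ[k] X}
    (hfg : ∀ (n : ℕ) (t : Fin n → Fin n → H), IsComatrix k t → ∀ i j, f (t i j) = g (t i j)) :
    f = g := by
  ext h
  obtain ⟨n, t, ht, hmem⟩ := mem_span_comatrix (k := k) h
  induction hmem using Submodule.span_induction with
  | mem x hx => obtain ⟨p, rfl⟩ := hx; exact hfg n t ht p.1 p.2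
  | zero => simp
  | add x y _ _ hx hy => rw [map_add, map_add, hx, hy]
  | smul c x _ hx => rw [map_smul, map_smul, hx]

namespace IsComatrix

variable {t : ι → ι → H} (ht : IsComatrix k t)
include ht

/-- The antipode axiom in matrix form; with `sum_mul_antipode` it says that `S(t)` is the inverse
matrix of `t`. -/
theorem sum_antipode_mul (i j : ι) :
    ∑ l, HopfAlgebra.antipode k (t i l) * t l j = if i = j then 1 else 0 := by
  have h := HopfAlgebra.mul_antipode_rTensor_comul_apply (R := k) (t i j)
  rw [ht.comul, ht.counit] at h
  simpa [map_sum] using h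

theorem sum_mul_antipode (i j : ι) :
    ∑ l, t i l * HopfAlgebra.antipode k (t l j) = if i = j then 1 else 0 := by
  have h := HopfAlgebra.mul_antipode_lTensor_comul_apply (R := k) (t i j)
  rw [ht.comul, ht.counit] at h
  simpa [map_sum] using h

/-- The transpose of `S(t)` is a comatrix. -/
theorem antipode : IsComatrix k fun i j => HopfAlgebra.antipode k (t j i) where
  counit i j := by rw [HopfAlgebra.counit_antipode, ht.counit]; simp [eq_comm]
  comul i j := by
    -- Over `H ⊗ H`, the matrix `A = Δ(S(t))` is a left inverse and the expected value `C` a right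
    -- inverse of `B = Δ(t)`, so they coincide.
    let A : Matrix ι ι (H ⊗[k] H) := Matrix.of fun i j => Coalgebra.comul (R := k)
      (HopfAlgebra.antipode k (t i j))
    let B : Matrix ι ι (H ⊗[k] H) := Matrix.of fun i j => Coalgebra.comul (R := k) (t i j)
    let C : Matrix ι ι (H ⊗[k] H) := Matrix.of fun i j =>
      ∑ l, HopfAlgebra.antipode k (t l j) ⊗ₜ[k] HopfAlgebra.antipode k (t i l)
    have hAB : A * B = 1 := by
      ext i j
      simp only [Matrix.mul_apply, A, B, Matrix.of_apply]
      simp_rw [← Bialgebra.comul_mul, ← map_sum, ht.sum_antipode_mul, Matrix.one_apply]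
      split_ifs <;> simp
    have hBC : B * C = 1 := by
      ext i j
      simp only [Matrix.mul_apply, Matrix.of_apply, B, C, ht.comul, Finset.sum_mul, Finset.mul_sum,
        Algebra.TensorProduct.tmul_mul_tmul]
      have : ∀ p : ι, ∑ l, ∑ r, (t i r * HopfAlgebra.antipode k (t p j)) ⊗ₜ[k]
          (t r l * HopfAlgebra.antipode k (t l p)) =
          (t i p * HopfAlgebra.antipode k (t p j)) ⊗ₜ[k] 1 := by
        intro p
        rw [Finset.sum_comm]
        simp_rw [← TensorProduct.tmul_sum, ht.sum_mul_antipode]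
        rw [Finset.sum_eq_single p] <;> simp +contextual
      have h2 : ∑ l, ∑ p, ∑ r, (t i r * HopfAlgebra.antipode k (t p j)) ⊗ₜ[k]
          (t r l * HopfAlgebra.antipode k (t l p)) = (1 : Matrix ι ι (H ⊗[k] H)) i j := by
        rw [Finset.sum_comm]
        simp_rw [this, ← TensorProduct.sum_tmul, ht.sum_mul_antipode, Matrix.one_apply]
        split_ifs <;> simp [Algebra.TensorProduct.one_def]
      exact h2
    have hAC : A = C := left_inv_eq_right_inv hAB hBC
    simpa [A, C] using congrFun (congrFun hAC j) i

end IsComatrix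

end Comatrix

/-! ### Yetter–Drinfeld modules: compatibility, left duals, inverse braiding -/

section YetterDrinfeldBasics

variable {k : Type u} {H : Type v} [Field k] [Ring H] [HopfAlgebra k H]
variable {ι : Type*} [Fintype ι] [DecidableEq ι]

section AntipodeInv

variable [BijectiveAntipode k H]

@[simp]
theorem antipodeInv_antipode (h : H) : antipodeInv k H (HopfAlgebra.antipode k h) = h :=
  (LinearEquiv.ofBijective (HopfAlgebra.antipode k : H →ₗ[k] H)
    BijectiveAntipode.bijective).symm_apply_apply h

@[simp]
theorem antipode_antipodeInv (h : H) : HopfAlgebra.antipode k (antipodeInv k H h) = h :=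
  (LinearEquiv.ofBijective (HopfAlgebra.antipode k : H →ₗ[k] H)
    BijectiveAntipode.bijective).apply_symm_apply h

theorem antipode_injective : Function.Injective (HopfAlgebra.antipode k : H →ₗ[k] H) :=
  BijectiveAntipode.bijective.1

theorem antipodeInv_one : antipodeInv k H (1 : H) = 1 :=
  antipode_injective (k := k) (by simp)

theorem antipodeInv_mul (g h : H) :
    antipodeInv k H (g * h) = antipodeInv k H h * antipodeInv k H g :=
  antipode_injective (k := k) (by simp [HopfAlgebra.antipode_mul_antidistrib])

/-- Linear maps out of `H` which agree on antipodes of entries of comatrices are equal. -/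
theorem linearMap_ext_antipode_comatrix {X : Type*} [AddCommGroup X] [Module k X]
    {f g : H →ₗ[k] X}
    (hfg : ∀ (n : ℕ) (t : Fin n → Fin n → H), IsComatrix k t → ∀ i j,
      f (HopfAlgebra.antipode k (t i j)) = g (HopfAlgebra.antipode k (t i j))) :
    f = g := by
  have h : f ∘ₗ HopfAlgebra.antipode k = g ∘ₗ HopfAlgebra.antipode k :=
    linearMap_ext_comatrix hfg
  ext x
  simpa using LinearMap.congr_fun h (antipodeInv k H x)

end AntipodeInv

namespace YDData

variable {M : Type w} [AddCommGroup M] [Module k M]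
variable {N : Type w₁} [AddCommGroup N] [Module k N]

theorem tensor_act_tmul (s : YDData k H M) (r : YDData k H N) {t : ι → ι → H}
    (ht : IsComatrix k t) (i j : ι) (m : M) (n : N) :
    (s.tensor r).act (t i j) (m ⊗ₜ n) = ∑ l, s.act (t i l) m ⊗ₜ r.act (t l j) n := by
  simp [tensor, ht.comul, map_sum, LinearMap.sum_apply]

/-- The coaction on a tensor product, on pure tensors. -/
def coactMul (M : Type w) (N : Type w₁) [AddCommGroup M] [Module k M] [AddCommGroup N]
    [Module k N] : (H ⊗[k] M) ⊗[k] (H ⊗[k] N) →ₗ[k] H ⊗[k] (M ⊗[k] N) :=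
  TensorProduct.map (LinearMap.mul' k H) LinearMap.id ∘ₗ
    (TensorProduct.tensorTensorTensorComm k H M H N).toLinearMap

@[simp]
theorem coactMul_tmul (g h : H) (m : M) (n : N) :
    coactMul M N ((g ⊗ₜ[k] m) ⊗ₜ (h ⊗ₜ n)) = (g * h) ⊗ₜ (m ⊗ₜ n) := rfl

theorem tensor_coact_tmul (s : YDData k H M) (r : YDData k H N) (m : M) (n : N) :
    (s.tensor r).coact (m ⊗ₜ n) = coactMul M N (s.coact m ⊗ₜ r.coact n) := rfl

/-- `(h ⊗ m) ⊗ n ↦ h · n ⊗ m`. -/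
def braidingAux (r : YDData k H N) (M : Type w) [AddCommGroup M] [Module k M] :
    (H ⊗[k] M) ⊗[k] N →ₗ[k] N ⊗[k] M :=
  TensorProduct.map (TensorProduct.lift r.act) LinearMap.id ∘ₗ
    (TensorProduct.rightComm k H M N).toLinearMap

@[simp]
theorem braidingAux_tmul (r : YDData k H N) (h : H) (m : M) (n : N) :
    r.braidingAux M ((h ⊗ₜ m) ⊗ₜ n) = r.act h n ⊗ₜ m := rfl

theorem braiding_tmul (s : YDData k H M) (r : YDData k H N) (m : M) (n : N) :
    s.braiding r (m ⊗ₜ n) = r.braidingAux M (s.coact m ⊗ₜ n) := rfl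

section Compat

variable {s : YDData k H M}

/-- The compatibility condition `(h₍₁₎ · m)₍₋₁₎ h₍₂₎ ⊗ (h₍₁₎ · m)₍₀₎ = h₍₁₎ m₍₋₁₎ ⊗ h₍₂₎ · m₍₀₎`
for the entries of a comatrix. -/
theorem IsYetterDrinfeld.compat (hs : s.IsYetterDrinfeld) {t : ι → ι → H} (ht : IsComatrix k t)
    (p q : ι) (m : M) :
    ∑ l, TensorProduct.map (LinearMap.mulRight k (t l q)) LinearMap.id
        (s.coact (s.act (t p l) m)) =
      ∑ l, TensorProduct.map (LinearMap.mulLeft k (t p l)) (s.act (t l q)) (s.coact m) := by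
  simp only [hs.coact_act, ht.comul, map_sum, TensorProduct.map_tmul, LinearMap.id_apply,
    TensorProduct.sum_tmul]
  generalize s.coact m = z
  induction z with
  | zero => simp
  | add x y hx hy => simp only [map_add, TensorProduct.tmul_add, Finset.sum_add_distrib, hx, hy]
  | tmul g n =>
    simp only [TensorProduct.tmul_sum, TensorProduct.sum_tmul, map_sum, sandwich_tmul,
      TensorProduct.map_tmul, LinearMap.id_apply, LinearMap.mulRight_apply,
      LinearMap.mulLeft_apply]
    -- The summation index shared by `S(t)` and `t` is brought innermost, where the two factors
    -- cancel to the identity matrix.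
    rw [Finset.sum_comm]
    refine Finset.sum_congr rfl fun i _ => ?_
    rw [Finset.sum_comm]
    simp_rw [← TensorProduct.sum_tmul, mul_assoc, ← Finset.mul_sum, ht.sum_antipode_mul]
    rw [Finset.sum_eq_single q] <;> simp +contextual

/-- Converse of `IsYetterDrinfeld.compat`: multiply on the right by `S(t)` and sum. For a new object
it suffices to check a condition in which the antipode does not occur. -/
theorem coact_act_of_compat {t : ι → ι → H} (ht : IsComatrix k t) (m : M)
    (h : ∀ p q, ∑ l, TensorProduct.map (LinearMap.mulRight k (t l q)) LinearMap.id
        (s.coact (s.act (t p l) m)) =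
      ∑ l, TensorProduct.map (LinearMap.mulLeft k (t p l)) (s.act (t l q)) (s.coact m))
    (p q : ι) :
    s.coact (s.act (t p q) m) =
      s.sandwich ((TensorProduct.map LinearMap.id Coalgebra.comul
        (Coalgebra.comul (R := k) (t p q))) ⊗ₜ s.coact m) := by
  have h1 : ∀ r, TensorProduct.map (LinearMap.mulRight k (HopfAlgebra.antipode k (t r q)))
      LinearMap.id (∑ l, TensorProduct.map (LinearMap.mulRight k (t l r)) LinearMap.id
        (s.coact (s.act (t p l) m))) = ∑ l, TensorProduct.map (LinearMap.mulRight k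
          (t l r * HopfAlgebra.antipode k (t r q))) LinearMap.id (s.coact (s.act (t p l) m)) := by
    intro r
    rw [map_sum]
    refine Finset.sum_congr rfl fun l _ => ?_
    rw [← LinearMap.comp_apply, ← TensorProduct.map_comp, LinearMap.id_comp]
    congr 2
    ext x
    simp [mul_assoc]
  have h2 : ∑ r, ∑ l, TensorProduct.map (LinearMap.mulRight k
      (t l r * HopfAlgebra.antipode k (t r q))) LinearMap.id (s.coact (s.act (t p l) m)) =
      s.coact (s.act (t p q) m) := by
    rw [Finset.sum_comm, Finset.sum_eq_single q]
    · generalize s.coact (s.act (t p q) m) = z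
      induction z with
      | zero => simp
      | add x y hx hy => simp only [map_add, Finset.sum_add_distrib, hx, hy]
      | tmul g n =>
        simp only [TensorProduct.map_tmul, LinearMap.mulRight_apply, LinearMap.id_apply,
          ← TensorProduct.sum_tmul, ← Finset.mul_sum, ht.sum_mul_antipode]
        simp
    · intro l _ hl
      generalize s.coact (s.act (t p l) m) = z
      induction z with
      | zero => simp
      | add x y hx hy => simp only [map_add, Finset.sum_add_distrib, hx, hy, add_zero]
      | tmul g n =>
        simp only [TensorProduct.map_tmul, LinearMap.mulRight_apply, LinearMap.id_apply,
          ← TensorProduct.sum_tmul, ← Finset.mul_sum, ht.sum_mul_antipode]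
        simp [hl]
    · simp
  simp_rw [← h2, ← h1, h]
  simp only [ht.comul, map_sum, TensorProduct.map_tmul, LinearMap.id_apply,
    TensorProduct.sum_tmul, TensorProduct.tmul_sum]
  rw [Finset.sum_comm]
  refine Finset.sum_congr rfl fun i _ => Finset.sum_congr rfl fun j _ => ?_
  generalize s.coact m = z
  induction z with
  | zero => simp
  | add x y hx hy => simp only [map_add, TensorProduct.tmul_add, hx, hy]
  | tmul g n => simp [sandwich_tmul, mul_assoc]

end Compat

section Coefficients

variable (s : YDData k H M) (b : Module.Basis ι k M)

/-- The matrix coefficients of the coaction in a basis: `δ(bⱼ) = ∑ᵢ uⱼᵢ ⊗ bᵢ`. -/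
def coeff (j i : ι) : H := TensorProduct.rid k H ((b.coord i).lTensor H (s.coact (b j)))

theorem coact_basis (j : ι) : s.coact (b j) = ∑ i, s.coeff b j i ⊗ₜ b i := by
  obtain ⟨a, ha⟩ := TensorProduct.eq_repr_basis_right b (s.coact (b j))
  simp only [coeff, ← ha]
  rw [Finsupp.sum_fintype _ _ (by simp)]
  refine Finset.sum_congr rfl fun i _ => ?_
  congr 1
  simp [map_sum, Finsupp.single_apply]

variable {s} in
theorem IsYetterDrinfeld.isComatrix_coeff (hs : s.IsYetterDrinfeld) :
    IsComatrix k (s.coeff b) :=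
  isComatrix_of_coaction s.coact hs.coassoc hs.counit_coact b b.coord
    (fun i j => by simp [Finsupp.single_apply, eq_comm]) _ (s.coact_basis b)

-- Converse of `isComatrix_coeff`. It serves for the left dual, whose coefficients are the antipodes
-- of the transposed coefficients.
variable {s b} in
theorem coassoc_of_isComatrix {t : ι → ι → H} (ht : IsComatrix k t)
    (h : ∀ j, s.coact (b j) = ∑ i, t j i ⊗ₜ b i) :
    (TensorProduct.assoc k H H M).toLinearMap ∘ₗ
        TensorProduct.map Coalgebra.comul LinearMap.id ∘ₗ s.coact =
      TensorProduct.map LinearMap.id s.coact ∘ₗ s.coact := by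
  refine b.ext fun j => ?_
  simp only [LinearMap.comp_apply, h, map_sum, TensorProduct.map_tmul, ht.comul,
    TensorProduct.sum_tmul, TensorProduct.tmul_sum, LinearMap.id_apply, LinearEquiv.coe_coe,
    TensorProduct.assoc_tmul]
  exact Finset.sum_comm

variable {s b} in
theorem counit_coact_of_isComatrix {t : ι → ι → H} (ht : IsComatrix k t)
    (h : ∀ j, s.coact (b j) = ∑ i, t j i ⊗ₜ b i) :
    (TensorProduct.lid k M).toLinearMap ∘ₗ
      TensorProduct.map Coalgebra.counit LinearMap.id ∘ₗ s.coact = LinearMap.id := by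
  refine b.ext fun j => ?_
  simp [h, map_sum, ht.counit]

end Coefficients

section LeftDual

variable [BijectiveAntipode k H] [Module.Finite k M] (s : YDData k H M)

theorem leftDual_act_apply (h : H) (f : Module.Dual k M) (x : M) :
    s.leftDual.act h f x = f (s.act (antipodeInv k H h) x) := rfl

/-- Testing the dual action on elements `S(h)` removes `S⁻¹`, so no formula for the coproduct of
`S⁻¹` is needed. -/
theorem leftDual_act_antipode (h : H) (f : Module.Dual k M) :
    s.leftDual.act (HopfAlgebra.antipode k h) f = f ∘ₗ s.act h := by
  ext x; simp [leftDual_act_apply]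

/-- `h ⊗ f ↦ f(x) h`. -/
def evalRight (H : Type v) [Ring H] [HopfAlgebra k H] (x : M) :
    H ⊗[k] Module.Dual k M →ₗ[k] H :=
  (TensorProduct.rid k H).toLinearMap ∘ₗ TensorProduct.map LinearMap.id (Module.Dual.eval k M x)

omit [BijectiveAntipode k H] [Module.Finite k M] in
@[simp]
theorem evalRight_tmul (x : M) (h : H) (f : Module.Dual k M) :
    evalRight H x (h ⊗ₜ f) = f x • h := rfl

/-- `h ⊗ x ↦ f(x) S(h)`. -/
def antipodeEval (H : Type v) [Ring H] [HopfAlgebra k H] (f : Module.Dual k M) :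
    H ⊗[k] M →ₗ[k] H :=
  (TensorProduct.rid k H).toLinearMap ∘ₗ TensorProduct.map (HopfAlgebra.antipode k) f

omit [BijectiveAntipode k H] [Module.Finite k M] in
@[simp]
theorem antipodeEval_tmul (f : Module.Dual k M) (h : H) (x : M) :
    antipodeEval H f (h ⊗ₜ x) = f x • HopfAlgebra.antipode k h := rfl

/-- `f₍₋₁₎ f₍₀₎(x) = S(x₍₋₁₎) f(x₍₀₎)`. -/
theorem evalRight_leftDual_coact (f : Module.Dual k M) (x : M) :
    evalRight H x (s.leftDual.coact f) = antipodeEval H f (s.coact x) := by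
  conv_rhs => rw [← (Module.finBasis k M).sum_repr x]
  change evalRight H x (∑ i, TensorProduct.map (HopfAlgebra.antipode k)
        (LinearMap.smulRight f ((Module.finBasis k M).coord i)) (s.coact (Module.finBasis k M i)))
    = _
  rw [map_sum, map_sum, map_sum]
  refine Finset.sum_congr rfl fun i _ => ?_
  rw [map_smul, map_smul]
  generalize s.coact (Module.finBasis k M i) = z
  induction z with
  | zero => simp
  | add x y hx hy => simp only [map_add, smul_add, hx, hy]
  | tmul g n => simp [smul_smul, mul_comm]

omit [DecidableEq ι] [BijectiveAntipode k H] [Module.Finite k M] in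
theorem eq_sum_evalRight (b : Module.Basis ι k M) (z : H ⊗[k] Module.Dual k M) :
    z = ∑ i, evalRight H (b i) z ⊗ₜ b.coord i := by
  induction z with
  | zero => simp
  | add x y hx hy =>
    simp only [map_add, TensorProduct.add_tmul, Finset.sum_add_distrib]
    rw [← hx, ← hy]
  | tmul g f =>
    simp only [evalRight_tmul, TensorProduct.smul_tmul, ← TensorProduct.tmul_sum]
    congr 1
    refine b.ext fun j => ?_
    simp

-- Makes `evalRight_leftDual_coact` a characterization of the dual coaction, independent of the
-- basis in its definition.
omit [BijectiveAntipode k H] in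
theorem evalRight_ext {z z' : H ⊗[k] Module.Dual k M}
    (h : ∀ x, evalRight H x z = evalRight H x z') : z = z' := by
  rw [eq_sum_evalRight (Module.finBasis k M) z, eq_sum_evalRight (Module.finBasis k M) z']
  exact Finset.sum_congr rfl fun i _ => by rw [h]

theorem leftDual_coact_coord (b : Module.Basis ι k M) (j : ι) :
    s.leftDual.coact (b.coord j) = ∑ i, HopfAlgebra.antipode k (s.coeff b i j) ⊗ₜ b.coord i := by
  rw [eq_sum_evalRight b (s.leftDual.coact (b.coord j))]
  refine Finset.sum_congr rfl fun i _ => ?_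
  rw [evalRight_leftDual_coact, s.coact_basis b]
  simp [map_sum, Finsupp.single_apply]

variable {s} in
/-- The left dual of a Yetter-Drinfeld module is a Yetter-Drinfeld module. -/
theorem IsYetterDrinfeld.leftDual (hs : s.IsYetterDrinfeld) : s.leftDual.IsYetterDrinfeld where
  one_act f := by
    ext x
    rw [leftDual_act_apply, antipodeInv_one, hs.one_act]
  mul_act g h f := by
    ext x
    rw [leftDual_act_apply, leftDual_act_apply, leftDual_act_apply, antipodeInv_mul, hs.mul_act]
  coassoc := by
    have hu := (hs.isComatrix_coeff (Module.finBasis k M)).antipode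
    refine coassoc_of_isComatrix (b := (Module.finBasis k M).dualBasis) hu fun j => ?_
    simpa using s.leftDual_coact_coord (Module.finBasis k M) j
  counit_coact := by
    have hu := (hs.isComatrix_coeff (Module.finBasis k M)).antipode
    refine counit_coact_of_isComatrix (b := (Module.finBasis k M).dualBasis) hu fun j => ?_
    simpa using s.leftDual_coact_coord (Module.finBasis k M) j
  coact_act h f := by
    revert h
    suffices hlin : s.leftDual.coact ∘ₗ s.leftDual.act.flip f =
        s.leftDual.sandwich ∘ₗ (TensorProduct.mk k _ _).flip (s.leftDual.coact f) ∘ₗ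
          TensorProduct.map LinearMap.id Coalgebra.comul ∘ₗ Coalgebra.comul from
      fun h => LinearMap.congr_fun hlin h
    refine linearMap_ext_antipode_comatrix fun n t ht p q => ?_
    change s.leftDual.coact (s.leftDual.act (HopfAlgebra.antipode k (t p q)) f) =
      s.leftDual.sandwich (TensorProduct.map LinearMap.id Coalgebra.comul
        (Coalgebra.comul (R := k) (HopfAlgebra.antipode k (t p q))) ⊗ₜ s.leftDual.coact f)
    -- The comatrix `ht.antipode` is the transpose of `S(t)`, hence the exchanged indices `q p`.
    refine coact_act_of_compat (s := s.leftDual) ht.antipode f (fun p q => ?_) q p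
    refine evalRight_ext fun x => ?_
    simp only [leftDual_act_antipode]
    have hL : ∀ (h : H) (z : H ⊗[k] Module.Dual k M), evalRight H x
        (TensorProduct.map (LinearMap.mulRight k h) LinearMap.id z) = evalRight H x z * h := by
      intro h z
      induction z with
      | zero => simp
      | add x y hx hy => simp only [map_add, add_mul, hx, hy]
      | tmul g n => simp
    have hR : ∀ (h g : H) (z : H ⊗[k] Module.Dual k M), evalRight H x
        (TensorProduct.map (LinearMap.mulLeft k h)
          (s.leftDual.act (HopfAlgebra.antipode k g)) z) =
          h * evalRight H (s.act g x) z := by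
      intro h g z
      induction z with
      | zero => simp
      | add x y hx hy => simp only [map_add, mul_add, hx, hy]
      | tmul g' n => simp [leftDual_act_antipode]
    simp only [map_sum, hL, hR, evalRight_leftDual_coact]
    -- Evaluated at `x`, the compatibility for `*M` and `S(t)` is the image of the compatibility for
    -- `M` and `t` under `S ⊗ f`; antimultiplicativity of `S` exchanges the two sides.
    have key := congrArg (antipodeEval H f) (hs.compat ht q p x)
    simp only [map_sum] at key
    have hL' : ∀ (h g : H) (z : H ⊗[k] M), antipodeEval H f
        (TensorProduct.map (LinearMap.mulLeft k h) (s.act g) z) =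
          antipodeEval H (f ∘ₗ s.act g) z * HopfAlgebra.antipode k h := by
      intro h g z
      induction z with
      | zero => simp
      | add x y hx hy => simp only [map_add, add_mul, hx, hy]
      | tmul g' n => simp [HopfAlgebra.antipode_mul_antidistrib]
    have hR' : ∀ (h : H) (z : H ⊗[k] M), antipodeEval H f
        (TensorProduct.map (LinearMap.mulRight k h) LinearMap.id z) =
          HopfAlgebra.antipode k h * antipodeEval H f z := by
      intro h z
      induction z with
      | zero => simp
      | add x y hx hy => simp only [map_add, mul_add, hx, hy]
      | tmul g n => simp [HopfAlgebra.antipode_mul_antidistrib]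
    simp only [hL', hR'] at key
    exact key.symm

end LeftDual

/-- The inverse braiding is a left inverse of the braiding. -/
theorem braidingInv_braiding [BijectiveAntipode k H] [Module.Finite k M] {s : YDData k H M}
    {r : YDData k H N} (hs : s.IsYetterDrinfeld) (hr : r.IsYetterDrinfeld) (z : M ⊗[k] N) :
    r.braidingInv s (s.braiding r z) = z := by
  induction z with
  | zero => simp
  | add x y hx hy => simp only [map_add, hx, hy]
  | tmul m n =>
    set b := Module.finBasis k M
    suffices h : ∀ j, r.braidingInv s (s.braiding r (b j ⊗ₜ n)) = b j ⊗ₜ n by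
      have h2 : r.braidingInv s ∘ₗ s.braiding r ∘ₗ (TensorProduct.mk k M N).flip n =
          (TensorProduct.mk k M N).flip n := b.ext h
      exact LinearMap.congr_fun h2 m
    intro j
    have hu := hs.isComatrix_coeff b
    -- Applying `S` turns this into `∑ S(uⱼᵢ) uᵢₗ`, the antipode axiom for the coefficients.
    have hsum : ∀ l, ∑ i, antipodeInv k H (s.coeff b i l) * s.coeff b j i =
        if j = l then 1 else 0 := by
      intro l
      apply antipode_injective (k := k)
      rw [map_sum]
      simp only [HopfAlgebra.antipode_mul_antidistrib, antipode_antipodeInv, hu.sum_antipode_mul]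
      split_ifs <;> simp
    rw [braiding_tmul, s.coact_basis b]
    simp only [braidingInv, TensorProduct.sum_tmul, map_sum, braidingAux_tmul,
      LinearMap.comp_apply, LinearEquiv.coe_coe, TensorProduct.comm_tmul, TensorProduct.map_tmul,
      s.coact_basis b, LinearMap.id_apply]
    have : ∀ i l, TensorProduct.comm k N M (TensorProduct.map (TensorProduct.lift
        (r.act ∘ₗ antipodeInv k H)) LinearMap.id (TensorProduct.rightComm k H M N
          ((s.coeff b i l ⊗ₜ[k] b l) ⊗ₜ[k] r.act (s.coeff b j i) n))) =
        b l ⊗ₜ r.act (antipodeInv k H (s.coeff b i l) * s.coeff b j i) n := by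
      intro i l
      rw [hr.mul_act]
      rfl
    simp only [this]
    rw [Finset.sum_comm]
    simp only [← TensorProduct.tmul_sum, ← LinearMap.sum_apply, ← map_sum, hsum]
    rw [Finset.sum_eq_single j] <;> simp +contextual [hr.one_act, eq_comm]

end YDData

end YetterDrinfeldBasics

/-! ### The tensor algebra as a Yetter–Drinfeld module -/

section TensorAlgebraYD

variable {k : Type u} {H : Type v} [Field k] [Ring H] [HopfAlgebra k H]
variable {ι : Type*} [Fintype ι] [DecidableEq ι]
variable {V : Type w} [AddCommGroup V] [Module k V]

namespace YDData

variable (s : YDData k H V)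

theorem tensorAct_one (h : H) :
    s.tensorAct h 1 = algebraMap k (TensorAlgebra k V) (Coalgebra.counit h) := by
  simp [tensorAct]

theorem tensorAct_algebraMap (h : H) (c : k) :
    s.tensorAct h (algebraMap k _ c) = algebraMap k _ (Coalgebra.counit h * c) := by
  rw [Algebra.algebraMap_eq_smul_one, map_smul, tensorAct_one, mul_comm, map_mul,
    Algebra.smul_def]

@[simp]
theorem tensorAct_ι (h : H) (v : V) :
    s.tensorAct h (TensorAlgebra.ι k v) = TensorAlgebra.ι k (s.act h v) := by
  simp [tensorAct]

/-- The product of the convolution algebra `Hom(H, T(V))` is the diagonal action, so this is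
multiplicativity of the lift. -/
theorem tensorAct_mul (h : H) (x y : TensorAlgebra k V) :
    s.tensorAct h (x * y) = LinearMap.mul' k _
      (TensorProduct.map (s.tensorAct.flip x) (s.tensorAct.flip y) (Coalgebra.comul h)) := by
  simp only [tensorAct, LinearMap.flip_apply, LinearMap.coe_mk, AddHom.coe_mk, map_mul]
  rfl

theorem tensorAct_mul_comatrix {t : ι → ι → H} (ht : IsComatrix k t) (i j : ι)
    (x y : TensorAlgebra k V) :
    s.tensorAct (t i j) (x * y) = ∑ l, s.tensorAct (t i l) x * s.tensorAct (t l j) y := by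
  simp [tensorAct_mul, ht.comul, map_sum]

variable {s} in
theorem IsYetterDrinfeld.one_tensorAct (hs : s.IsYetterDrinfeld) (x : TensorAlgebra k V) :
    s.tensorAct 1 x = x := by
  induction x using TensorAlgebra.induction with
  | algebraMap r => simp [tensorAct_algebraMap]
  | ι v => simp [hs.one_act]
  | mul a b ha hb =>
    rw [tensorAct_mul, Bialgebra.comul_one, Algebra.TensorProduct.one_def]
    simp [ha, hb]
  | add a b ha hb => rw [map_add, ha, hb]

variable {s} in
theorem IsYetterDrinfeld.mul_tensorAct (hs : s.IsYetterDrinfeld) (g h : H)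
    (x : TensorAlgebra k V) : s.tensorAct (g * h) x = s.tensorAct g (s.tensorAct h x) := by
  revert g h
  -- All entries are kept in the induction statement, because a product `a * b` is acted on through
  -- all intermediate indices.
  suffices hx : ∀ (n : ℕ) (t : Fin n → Fin n → H), IsComatrix k t → ∀ (m : ℕ)
      (r : Fin m → Fin m → H), IsComatrix k r → ∀ i j i' j',
      s.tensorAct (t i j * r i' j') x = s.tensorAct (t i j) (s.tensorAct (r i' j') x) by
    have : (LinearMap.mul k H).compr₂ (s.tensorAct.flip x) =
        s.tensorAct.compl₂ (s.tensorAct.flip x) := by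
      refine linearMap_ext_comatrix fun n t ht i j => linearMap_ext_comatrix fun m r hr i' j' => ?_
      exact hx n t ht m r hr i j i' j'
    exact fun g h => LinearMap.congr_fun₂ this g h
  intro n t ht m r hr
  induction x using TensorAlgebra.induction with
  | algebraMap c => intros; simp only [tensorAct_algebraMap, Bialgebra.counit_mul, mul_assoc]
  | ι v => simp [hs.mul_act]
  | mul a b ha hb =>
    intro i j i' j'
    rw [tensorAct_mul, Bialgebra.comul_mul, ht.comul, hr.comul]
    simp only [Finset.sum_mul, Finset.mul_sum, map_sum, Algebra.TensorProduct.tmul_mul_tmul,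
      TensorProduct.map_tmul, LinearMap.mul'_apply, LinearMap.flip_apply, ha, hb,
      s.tensorAct_mul_comatrix hr, s.tensorAct_mul_comatrix ht]
  | add a b ha hb => intro i j i' j'; simp only [map_add, ha, hb]

/-- The coaction on `T(V)` as an algebra map. -/
def tensorCoactHom : TensorAlgebra k V →ₐ[k] H ⊗[k] TensorAlgebra k V :=
  TensorAlgebra.lift k (TensorProduct.map LinearMap.id (TensorAlgebra.ι k) ∘ₗ s.coact)

theorem tensorCoact_eq (x : TensorAlgebra k V) : s.tensorCoact x = s.tensorCoactHom x := rfl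

theorem tensorCoact_mul (x y : TensorAlgebra k V) :
    s.tensorCoact (x * y) = s.tensorCoact x * s.tensorCoact y :=
  map_mul s.tensorCoactHom x y

theorem tensorCoact_one : s.tensorCoact 1 = 1 ⊗ₜ 1 := map_one s.tensorCoactHom

theorem tensorCoact_ι (v : V) : s.tensorCoact (TensorAlgebra.ι k v) =
    TensorProduct.map LinearMap.id (TensorAlgebra.ι k) (s.coact v) := by
  simp [tensorCoact]

theorem tensorCoact_ι_basis (b : Module.Basis ι k V) (j : ι) :
    s.tensorCoact (TensorAlgebra.ι k (b j)) = ∑ i, s.coeff b j i ⊗ₜ TensorAlgebra.ι k (b i) := by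
  rw [tensorCoact_ι, s.coact_basis b]
  simp [map_sum]

theorem map_mulRight_id_eq {A : Type*} [Ring A] [Algebra k A] (g : H) (z : H ⊗[k] A) :
    TensorProduct.map (LinearMap.mulRight k g) LinearMap.id z = z * g ⊗ₜ 1 := by
  induction z with
  | zero => simp
  | add x y hx hy => simp only [map_add, add_mul, hx, hy]
  | tmul h a => simp

variable {s} in
/-- The Yetter-Drinfeld compatibility on `T(V)`. -/
theorem IsYetterDrinfeld.compat_tensorAlgebra (hs : s.IsYetterDrinfeld) {t : ι → ι → H}
    (ht : IsComatrix k t) (p q : ι) (x : TensorAlgebra k V) :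
    ∑ l, TensorProduct.map (LinearMap.mulRight k (t l q)) LinearMap.id
        (s.tensorCoact (s.tensorAct (t p l) x)) =
      ∑ l, TensorProduct.map (LinearMap.mulLeft k (t p l)) (s.tensorAct (t l q))
        (s.tensorCoact x) := by
  induction x using TensorAlgebra.induction generalizing p q with
  | algebraMap c =>
    have h : ∀ c, s.tensorCoact (algebraMap k _ c) = 1 ⊗ₜ algebraMap k _ c := fun c => by
      rw [tensorCoact_eq, AlgHom.commutes, Algebra.TensorProduct.algebraMap_apply,
        Algebra.algebraMap_eq_smul_one, Algebra.algebraMap_eq_smul_one, TensorProduct.smul_tmul]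
    simp only [tensorAct_algebraMap, h, ht.counit, TensorProduct.map_tmul, LinearMap.id_apply,
      LinearMap.mulRight_apply, LinearMap.mulLeft_apply, one_mul, mul_one]
    simp only [ite_mul, zero_mul, one_mul, apply_ite (algebraMap k (TensorAlgebra k V)), map_zero, TensorProduct.tmul_ite]
    simp
  | ι v =>
    have h := congrArg (TensorProduct.map LinearMap.id (TensorAlgebra.ι k)) (hs.compat ht p q v)
    simp only [map_sum] at h
    simp only [tensorAct_ι, tensorCoact_ι]
    convert h using 2 with l _ l _
    · generalize s.coact (s.act (t p l) v) = z
      induction z with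
      | zero => simp
      | add x y hx hy => simp only [map_add, hx, hy]
      | tmul h a => simp
    · generalize s.coact v = z
      induction z with
      | zero => simp
      | add x y hx hy => simp only [map_add, hx, hy]
      | tmul h a => simp
  | add a b ha hb => simp only [map_add, Finset.sum_add_distrib, ha, hb]
  | mul x y hx hy =>
    -- The right factor `t` is moved past `y` by one induction hypothesis and then past `x` by the
    -- other.
    simp only [s.tensorAct_mul_comatrix ht, map_sum, tensorCoact_mul, map_mulRight_id_eq] at hx hy ⊢
    simp only [mul_assoc]
    rw [Finset.sum_comm]
    simp only [← Finset.mul_sum, hy]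
    generalize s.tensorCoact y = z
    induction z with
    | zero => simp
    | add z z' hz hz' =>
      simp only [map_add, mul_add, Finset.sum_add_distrib] at hz hz' ⊢
      rw [hz, hz']
    | tmul g y =>
      simp only [TensorProduct.map_tmul, LinearMap.mulLeft_apply, Finset.mul_sum]
      rw [Finset.sum_comm]
      have h1 : ∀ l, ∑ m, s.tensorCoact (s.tensorAct (t p m) x) *
          ((t m l * g) ⊗ₜ[k] s.tensorAct (t l q) y) =
          ∑ m, TensorProduct.map (LinearMap.mulLeft k (t p m)) (s.tensorAct (t m l))
            (s.tensorCoact x) * (g ⊗ₜ s.tensorAct (t l q) y) := by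
        intro l
        rw [← Finset.sum_mul, ← hx, Finset.sum_mul]
        refine Finset.sum_congr rfl fun m _ => ?_
        rw [mul_assoc, Algebra.TensorProduct.tmul_mul_tmul, one_mul]
      simp only [h1]
      generalize s.tensorCoact x = z
      induction z with
      | zero => simp
      | add z z' hz hz' =>
        simp only [map_add, add_mul, Finset.sum_add_distrib] at hz hz' ⊢
        rw [hz, hz']
      | tmul g' x =>
        simp only [TensorProduct.map_tmul, LinearMap.mulLeft_apply,
          Algebra.TensorProduct.tmul_mul_tmul, s.tensorAct_mul_comatrix ht,
          TensorProduct.tmul_sum]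
        rw [Finset.sum_comm]
        simp only [mul_assoc]

variable {s} in
/-- The tensor algebra of a finite-dimensional Yetter-Drinfeld module is a Yetter-Drinfeld
module. -/
theorem IsYetterDrinfeld.tensorHopf [Module.Finite k V] (hs : s.IsYetterDrinfeld) :
    s.tensorHopf.toYDData.IsYetterDrinfeld where
  one_act := hs.one_tensorAct
  mul_act := hs.mul_tensorAct
  coassoc := by
    have hu := hs.isComatrix_coeff (Module.finBasis k V)
    -- Both sides of coassociativity are algebra maps on `T(V)`, so they are compared on a basis of
    -- `V`.
    have h : ((Algebra.TensorProduct.assoc k k k H H (TensorAlgebra k V)).toAlgHom.comp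
        (Algebra.TensorProduct.map (Bialgebra.comulAlgHom k H) (AlgHom.id k _))).comp
          s.tensorCoactHom =
        (Algebra.TensorProduct.map (AlgHom.id k H) s.tensorCoactHom).comp s.tensorCoactHom := by
      refine TensorAlgebra.hom_ext ((Module.finBasis k V).ext fun j => ?_)
      simp only [LinearMap.comp_apply, AlgHom.toLinearMap_apply, AlgHom.comp_apply,
        ← tensorCoact_eq, s.tensorCoact_ι_basis, map_sum, Algebra.TensorProduct.map_tmul,
        Bialgebra.comulAlgHom_apply, hu.comul, TensorProduct.sum_tmul, AlgHom.id_apply,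
        TensorProduct.tmul_sum]
      rw [Finset.sum_comm]
      rfl
    exact congrArg AlgHom.toLinearMap h
  counit_coact := by
    have hu := hs.isComatrix_coeff (Module.finBasis k V)
    have h : ((Algebra.TensorProduct.lid k (TensorAlgebra k V)).toAlgHom.comp
        (Algebra.TensorProduct.map (Bialgebra.counitAlgHom k H) (AlgHom.id k _))).comp
          s.tensorCoactHom = AlgHom.id k _ := by
      refine TensorAlgebra.hom_ext ((Module.finBasis k V).ext fun j => ?_)
      simp [← tensorCoact_eq, s.tensorCoact_ι_basis, map_sum, hu.counit]
    exact congrArg AlgHom.toLinearMap h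
  coact_act h x := by
    revert h
    suffices hlin : s.tensorHopf.coact ∘ₗ s.tensorHopf.act.flip x =
        s.tensorHopf.sandwich ∘ₗ (TensorProduct.mk k _ _).flip (s.tensorHopf.coact x) ∘ₗ
          TensorProduct.map LinearMap.id Coalgebra.comul ∘ₗ Coalgebra.comul from
      fun h => LinearMap.congr_fun hlin h
    refine linearMap_ext_comatrix fun n t ht p q => ?_
    exact coact_act_of_compat (s := s.tensorHopf.toYDData) ht x
      (fun p q => hs.compat_tensorAlgebra ht p q x) p q

end YDData

end TensorAlgebraYD

/-! ### The braided coproduct of the tensor algebra -/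

section TensorAlgebraHopf

variable {k : Type u} {H : Type v} [Field k] [Ring H] [HopfAlgebra k H]
variable {ι : Type*} [Fintype ι] [DecidableEq ι]
variable {V : Type w} [AddCommGroup V] [Module k V]
variable {X : Type w₁} [AddCommGroup X] [Module k X]
variable {Y : Type w₂} [AddCommGroup Y] [Module k Y]

omit [Fintype ι] [DecidableEq ι] in
/-- A linear map intertwining the actions of the generators intertwines the actions of `T(V)`. -/
theorem tensorAlgebra_intertwine (b : Module.Basis ι k V)
    (D : TensorAlgebra k V →ₐ[k] Module.End k X) (D' : TensorAlgebra k V →ₐ[k] Module.End k Y)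
    (A : X →ₗ[k] Y)
    (h : ∀ j z, A (D (TensorAlgebra.ι k (b j)) z) = D' (TensorAlgebra.ι k (b j)) (A z))
    (x : TensorAlgebra k V) (z : X) : A (D x z) = D' x (A z) := by
  induction x using TensorAlgebra.induction generalizing z with
  | algebraMap r => simp
  | ι v =>
    have hlin : A ∘ₗ (D.toLinearMap ∘ₗ TensorAlgebra.ι k).flip z =
        (D'.toLinearMap ∘ₗ TensorAlgebra.ι k).flip (A z) := b.ext fun j => h j z
    exact LinearMap.congr_fun hlin v
  | mul a b ha hb => simp [ha, hb]
  | add a b ha hb => simp [ha, hb]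

namespace YDData

variable (s : YDData k H V)

/-- Covariance of the action of `T(V)` on `X` follows from covariance for generators. -/
theorem tensorAlgebra_covariant {t : ι → ι → H} (ht : IsComatrix k t)
    (D : TensorAlgebra k V →ₐ[k] Module.End k X) (ρ : H →ₗ[k] Module.End k X)
    (h : ∀ v z p q, ρ (t p q) (D (TensorAlgebra.ι k v) z) =
      ∑ l, D (TensorAlgebra.ι k (s.act (t p l) v)) (ρ (t l q) z))
    (x : TensorAlgebra k V) (z : X) (p q : ι) :
    ρ (t p q) (D x z) = ∑ l, D (s.tensorAct (t p l) x) (ρ (t l q) z) := by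
  induction x using TensorAlgebra.induction generalizing z p q with
  | algebraMap r =>
    simp only [tensorAct_algebraMap, AlgHom.commutes, ht.counit]
    rw [Finset.sum_eq_single p] <;> simp +contextual [eq_comm]
  | ι v => simp [h]
  | mul a b ha hb =>
    simp only [map_mul, Module.End.mul_apply, ha, hb, s.tensorAct_mul_comatrix ht, map_sum,
      LinearMap.sum_apply]
    exact Finset.sum_comm
  | add a b ha hb => simp [ha, hb, Finset.sum_add_distrib]

/-- The algebra map `x ↦ x₍₋₁₎ ⊗ D(x₍₀₎)`. -/
def coactEnd (D : TensorAlgebra k V →ₐ[k] Module.End k X) :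
    TensorAlgebra k V →ₐ[k] Module.End k (H ⊗[k] X) :=
  (Module.endTensorEndAlgHom (R := k) (A := k) (S := k) (M := H) (N := X)).comp <|
    (Algebra.TensorProduct.map (Algebra.lmul k H) D).comp s.tensorCoactHom

theorem coactEnd_ι (b : Module.Basis ι k V) (D : TensorAlgebra k V →ₐ[k] Module.End k X) (j : ι) :
    s.coactEnd D (TensorAlgebra.ι k (b j)) =
      ∑ i, TensorProduct.map (LinearMap.mulLeft k (s.coeff b j i))
        (D (TensorAlgebra.ι k (b i))) := by
  simp only [coactEnd, AlgHom.comp_apply, ← tensorCoact_eq, s.tensorCoact_ι_basis, map_sum,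
    Algebra.TensorProduct.map_tmul]
  rfl

/-- For a coinvariant `z`, this turns an intertwining property of `coactEnd` into colinearity of the
orbit map `x ↦ D x z`. -/
theorem coactEnd_one_tmul (D : TensorAlgebra k V →ₐ[k] Module.End k X) (x : TensorAlgebra k V)
    (z : X) : s.coactEnd D x (1 ⊗ₜ z) =
      TensorProduct.map LinearMap.id (D.toLinearMap.flip z) (s.tensorCoact x) := by
  simp only [coactEnd, AlgHom.comp_apply, ← tensorCoact_eq]
  generalize s.tensorCoact x = y
  induction y with
  | zero => simp
  | add x y hx hy => simp only [map_add, LinearMap.add_apply, hx, hy]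
  | tmul h x =>
    change (1 : H) |> fun g => (h * g) ⊗ₜ D x z = h ⊗ₜ D x z
    simp

/-! #### The comultiplication -/

/-- The action of `T(V)` on `T(V) ⊗ T(V)` by left multiplication with the coproduct. -/
def comulEnd : TensorAlgebra k V →ₐ[k] Module.End k (TensorAlgebra k V ⊗[k] TensorAlgebra k V) :=
  TensorAlgebra.lift k s.primitiveMul

/-- The coproduct is the orbit map of `1 ⊗ 1`. An axiom for `Δ` then becomes the statement that a
linear map intertwines two actions of `T(V)`, which need only be checked on generators. -/
theorem tensorComul_eq (x : TensorAlgebra k V) :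
    s.tensorComul x = s.comulEnd x (1 ⊗ₜ 1) := rfl

theorem tensorComul_mul' (x y : TensorAlgebra k V) :
    s.tensorComul (x * y) = s.comulEnd x (s.tensorComul y) := by
  simp [tensorComul_eq]

@[simp]
theorem tensorComul_one : s.tensorComul 1 = 1 ⊗ₜ 1 := by simp [tensorComul_eq]

/-- `h ⊗ v ↦ (h · ) ⊗ (v * )`. -/
def actMul : H ⊗[k] V →ₗ[k] Module.End k (TensorAlgebra k V ⊗[k] TensorAlgebra k V) :=
  TensorProduct.homTensorHomMap (RingHom.id k) _ _ _ _ ∘ₗ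
      TensorProduct.map s.tensorAct (LinearMap.mul k (TensorAlgebra k V) ∘ₗ TensorAlgebra.ι k)

@[simp]
theorem actMul_tmul (h : H) (v : V) (a b : TensorAlgebra k V) :
    s.actMul (h ⊗ₜ v) (a ⊗ₜ b) = s.tensorAct h a ⊗ₜ (TensorAlgebra.ι k v * b) := rfl

theorem comulEnd_ι_tmul (v : V) (a c : TensorAlgebra k V) :
    s.comulEnd (TensorAlgebra.ι k v) (a ⊗ₜ c) =
      (TensorAlgebra.ι k v * a) ⊗ₜ c + s.actMul (s.coact v) (a ⊗ₜ c) := by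
  simp [comulEnd, primitiveMul, actMul]

theorem comulEnd_ι_basis (b : Module.Basis ι k V) (j : ι) (a c : TensorAlgebra k V) :
    s.comulEnd (TensorAlgebra.ι k (b j)) (a ⊗ₜ c) =
      (TensorAlgebra.ι k (b j) * a) ⊗ₜ c +
        ∑ i, s.tensorAct (s.coeff b j i) a ⊗ₜ (TensorAlgebra.ι k (b i) * c) := by
  simp [comulEnd_ι_tmul, s.coact_basis b, map_sum, LinearMap.sum_apply]

variable {s}
variable (hs : s.IsYetterDrinfeld)
include hs

theorem IsYetterDrinfeld.actMul_act (h : H) (z : H ⊗[k] V) (a c : TensorAlgebra k V) :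
    s.actMul z (s.tensorAct h a ⊗ₜ c) =
      s.actMul (TensorProduct.map (LinearMap.mulRight k h) LinearMap.id z) (a ⊗ₜ c) := by
  induction z with
  | zero => simp
  | add x y hx hy => simp only [map_add, LinearMap.add_apply, hx, hy]
  | tmul g v => simp [hs.mul_tensorAct]

/-- For a generator `v`, the summand `va ⊗ c` needs only the diagonal action; the summand `(v₍₋₁₎ ·
a) ⊗ v₍₀₎c` is the Yetter–Drinfeld compatibility of `V`. -/
theorem IsYetterDrinfeld.comulEnd_covariant {t : ι → ι → H} (ht : IsComatrix k t)
    (x : TensorAlgebra k V) (z : TensorAlgebra k V ⊗[k] TensorAlgebra k V) (p q : ι) :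
    (s.tensorHopf.tensor s.tensorHopf.toYDData).act (t p q) (s.comulEnd x z) =
      ∑ l, s.comulEnd (s.tensorAct (t p l) x)
        ((s.tensorHopf.tensor s.tensorHopf.toYDData).act (t l q) z) := by
  refine s.tensorAlgebra_covariant ht s.comulEnd
    (s.tensorHopf.tensor s.tensorHopf.toYDData).act ?_ x z p q
  intro v z p q
  induction z with
  | zero => simp
  | add x y hx hy => simp only [map_add, hx, hy, Finset.sum_add_distrib]
  | tmul a c =>
    simp only [tensor_act_tmul _ _ ht, comulEnd_ι_tmul, map_add, map_sum, Finset.sum_add_distrib]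
    change (∑ l, s.tensorAct (t p l) (TensorAlgebra.ι k v * a) ⊗ₜ[k] s.tensorAct (t l q) c) + _ =
      (∑ l, ∑ m, (TensorAlgebra.ι k (s.act (t p l) v) * s.tensorAct (t l m) a) ⊗ₜ[k]
        s.tensorAct (t m q) c) + ∑ l, ∑ m, s.actMul (s.coact (s.act (t p l) v))
          (s.tensorAct (t l m) a ⊗ₜ s.tensorAct (t m q) c)
    congr 1
    · simp only [s.tensorAct_mul_comatrix ht, TensorProduct.sum_tmul, tensorAct_ι]
      exact Finset.sum_comm
    · rw [Finset.sum_comm]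
      simp only [hs.actMul_act, ← LinearMap.sum_apply, ← map_sum, hs.compat ht]
      generalize s.coact v = z
      induction z with
      | zero => simp
      | add x y hx hy => simp only [map_add, LinearMap.add_apply, Finset.sum_add_distrib, hx, hy]
      | tmul g w =>
        simp only [actMul_tmul, tensor_act_tmul _ _ ht, TensorProduct.map_tmul, map_sum,
          LinearMap.sum_apply, LinearMap.mulLeft_apply, hs.mul_tensorAct]
        change ∑ l, s.tensorAct (t p l) (s.tensorAct g a) ⊗ₜ[k]
          s.tensorAct (t l q) (TensorAlgebra.ι k w * c) = _
        simp only [s.tensorAct_mul_comatrix ht, TensorProduct.tmul_sum, tensorAct_ι]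
        exact Finset.sum_comm

theorem IsYetterDrinfeld.tensorComul_act (h : H) (x : TensorAlgebra k V) :
    s.tensorComul (s.tensorAct h x) =
      (s.tensorHopf.tensor s.tensorHopf.toYDData).act h (s.tensorComul x) := by
  revert h
  suffices hlin : s.tensorComul ∘ₗ s.tensorAct.flip x =
      (s.tensorHopf.tensor s.tensorHopf.toYDData).act.flip (s.tensorComul x) from
    fun h => LinearMap.congr_fun hlin h
  refine linearMap_ext_comatrix fun n t ht p q => ?_
  change s.tensorComul (s.tensorAct (t p q) x) =
    (s.tensorHopf.tensor s.tensorHopf.toYDData).act (t p q) (s.tensorComul x)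
  rw [tensorComul_eq, tensorComul_eq, hs.comulEnd_covariant ht]
  simp only [tensor_act_tmul _ _ ht]
  have h1 : ∀ h : H, s.tensorHopf.act h 1 = Coalgebra.counit (R := k) h • 1 := fun h => by
    rw [← Algebra.algebraMap_eq_smul_one]; exact s.tensorAct_one h
  -- `H` acts on `1 ⊗ 1` through the counit, so only `l = q` survives.
  have h2 : ∀ l, ∑ m, s.tensorHopf.act (t l m) 1 ⊗ₜ[k] s.tensorHopf.act (t m q) 1 =
      (if l = q then (1 : k) else 0) • (1 ⊗ₜ 1) := by
    intro l
    simp only [h1, ht.counit]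
    rw [Finset.sum_eq_single l]
    · rw [if_pos rfl]; split_ifs <;> simp
    · intro m _ hm; simp [Ne.symm hm]
    · simp
  simp only [h2, map_smul]
  simp

variable [Module.Finite k V]

theorem IsYetterDrinfeld.comulEnd_coact (x : TensorAlgebra k V)
    (z : TensorAlgebra k V ⊗[k] TensorAlgebra k V) :
    (s.tensorHopf.tensor s.tensorHopf.toYDData).coact (s.comulEnd x z) =
      s.coactEnd s.comulEnd x ((s.tensorHopf.tensor s.tensorHopf.toYDData).coact z) := by
  set b := Module.finBasis k V
  have hu := hs.isComatrix_coeff b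
  refine tensorAlgebra_intertwine b _ _ _ (fun j z => ?_) x z
  induction z with
  | zero => simp
  | add x y hx hy => simp only [map_add, hx, hy]
  | tmul a c =>
    simp only [s.comulEnd_ι_basis b, s.coactEnd_ι b, map_add, map_sum, tensor_coact_tmul,
      LinearMap.sum_apply]
    change coactMul _ _ (s.tensorCoact _ ⊗ₜ s.tensorCoact _) +
      ∑ i, coactMul _ _ (s.tensorCoact (s.tensorAct (s.coeff b j i) a) ⊗ₜ s.tensorCoact _) =
      ∑ i, TensorProduct.map _ _ (coactMul _ _ (s.tensorCoact a ⊗ₜ s.tensorCoact c))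
    simp only [tensorCoact_mul, s.tensorCoact_ι_basis b]
    generalize s.tensorCoact c = y
    induction y with
    | zero => simp
    | add x y hx hy =>
      simp only [mul_add, TensorProduct.tmul_add, map_add, Finset.sum_add_distrib] at hx hy ⊢
      rw [← hx, ← hy]
      abel
    | tmul g c =>
      -- The sum is regrouped so that the compatibility on `T(V)` applies with the coefficient
      -- comatrix of `V` itself in the role of `t`.
      have h1 : ∑ i, coactMul (TensorAlgebra k V) (TensorAlgebra k V)
          (s.tensorCoact (s.tensorAct (s.coeff b j i) a) ⊗ₜ[k]
            ((∑ l, s.coeff b i l ⊗ₜ[k] TensorAlgebra.ι k (b l)) * g ⊗ₜ c)) =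
          ∑ l, coactMul _ _ ((∑ i, TensorProduct.map (LinearMap.mulRight k (s.coeff b i l))
            LinearMap.id (s.tensorCoact (s.tensorAct (s.coeff b j i) a))) ⊗ₜ
              (g ⊗ₜ (TensorAlgebra.ι k (b l) * c))) := by
        simp only [Finset.sum_mul, TensorProduct.sum_tmul, TensorProduct.tmul_sum, map_sum]
        rw [Finset.sum_comm]
        refine Finset.sum_congr rfl fun l _ => Finset.sum_congr rfl fun i _ => ?_
        generalize s.tensorCoact (s.tensorAct (s.coeff b j i) a) = y
        induction y with
        | zero => simp
        | add x y hx hy => simp only [map_add, TensorProduct.add_tmul, hx, hy]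
        | tmul h d => simp [mul_assoc]
      rw [h1]
      simp only [hs.compat_tensorAlgebra hu]
      generalize s.tensorCoact a = y
      induction y with
      | zero => simp
      | add x y hx hy =>
        simp only [mul_add, TensorProduct.add_tmul, map_add, Finset.sum_add_distrib] at hx hy ⊢
        rw [← hx, ← hy]
        abel
      | tmul h d =>
        simp only [Finset.sum_mul, Algebra.TensorProduct.tmul_mul_tmul, TensorProduct.sum_tmul,
          map_sum, coactMul_tmul, TensorProduct.map_tmul, LinearMap.mulLeft_apply,
          s.comulEnd_ι_basis b, TensorProduct.tmul_add, TensorProduct.tmul_sum,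
          Finset.sum_add_distrib, mul_assoc]
        congr 1
        exact Finset.sum_comm

theorem IsYetterDrinfeld.tensorComul_coact (x : TensorAlgebra k V) :
    (s.tensorHopf.tensor s.tensorHopf.toYDData).coact (s.tensorComul x) =
      TensorProduct.map LinearMap.id s.tensorComul (s.tensorCoact x) := by
  rw [tensorComul_eq, hs.comulEnd_coact]
  have h : (s.tensorHopf.tensor s.tensorHopf.toYDData).coact (1 ⊗ₜ 1) = 1 ⊗ₜ (1 ⊗ₜ 1) := by
    rw [tensor_coact_tmul]
    change coactMul _ _ (s.tensorCoact _ ⊗ₜ s.tensorCoact _) = _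
    rw [tensorCoact_one]
    simp
  rw [h, coactEnd_one_tmul]
  rfl

/-- The multiplication of the braided tensor product algebra `T(V) ⊗ T(V)`. -/
theorem IsYetterDrinfeld.comulEnd_middle (x : TensorAlgebra k V)
    (w z : TensorAlgebra k V ⊗[k] TensorAlgebra k V) :
    TensorProduct.map s.tensorHopf.mul s.tensorHopf.mul
        (middle (s.tensorHopf.braiding s.tensorHopf.toYDData) (s.comulEnd x w ⊗ₜ z)) =
      s.comulEnd x (TensorProduct.map s.tensorHopf.mul s.tensorHopf.mul
        (middle (s.tensorHopf.braiding s.tensorHopf.toYDData) (w ⊗ₜ z))) := by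
  set b := Module.finBasis k V
  have hu := hs.isComatrix_coeff b
  -- For fixed `z`, right multiplication by `z` in the braided tensor product commutes with left
  -- multiplication by `Δ(x)`; as a property of `x` this is checked on generators.
  refine tensorAlgebra_intertwine b s.comulEnd s.comulEnd
    (TensorProduct.map s.tensorHopf.mul s.tensorHopf.mul ∘ₗ
      middle (s.tensorHopf.braiding s.tensorHopf.toYDData) ∘ₗ
        (TensorProduct.mk k _ _).flip z) (fun j w => ?_) x w
  simp only [LinearMap.comp_apply, LinearMap.flip_apply, TensorProduct.mk_apply]
  induction z with
  | zero => simp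
  | add x y hx hy => simp only [TensorProduct.tmul_add, map_add, hx, hy]
  | tmul c c' =>
    induction w with
    | zero => simp
    | add x y hx hy => simp only [TensorProduct.add_tmul, map_add, hx, hy]
    | tmul a a' =>
      -- the product of two pure tensors
      let K : TensorAlgebra k V → H ⊗[k] TensorAlgebra k V →ₗ[k]
          TensorAlgebra k V ⊗[k] TensorAlgebra k V := fun a =>
        TensorProduct.map (LinearMap.mulLeft k a ∘ₗ s.tensorAct.flip c) (LinearMap.mulRight k c')
      have hK : ∀ a a', TensorProduct.map s.tensorHopf.mul s.tensorHopf.mul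
          (middle (s.tensorHopf.braiding s.tensorHopf.toYDData) ((a ⊗ₜ a') ⊗ₜ (c ⊗ₜ c'))) =
          K a (s.tensorCoact a') := by
        intro a a'
        have : middle (s.tensorHopf.braiding s.tensorHopf.toYDData) ((a ⊗ₜ a') ⊗ₜ (c ⊗ₜ c')) =
            (TensorProduct.assoc k _ _ _).symm (a ⊗ₜ TensorProduct.assoc k _ _ _
              (s.tensorHopf.braidingAux _ (s.tensorCoact a' ⊗ₜ c) ⊗ₜ c')) := rfl
        rw [this]
        generalize s.tensorCoact a' = y
        induction y with
        | zero => simp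
        | add x y hx hy => simp only [TensorProduct.add_tmul, TensorProduct.tmul_add, map_add,
            hx, hy]
        | tmul h d => rfl
      simp only [s.comulEnd_ι_basis b, TensorProduct.add_tmul, TensorProduct.sum_tmul, map_add,
        map_sum, hK, tensorCoact_mul, s.tensorCoact_ι_basis b]
      generalize s.tensorCoact a' = y
      induction y with
      | zero => simp
      | add x y hx hy =>
        simp only [mul_add, map_add, Finset.sum_add_distrib] at hx hy ⊢
        rw [← hx, ← hy]
        abel
      | tmul h d =>
        simp only [K, Finset.sum_mul, map_sum, Algebra.TensorProduct.tmul_mul_tmul,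
          TensorProduct.map_tmul, LinearMap.comp_apply, LinearMap.mulLeft_apply,
          LinearMap.flip_apply, LinearMap.mulRight_apply, s.comulEnd_ι_basis b, hs.mul_tensorAct,
          s.tensorAct_mul_comatrix hu, TensorProduct.sum_tmul, mul_assoc]
        rw [Finset.sum_comm]

theorem IsYetterDrinfeld.tensorComul_mul (x y : TensorAlgebra k V) :
    s.tensorComul (x * y) = TensorProduct.map s.tensorHopf.mul s.tensorHopf.mul
        (middle (s.tensorHopf.braiding s.tensorHopf.toYDData)
          (s.tensorComul x ⊗ₜ s.tensorComul y)) := by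
  rw [tensorComul_mul', s.tensorComul_eq x, hs.comulEnd_middle]
  -- It remains that `1 ⊗ 1` is a left unit of the braided product.
  congr 1
  generalize s.tensorComul y = z
  induction z with
  | zero => simp
  | add x y hx hy => simp only [TensorProduct.tmul_add, map_add, ← hx, ← hy]
  | tmul c c' =>
    have : middle (s.tensorHopf.braiding s.tensorHopf.toYDData) ((1 ⊗ₜ 1) ⊗ₜ (c ⊗ₜ c')) =
        (TensorProduct.assoc k _ _ _).symm (1 ⊗ₜ TensorProduct.assoc k _ _ _
          (s.tensorHopf.braidingAux _ (s.tensorCoact 1 ⊗ₜ c) ⊗ₜ c')) := rfl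
    rw [this, tensorCoact_one, braidingAux_tmul]
    change _ = (1 * s.tensorAct 1 c) ⊗ₜ (1 * c')
    rw [hs.one_tensorAct, one_mul, one_mul]

omit hs [Module.Finite k V] in
variable (s) in
/-- The action of `T(V)` on `T(V) ⊗ T(V) ⊗ T(V)` by left multiplication with the iterated
coproduct. -/
def comulEnd₃ : TensorAlgebra k V →ₐ[k]
    Module.End k (TensorAlgebra k V ⊗[k] (TensorAlgebra k V ⊗[k] TensorAlgebra k V)) :=
  TensorAlgebra.lift k <|
    (TensorProduct.mapBilinear (RingHom.id k) _ _ _ _).flip LinearMap.id ∘ₗ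
      LinearMap.mul k (TensorAlgebra k V) ∘ₗ TensorAlgebra.ι k +
    TensorProduct.homTensorHomMap (RingHom.id k) _ _ _ _ ∘ₗ
      TensorProduct.map s.tensorAct (s.comulEnd.toLinearMap ∘ₗ TensorAlgebra.ι k) ∘ₗ
      s.coact

omit hs [Module.Finite k V] in
theorem comulEnd₃_ι_basis (b : Module.Basis ι k V) (j : ι) (a : TensorAlgebra k V)
    (z : TensorAlgebra k V ⊗[k] TensorAlgebra k V) :
    s.comulEnd₃ (TensorAlgebra.ι k (b j)) (a ⊗ₜ z) =
      (TensorAlgebra.ι k (b j) * a) ⊗ₜ z +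
        ∑ i, s.tensorAct (s.coeff b j i) a ⊗ₜ s.comulEnd (TensorAlgebra.ι k (b i)) z := by
  simp [comulEnd₃, s.coact_basis b, map_sum, LinearMap.sum_apply]

/-- The coefficient acting on the first leg has to pass through `Δ`, so `H`-linearity of `Δ` is
used; the counterpart `comulEnd₃_right` does not need it. -/
theorem IsYetterDrinfeld.comulEnd₃_left (x : TensorAlgebra k V)
    (z : TensorAlgebra k V ⊗[k] TensorAlgebra k V) :
    TensorProduct.assoc k _ _ _
        (TensorProduct.map s.tensorComul LinearMap.id (s.comulEnd x z)) =
      s.comulEnd₃ x (TensorProduct.assoc k _ _ _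
        (TensorProduct.map s.tensorComul LinearMap.id z)) := by
  set b := Module.finBasis k V
  have hu := hs.isComatrix_coeff b
  refine tensorAlgebra_intertwine b s.comulEnd s.comulEnd₃
    ((TensorProduct.assoc k _ _ _).toLinearMap ∘ₗ
      TensorProduct.map s.tensorComul LinearMap.id) (fun j z => ?_) x z
  simp only [LinearMap.comp_apply, LinearEquiv.coe_coe]
  induction z with
  | zero => simp
  | add x y hx hy => simp only [map_add, hx, hy]
  | tmul a c =>
    simp only [s.comulEnd_ι_basis b, map_add, map_sum,
      TensorProduct.map_tmul, tensorComul_mul', hs.tensorComul_act, LinearMap.id_apply]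
    generalize s.tensorComul a = y
    induction y with
    | zero => simp
    | add x y hx hy =>
      simp only [TensorProduct.add_tmul, map_add, Finset.sum_add_distrib] at hx hy ⊢
      rw [← hx, ← hy]
      abel
    | tmul d d' =>
      simp only [s.comulEnd_ι_basis b, tensor_act_tmul _ _ hu, TensorProduct.add_tmul,
        TensorProduct.sum_tmul, map_add, map_sum,
        TensorProduct.assoc_tmul, s.comulEnd₃_ι_basis b, TensorProduct.tmul_add,
        TensorProduct.tmul_sum, Finset.sum_add_distrib, add_assoc]
      congr 2
      exact Finset.sum_comm

omit hs in
theorem comulEnd₃_right (x : TensorAlgebra k V)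
    (z : TensorAlgebra k V ⊗[k] TensorAlgebra k V) :
    TensorProduct.map LinearMap.id s.tensorComul (s.comulEnd x z) =
      s.comulEnd₃ x (TensorProduct.map LinearMap.id s.tensorComul z) := by
  set b := Module.finBasis k V
  refine tensorAlgebra_intertwine b _ _ _ (fun j z => ?_) x z
  induction z with
  | zero => simp
  | add x y hx hy => simp only [map_add, hx, hy]
  | tmul a c =>
    simp only [s.comulEnd_ι_basis b, map_add, map_sum, TensorProduct.map_tmul,
      tensorComul_mul', LinearMap.id_apply, s.comulEnd₃_ι_basis b]

/-- Both sides are the orbit map of `1 ⊗ 1 ⊗ 1` under `comulEnd₃`. -/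
theorem IsYetterDrinfeld.tensorComul_coassoc (x : TensorAlgebra k V) :
    TensorProduct.assoc k _ _ _ (TensorProduct.map s.tensorComul LinearMap.id (s.tensorComul x)) =
      TensorProduct.map LinearMap.id s.tensorComul (s.tensorComul x) := by
  rw [tensorComul_eq, hs.comulEnd₃_left, comulEnd₃_right]
  simp

end YDData

end TensorAlgebraHopf

/-! ### Counit and antipode of the tensor algebra -/

section TensorAlgebraAntipode

variable {k : Type u} {H : Type v} [Field k] [Ring H] [HopfAlgebra k H]
variable {ι : Type*} [Fintype ι] [DecidableEq ι]
variable {V : Type w} [AddCommGroup V] [Module k V]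

namespace YDData

variable (s : YDData k H V)

theorem algebraMapInv_ι (v : V) :
    TensorAlgebra.algebraMapInv (R := k) (TensorAlgebra.ι k v) = 0 := by
  simp [TensorAlgebra.algebraMapInv]

theorem algebraMapInv_tensorAct (h : H) (x : TensorAlgebra k V) :
    TensorAlgebra.algebraMapInv (s.tensorAct h x) =
      Coalgebra.counit (R := k) h * TensorAlgebra.algebraMapInv x := by
  revert h
  suffices hlin : TensorAlgebra.algebraMapInv.toLinearMap ∘ₗ s.tensorAct.flip x =
      (LinearMap.mulRight k (TensorAlgebra.algebraMapInv x)) ∘ₗ Coalgebra.counit from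
    fun h => LinearMap.congr_fun hlin h
  refine linearMap_ext_comatrix fun n t ht p q => ?_
  simp only [LinearMap.comp_apply, LinearMap.flip_apply, AlgHom.toLinearMap_apply,
    LinearMap.mulRight_apply]
  induction x using TensorAlgebra.induction generalizing p q with
  | algebraMap r => simp [tensorAct_algebraMap, TensorAlgebra.algebraMapInv]
  | ι v => simp [algebraMapInv_ι]
  | mul a b ha hb =>
    simp only [s.tensorAct_mul_comatrix ht, map_sum, map_mul, ha, hb, ht.counit]
    rw [Finset.sum_eq_single p] <;> simp +contextual [eq_comm]
  | add a b ha hb => simp only [map_add, ha, hb, mul_add]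

theorem coact_algebraMapInv (x : TensorAlgebra k V) :
    TensorProduct.map LinearMap.id (TensorAlgebra.algebraMapInv (R := k)).toLinearMap
      (s.tensorCoact x) = 1 ⊗ₜ TensorAlgebra.algebraMapInv x := by
  have h : (Algebra.TensorProduct.map (AlgHom.id k H) TensorAlgebra.algebraMapInv).comp
      s.tensorCoactHom = Algebra.TensorProduct.includeRight.comp TensorAlgebra.algebraMapInv := by
    refine TensorAlgebra.hom_ext (LinearMap.ext fun v => ?_)
    simp only [LinearMap.comp_apply, AlgHom.toLinearMap_apply, AlgHom.comp_apply,
      ← tensorCoact_eq, tensorCoact_ι, algebraMapInv_ι, map_zero]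
    generalize s.coact v = z
    induction z with
    | zero => simp
    | add x y hx hy => simp only [map_add, hx, hy, add_zero]
    | tmul g v => simp [algebraMapInv_ι]
  exact DFunLike.congr_fun h x

/-- The map `id ⊗ ε` intertwines the action through `Δ` with left multiplication, so `Δ(x)` is sent
to `x * 1`. -/
theorem tensorComul_counit [Module.Finite k V] (x : TensorAlgebra k V) :
    TensorProduct.rid k _ (TensorProduct.map LinearMap.id
      (TensorAlgebra.algebraMapInv (R := k)).toLinearMap (s.tensorComul x)) = x := by
  have h := tensorAlgebra_intertwine (Module.finBasis k V) s.comulEnd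
    (Algebra.lmul k (TensorAlgebra k V)) ((TensorProduct.rid k _).toLinearMap ∘ₗ
      TensorProduct.map LinearMap.id (TensorAlgebra.algebraMapInv (R := k)).toLinearMap)
    (fun j z => ?_) x (1 ⊗ₜ 1)
  · rw [← tensorComul_eq] at h
    simpa using h
  · induction z with
    | zero => simp
    | add x y hx hy => simp only [map_add, hx, hy]
    | tmul a c => simp [s.comulEnd_ι_basis, map_sum, algebraMapInv_ι]

variable {s} in
theorem IsYetterDrinfeld.counit_tensorComul [Module.Finite k V] (hs : s.IsYetterDrinfeld)
    (x : TensorAlgebra k V) :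
    TensorProduct.lid k _ (TensorProduct.map
      (TensorAlgebra.algebraMapInv (R := k)).toLinearMap LinearMap.id (s.tensorComul x)) = x := by
  have hu := hs.isComatrix_coeff (Module.finBasis k V)
  have h := tensorAlgebra_intertwine (Module.finBasis k V) s.comulEnd
    (Algebra.lmul k (TensorAlgebra k V)) ((TensorProduct.lid k _).toLinearMap ∘ₗ
      TensorProduct.map (TensorAlgebra.algebraMapInv (R := k)).toLinearMap LinearMap.id)
    (fun j z => ?_) x (1 ⊗ₜ 1)
  · rw [← tensorComul_eq] at h
    simpa using h
  · induction z with
    | zero => simp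
    | add x y hx hy => simp only [map_add, hx, hy]
    | tmul a c =>
      simp [s.comulEnd_ι_basis, map_sum, algebraMapInv_ι, algebraMapInv_tensorAct, hu.counit]

/-! #### The antipode -/

/-- The algebra map `T(V) → End T(V)` which computes the antipode. -/
def antipodeEnd : TensorAlgebra k V →ₐ[k] Module.End k (TensorAlgebra k V) :=
  TensorAlgebra.lift k s.antipodeStep

theorem tensorAntipode_eq (x : TensorAlgebra k V) :
    s.tensorAntipode x = s.antipodeEnd x 1 := rfl

theorem tensorAntipode_mul' (x y : TensorAlgebra k V) :
    s.tensorAntipode (x * y) = s.antipodeEnd x (s.tensorAntipode y) := by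
  simp [tensorAntipode_eq]

@[simp]
theorem tensorAntipode_one : s.tensorAntipode 1 = 1 := by simp [tensorAntipode_eq]

/-- `h ⊗ v ↦ (y ↦ (h · y) v)`. -/
def actMulRight (y : TensorAlgebra k V) : H ⊗[k] V →ₗ[k] TensorAlgebra k V :=
  LinearMap.mul' k _ ∘ₗ TensorProduct.map (s.tensorAct.flip y) (TensorAlgebra.ι k)

@[simp]
theorem actMulRight_tmul (y : TensorAlgebra k V) (h : H) (v : V) :
    s.actMulRight y (h ⊗ₜ v) = s.tensorAct h y * TensorAlgebra.ι k v := rfl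

theorem antipodeStep_apply (v : V) (y : TensorAlgebra k V) :
    s.antipodeStep v y = -s.actMulRight y (s.coact v) := by
  simp only [antipodeStep, LinearMap.neg_apply, LinearMap.comp_apply]
  congr 1
  generalize s.coact v = z
  induction z with
  | zero => simp
  | add x y hx hy => simp only [map_add, LinearMap.add_apply, hx, hy]
  | tmul g v => simp

theorem antipodeEnd_ι (v : V) (y : TensorAlgebra k V) :
    s.antipodeEnd (TensorAlgebra.ι k v) y = -s.actMulRight y (s.coact v) := by
  simp [antipodeEnd, antipodeStep_apply]

theorem antipodeEnd_ι_basis (b : Module.Basis ι k V) (j : ι) (y : TensorAlgebra k V) :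
    s.antipodeEnd (TensorAlgebra.ι k (b j)) y =
      -∑ i, s.tensorAct (s.coeff b j i) y * TensorAlgebra.ι k (b i) := by
  simp [antipodeEnd_ι, s.coact_basis b, map_sum]

variable {s}
variable (hs : s.IsYetterDrinfeld)
include hs

theorem IsYetterDrinfeld.actMulRight_act (h : H) (z : H ⊗[k] V) (y : TensorAlgebra k V) :
    s.actMulRight (s.tensorAct h y) z =
      s.actMulRight y (TensorProduct.map (LinearMap.mulRight k h) LinearMap.id z) := by
  induction z with
  | zero => simp
  | add x y hx hy => simp only [map_add, hx, hy]
  | tmul g v => simp [hs.mul_tensorAct]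

theorem IsYetterDrinfeld.tensorAntipode_act (h : H) (x : TensorAlgebra k V) :
    s.tensorAntipode (s.tensorAct h x) = s.tensorAct h (s.tensorAntipode x) := by
  revert h
  suffices hlin : s.tensorAntipode ∘ₗ s.tensorAct.flip x =
      s.tensorAct.flip (s.tensorAntipode x) from
    fun h => LinearMap.congr_fun hlin h
  refine linearMap_ext_comatrix fun n t ht p q => ?_
  change s.tensorAntipode (s.tensorAct (t p q) x) = s.tensorAct (t p q) (s.tensorAntipode x)
  rw [tensorAntipode_eq, tensorAntipode_eq,
    s.tensorAlgebra_covariant ht s.antipodeEnd s.tensorAct ?_ x 1 p q]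
  · simp only [tensorAct_one, ht.counit]
    rw [Finset.sum_eq_single q] <;> simp +contextual
  · intro v z p q
    simp only [antipodeEnd_ι, map_neg, Finset.sum_neg_distrib, hs.actMulRight_act]
    rw [← map_sum, hs.compat ht]
    congr 1
    generalize s.coact v = y
    induction y with
    | zero => simp
    | add x y hx hy => simp only [map_add, Finset.sum_add_distrib, hx, hy]
    | tmul g v =>
      simp only [actMulRight_tmul, s.tensorAct_mul_comatrix ht, map_sum, TensorProduct.map_tmul,
        LinearMap.mulLeft_apply, hs.mul_tensorAct, tensorAct_ι]

variable [Module.Finite k V]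

theorem IsYetterDrinfeld.tensorAntipode_coact (x : TensorAlgebra k V) :
    s.tensorCoact (s.tensorAntipode x) =
      TensorProduct.map LinearMap.id s.tensorAntipode (s.tensorCoact x) := by
  set b := Module.finBasis k V
  have hu := hs.isComatrix_coeff b
  have h := tensorAlgebra_intertwine b s.antipodeEnd (s.coactEnd s.antipodeEnd) s.tensorCoact
    (fun j y => ?_) x 1
  · rw [← tensorAntipode_eq, tensorCoact_one, coactEnd_one_tmul] at h
    exact h
  · simp only [s.antipodeEnd_ι_basis b, s.coactEnd_ι b, map_neg, map_sum, tensorCoact_mul,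
      s.tensorCoact_ι_basis b, LinearMap.sum_apply, Finset.mul_sum]
    rw [Finset.sum_comm]
    have h1 : ∀ m, ∑ i, s.tensorCoact (s.tensorAct (s.coeff b j i) y) *
        s.coeff b i m ⊗ₜ[k] TensorAlgebra.ι k (b m) =
        (∑ i, TensorProduct.map (LinearMap.mulRight k (s.coeff b i m)) LinearMap.id
          (s.tensorCoact (s.tensorAct (s.coeff b j i) y))) * 1 ⊗ₜ TensorAlgebra.ι k (b m) := by
      intro m
      rw [Finset.sum_mul]
      refine Finset.sum_congr rfl fun i _ => ?_
      rw [map_mulRight_id_eq, mul_assoc, Algebra.TensorProduct.tmul_mul_tmul, one_mul, mul_one]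
    simp only [h1, hs.compat_tensorAlgebra hu]
    generalize s.tensorCoact y = z
    induction z with
    | zero => simp
    | add x y hx hy =>
      simp only [map_add, add_mul, Finset.sum_add_distrib, neg_add] at hx hy ⊢
      rw [hx, hy]
    | tmul g d =>
      simp only [TensorProduct.map_tmul, LinearMap.mulLeft_apply, s.antipodeEnd_ι_basis b,
        Finset.sum_mul, Algebra.TensorProduct.tmul_mul_tmul, mul_one, TensorProduct.tmul_neg,
        TensorProduct.tmul_sum, Finset.sum_neg_distrib]
      rw [Finset.sum_comm]

/-- `m(S ⊗ id)` intertwines the action through `Δ` with the action through `ε`: for a generator, the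
two terms of `Δ(v)` cancel. -/
theorem IsYetterDrinfeld.tensorAntipode_left (x : TensorAlgebra k V) :
    LinearMap.mul' k _ (TensorProduct.map s.tensorAntipode LinearMap.id (s.tensorComul x)) =
      algebraMap k _ (TensorAlgebra.algebraMapInv x) := by
  set b := Module.finBasis k V
  have h := tensorAlgebra_intertwine b s.comulEnd
    ((Algebra.ofId k (Module.End k (TensorAlgebra k V))).comp TensorAlgebra.algebraMapInv)
    (LinearMap.mul' k _ ∘ₗ TensorProduct.map s.tensorAntipode LinearMap.id)
    (fun j z => ?_) x (1 ⊗ₜ 1)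
  · rw [← tensorComul_eq] at h
    simp only [LinearMap.comp_apply] at h
    rw [h, Algebra.algebraMap_eq_smul_one]
    simp [Algebra.ofId_apply]
  · induction z with
    | zero => simp
    | add x y hx hy => simp only [map_add, hx, hy]
    | tmul a c =>
      simp only [s.comulEnd_ι_basis b, LinearMap.comp_apply, map_add, map_sum,
        TensorProduct.map_tmul, LinearMap.mul'_apply, LinearMap.id_apply, tensorAntipode_mul',
        s.antipodeEnd_ι_basis b, hs.tensorAntipode_act, AlgHom.comp_apply, algebraMapInv_ι,
        map_zero, LinearMap.zero_apply, neg_mul, Finset.sum_mul, mul_assoc]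
      exact neg_add_cancel _

theorem IsYetterDrinfeld.tensorAntipode_right (x : TensorAlgebra k V) :
    LinearMap.mul' k _ (TensorProduct.map LinearMap.id s.tensorAntipode (s.tensorComul x)) =
      algebraMap k _ (TensorAlgebra.algebraMapInv x) := by
  set b := Module.finBasis k V
  have hu := hs.isComatrix_coeff b
  -- Here `m(id ⊗ S)` intertwines the action through `Δ` with the braided adjoint action `y ↦ vy -
  -- (v₍₋₁₎ · y)v₍₀₎`, not with the action through `ε`.
  let E : TensorAlgebra k V →ₐ[k] Module.End k (TensorAlgebra k V) :=
    TensorAlgebra.lift k (LinearMap.mul k _ ∘ₗ TensorAlgebra.ι k + s.antipodeStep)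
  have hE : ∀ j y, E (TensorAlgebra.ι k (b j)) y = TensorAlgebra.ι k (b j) * y -
      ∑ i, s.tensorAct (s.coeff b j i) y * TensorAlgebra.ι k (b i) := by
    intro j y
    simp [E, antipodeStep_apply, s.coact_basis b, map_sum, sub_eq_add_neg]
  have h := tensorAlgebra_intertwine b s.comulEnd E
    (LinearMap.mul' k _ ∘ₗ TensorProduct.map LinearMap.id s.tensorAntipode)
    (fun j z => ?_) x (1 ⊗ₜ 1)
  -- Braided commutators with scalars vanish, so `E` acts on scalars through `ε`.
  · have h2 := tensorAlgebra_intertwine b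
      ((Algebra.ofId k (Module.End k k)).comp TensorAlgebra.algebraMapInv) E
      (Algebra.linearMap k (TensorAlgebra k V)) (fun j c => ?_) x 1
    · rw [← tensorComul_eq] at h
      simp only [LinearMap.comp_apply] at h
      rw [h]
      simp only [TensorProduct.map_tmul, LinearMap.id_apply, tensorAntipode_one,
        LinearMap.mul'_apply, mul_one, Algebra.linearMap_apply, map_one] at h2 ⊢
      rw [← h2]
      simp [Algebra.ofId_apply]
    · simp only [hE, AlgHom.comp_apply, algebraMapInv_ι, map_zero, LinearMap.zero_apply,
        Algebra.linearMap_apply, tensorAct_algebraMap, hu.counit]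
      rw [Finset.sum_eq_single j]
      · simp [← Algebra.commutes]
      · intro i _ hi; simp [hi.symm]
      · simp
  · induction z with
    | zero => simp
    | add x y hx hy => simp only [map_add, hx, hy]
    | tmul a c =>
      simp only [s.comulEnd_ι_basis b, LinearMap.comp_apply, map_add, map_sum,
        TensorProduct.map_tmul, LinearMap.mul'_apply, LinearMap.id_apply, tensorAntipode_mul',
        s.antipodeEnd_ι_basis b, hE, s.tensorAct_mul_comatrix hu, mul_neg, Finset.sum_mul,
        Finset.mul_sum, mul_assoc, Finset.sum_neg_distrib, sub_eq_add_neg]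
      rw [Finset.sum_comm]

/-- The tensor algebra is a Hopf algebra in the category of Yetter-Drinfeld modules. -/
theorem IsYetterDrinfeld.isHopfAlgebra_tensorHopf : s.tensorHopf.IsHopfAlgebra where
  isYetterDrinfeld := hs.tensorHopf
  mul_hom :=
    { map_act := fun h m => by
        induction m with
        | zero => simp
        | add x y hx hy => simp only [map_add, hx, hy]
        | tmul x y =>
          revert h
          suffices hlin : s.tensorHopf.mul ∘ₗ
              (s.tensorHopf.tensor s.tensorHopf.toYDData).act.flip (x ⊗ₜ y) =
              s.tensorAct.flip (x * y) from fun h => LinearMap.congr_fun hlin h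
          refine linearMap_ext_comatrix fun n t ht p q => ?_
          simp only [LinearMap.comp_apply, LinearMap.flip_apply, tensor_act_tmul _ _ ht,
            s.tensorAct_mul_comatrix ht, map_sum]
          rfl
      coact_map := by
        refine TensorProduct.ext' fun x y => ?_
        change s.tensorCoact (x * y) = TensorProduct.map LinearMap.id (LinearMap.mul' k _)
          (coactMul _ _ (s.tensorCoact x ⊗ₜ s.tensorCoact y))
        rw [tensorCoact_mul]
        generalize s.tensorCoact x = z
        generalize s.tensorCoact y = z'
        induction z with
        | zero => simp
        | add x y hx hy => simp only [add_mul, TensorProduct.add_tmul, map_add, hx, hy]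
        | tmul g x =>
          induction z' with
          | zero => simp
          | add x y hx hy => simp only [mul_add, TensorProduct.tmul_add, map_add, hx, hy]
          | tmul g' y => simp }
  unit_hom :=
    { map_act := fun h c => (s.tensorAct_algebraMap h c).symm
      coact_map := by
        refine LinearMap.ext_ring ?_
        change s.tensorCoact (algebraMap k _ 1) = 1 ⊗ₜ algebraMap k _ 1
        rw [map_one, tensorCoact_one] }
  comul_hom :=
    { map_act := fun h x => hs.tensorComul_act h x
      coact_map := LinearMap.ext fun x => hs.tensorComul_coact x }
  counit_hom :=
    { map_act := fun h x => s.algebraMapInv_tensorAct h x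
      coact_map := LinearMap.ext fun x => (s.coact_algebraMapInv x).symm }
  antipode_hom :=
    { map_act := fun h x => hs.tensorAntipode_act h x
      coact_map := LinearMap.ext fun x => hs.tensorAntipode_coact x }
  mul_assoc := TensorProduct.ext_threefold fun x y z => mul_assoc x y z
  unit_mul x := by
    change algebraMap k _ 1 * x = x
    rw [map_one, one_mul]
  mul_unit x := by
    change x * algebraMap k _ 1 = x
    rw [map_one, mul_one]
  coassoc := LinearMap.ext fun x => hs.tensorComul_coassoc x
  counit_comul := LinearMap.ext fun x => hs.counit_tensorComul x
  comul_counit := LinearMap.ext fun x => s.tensorComul_counit x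
  counit_unit := by
    change TensorAlgebra.algebraMapInv (algebraMap k (TensorAlgebra k V) 1) = 1
    rw [map_one, map_one]
  counit_mul x y := map_mul TensorAlgebra.algebraMapInv x y
  comul_unit := by
    change s.tensorComul (algebraMap k _ 1) = algebraMap k _ 1 ⊗ₜ algebraMap k _ 1
    rw [map_one, tensorComul_one]
  comul_mul := TensorProduct.ext' fun x y => hs.tensorComul_mul x y
  antipode_left := LinearMap.ext fun x => hs.tensorAntipode_left x
  antipode_right := LinearMap.ext fun x => hs.tensorAntipode_right x

end YDData

end TensorAlgebraAntipode

/-! ### Skew derivations of the tensor algebra -/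

section SkewDerivations

variable {k : Type u} {H : Type v} [Field k] [Ring H] [HopfAlgebra k H]
variable {ι : Type*} [Fintype ι] [DecidableEq ι]
variable {V : Type w} [AddCommGroup V] [Module k V]
variable {W : Type w₁} [AddCommGroup W] [Module k W]

/-- Induction on `T(V)` by left multiplication with generators. -/
theorem tensorAlgebra_induction_left {p : TensorAlgebra k V → Prop} (one : p 1)
    (add : ∀ x y, p x → p y → p (x + y)) (smul : ∀ (c : k) x, p x → p (c • x))
    (mul : ∀ v x, p x → p (TensorAlgebra.ι k v * x)) (x : TensorAlgebra k V) : p x := by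
  suffices h : ∀ y, p y → p (x * y) by simpa using h 1 one
  induction x using TensorAlgebra.induction with
  | algebraMap r => intro y hy; rw [← Algebra.smul_def]; exact smul r y hy
  | ι v => exact fun y => mul v y
  | mul a b ha hb => intro y hy; rw [mul_assoc]; exact ha _ (hb _ hy)
  | add a b ha hb => intro y hy; rw [add_mul]; exact add _ _ (ha y hy) (hb y hy)

theorem ιInv_one : TensorAlgebra.ιInv (1 : TensorAlgebra k V) = 0 := by
  let : Module kᵐᵒᵖ V := Module.compHom _ ((RingHom.id k).fromOpposite mul_comm)
  have : IsCentralScalar k V := ⟨fun r m => rfl⟩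
  change TrivSqZeroExt.snd (TensorAlgebra.toTrivSqZeroExt (1 : TensorAlgebra k V)) = 0
  rw [map_one, TrivSqZeroExt.snd_one]

-- `ιInv` is the second component of the map to the trivial square-zero extension; since `v` has
-- first component zero, only one term of the Leibniz rule remains.
open YDData in
theorem ιInv_ι_mul (v : V) (x : TensorAlgebra k V) :
    TensorAlgebra.ιInv (TensorAlgebra.ι k v * x) = TensorAlgebra.algebraMapInv x • v := by
  let : Module kᵐᵒᵖ V := Module.compHom _ ((RingHom.id k).fromOpposite mul_comm)
  have : IsCentralScalar k V := ⟨fun r m => rfl⟩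
  have h : (TrivSqZeroExt.fstHom k k V).comp TensorAlgebra.toTrivSqZeroExt =
      TensorAlgebra.algebraMapInv := by
    refine TensorAlgebra.hom_ext (LinearMap.ext fun v => ?_)
    simp [algebraMapInv_ι]
  have h2 := DFunLike.congr_fun h x
  change TrivSqZeroExt.snd (TensorAlgebra.toTrivSqZeroExt (TensorAlgebra.ι k v * x)) = _
  rw [map_mul, TensorAlgebra.toTrivSqZeroExt_ι, TrivSqZeroExt.snd_mul, ← h2]
  simp

/-- The extension of a functional on `V` to `T(V)` which vanishes outside of degree `1`. -/
def degreeOne : Module.Dual k V →ₗ[k] Module.Dual k (TensorAlgebra k V) :=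
  LinearMap.lcomp k k TensorAlgebra.ιInv

@[simp]
theorem degreeOne_one (f : Module.Dual k V) : degreeOne f 1 = 0 := by
  simp [degreeOne, ιInv_one]

@[simp]
theorem degreeOne_ι_mul (f : Module.Dual k V) (v : V) (x : TensorAlgebra k V) :
    degreeOne f (TensorAlgebra.ι k v * x) = f v * TensorAlgebra.algebraMapInv x := by
  simp [degreeOne, ιInv_ι_mul, mul_comm]

namespace YDData

variable (s : YDData k H V)

theorem degreeOne_act (f : Module.Dual k V) (h : H) (x : TensorAlgebra k V) :
    degreeOne f (s.tensorAct h x) = degreeOne (f ∘ₗ s.act h) x := by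
  revert h
  suffices hlin : degreeOne f ∘ₗ s.tensorAct.flip x =
      (LinearMap.applyₗ x ∘ₗ degreeOne) ∘ₗ f.compRight k ∘ₗ s.act from
    fun h => LinearMap.congr_fun hlin h
  refine linearMap_ext_comatrix fun n t ht p q => ?_
  change degreeOne f (s.tensorAct (t p q) x) = degreeOne (f ∘ₗ s.act (t p q)) x
  induction x using tensorAlgebra_induction_left with
  | one => rw [tensorAct_one, Algebra.algebraMap_eq_smul_one]; simp
  | add x y hx hy => simp only [map_add, hx, hy]
  | smul c x hx => simp only [map_smul, hx]
  | mul v x hx =>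
    simp only [s.tensorAct_mul_comatrix ht, map_sum, tensorAct_ι, degreeOne_ι_mul,
      algebraMapInv_tensorAct, ht.counit]
    rw [Finset.sum_eq_single q] <;> simp +contextual

/-- The skew derivation `∂_f = (id ⊗ f) Δ` of `T(V)`. -/
def skewDer : Module.Dual k V →ₗ[k] Module.End k (TensorAlgebra k V) :=
  (LinearMap.lcomp k _ s.tensorComul) ∘ₗ
    (TensorProduct.rid k (TensorAlgebra k V)).toLinearMap.compRight k ∘ₗ
      TensorProduct.mapBilinear (RingHom.id k) _ _ _ _ LinearMap.id ∘ₗ degreeOne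

theorem skewDer_apply (f : Module.Dual k V) (x : TensorAlgebra k V) :
    s.skewDer f x = TensorProduct.rid k _
      (TensorProduct.map LinearMap.id (degreeOne f) (s.tensorComul x)) := rfl

@[simp]
theorem skewDer_one (f : Module.Dual k V) : s.skewDer f 1 = 0 := by simp [skewDer_apply]

/-- The twisted Leibniz rule. Together with `∂_f(1) = 0` it determines `∂_f`, and the contracted
braid shuffle satisfies the same recursion. -/
theorem skewDer_ι_mul (b : Module.Basis ι k V) (f : Module.Dual k V) (j : ι)
    (x : TensorAlgebra k V) :
    s.skewDer f (TensorAlgebra.ι k (b j) * x) = TensorAlgebra.ι k (b j) * s.skewDer f x +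
      ∑ i, f (b i) • s.tensorAct (s.coeff b j i) x := by
  -- Writing the undifferentiated `x` as `(id ⊗ ε)Δ(x)` makes both sides linear in `Δ(x)`.
  have hx : x = TensorProduct.rid k _ (TensorProduct.map LinearMap.id
      (TensorAlgebra.algebraMapInv (R := k)).toLinearMap (s.tensorComul x)) := by
    have : Module.Finite k V := Module.Finite.of_basis b
    rw [s.tensorComul_counit x]
  conv_rhs => enter [2, 2, i]; rw [hx]
  rw [skewDer_apply, skewDer_apply, tensorComul_mul']
  generalize s.tensorComul x = z
  induction z with
  | zero => simp
  | add x y hx hy =>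
    simp only [map_add, mul_add, smul_add, Finset.sum_add_distrib] at hx hy ⊢
    rw [hx, hy]
    abel
  | tmul a c => simp [s.comulEnd_ι_basis b, map_sum, smul_smul]

variable {s}
variable (hs : s.IsYetterDrinfeld)
include hs

theorem IsYetterDrinfeld.skewDer_act {t : ι → ι → H} (ht : IsComatrix k t) (f : Module.Dual k V)
    (p q : ι) (x : TensorAlgebra k V) :
    s.skewDer f (s.tensorAct (t p q) x) =
      ∑ l, s.tensorAct (t p l) (s.skewDer (f ∘ₗ s.act (t l q)) x) := by
  simp only [skewDer_apply]
  rw [hs.tensorComul_act]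
  generalize s.tensorComul x = z
  induction z with
  | zero => simp
  | add x y hx hy => simp only [map_add, Finset.sum_add_distrib, hx, hy]
  | tmul a c =>
    rw [tensor_act_tmul _ _ ht]
    simp only [map_sum, TensorProduct.map_tmul, LinearMap.id_apply, TensorProduct.rid_tmul,
      map_smul, ← degreeOne_act]
    rfl

variable [Module.Finite k V]

/-- Coassociativity with `f` applied to the last leg; it is the inductive step of `pair_mul`. -/
theorem IsYetterDrinfeld.tensorComul_skewDer (f : Module.Dual k V) (x : TensorAlgebra k V) :
    s.tensorComul (s.skewDer f x) =
      TensorProduct.map LinearMap.id (s.skewDer f) (s.tensorComul x) := by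
  have h := congrArg (TensorProduct.map LinearMap.id ((TensorProduct.rid k _).toLinearMap ∘ₗ
    TensorProduct.map LinearMap.id (degreeOne f))) (hs.tensorComul_coassoc x)
  rw [skewDer_apply]
  have h1 : ∀ z : TensorAlgebra k V ⊗[k] TensorAlgebra k V,
      s.tensorComul (TensorProduct.rid k _ (TensorProduct.map LinearMap.id (degreeOne f) z)) =
      TensorProduct.map LinearMap.id ((TensorProduct.rid k _).toLinearMap ∘ₗ
        TensorProduct.map LinearMap.id (degreeOne f))
          (TensorProduct.assoc k _ _ _ (TensorProduct.map s.tensorComul LinearMap.id z)) := by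
    intro z
    induction z with
    | zero => simp
    | add x y hx hy => simp only [map_add, hx, hy]
    | tmul a c =>
      simp only [TensorProduct.map_tmul, LinearMap.id_apply, TensorProduct.rid_tmul, map_smul]
      generalize s.tensorComul a = y
      induction y with
      | zero => simp
      | add x y hx hy => simp only [map_add, smul_add, TensorProduct.add_tmul, hx, hy]
      | tmul a a' => simp
  rw [h1, h]
  generalize s.tensorComul x = z
  induction z with
  | zero => simp
  | add x y hx hy => simp only [map_add, hx, hy]
  | tmul a c => simp [skewDer_apply]

omit [Module.Finite k V] in
/-- `∑ᵢ (∂ᵢ x)₍₋₁₎ uᵢⱼ ⊗ (∂ᵢ x)₍₀₎ = x₍₋₁₎ ⊗ ∂ⱼ x₍₀₎`. -/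
theorem IsYetterDrinfeld.skewDer_coact (b : Module.Basis ι k V) (j : ι) (x : TensorAlgebra k V) :
    ∑ i, TensorProduct.map (LinearMap.mulRight k (s.coeff b i j)) LinearMap.id
        (s.tensorCoact (s.skewDer (b.coord i) x)) =
      TensorProduct.map LinearMap.id (s.skewDer (b.coord j)) (s.tensorCoact x) := by
  have hu := hs.isComatrix_coeff b
  induction x using tensorAlgebra_induction_left with
  | one => simp [tensorCoact_one]
  | add x y hx hy => simp only [map_add, Finset.sum_add_distrib, hx, hy]
  | smul c x hx => simp only [map_smul, ← Finset.smul_sum, hx]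
  | mul v x hx =>
    suffices hlin : ∑ i, TensorProduct.map (LinearMap.mulRight k (s.coeff b i j)) LinearMap.id ∘ₗ
        s.tensorCoact ∘ₗ s.skewDer (b.coord i) ∘ₗ LinearMap.mulRight k x ∘ₗ TensorAlgebra.ι k =
        TensorProduct.map LinearMap.id (s.skewDer (b.coord j)) ∘ₗ s.tensorCoact ∘ₗ
          LinearMap.mulRight k x ∘ₗ TensorAlgebra.ι k by
      simpa [LinearMap.sum_apply] using LinearMap.congr_fun hlin v
    refine b.ext fun l => ?_
    simp only [LinearMap.sum_apply, LinearMap.comp_apply, LinearMap.mulRight_apply,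
      s.skewDer_ι_mul b, map_add, Finset.sum_add_distrib, tensorCoact_mul,
      s.tensorCoact_ι_basis b]
    have e1 : ∀ i, ∑ m, b.coord i (b m) • s.tensorAct (s.coeff b l m) x =
        s.tensorAct (s.coeff b l i) x := by
      intro i
      rw [Finset.sum_eq_single i]
      · simp
      · intro m _ hm; simp [hm]
      · simp
    -- The twisted summand of the Leibniz rule is handled by compatibility on `T(V)`, the other one
    -- by the induction hypothesis.
    simp only [e1, hs.compat_tensorAlgebra hu]
    have e2 : ∀ i, TensorProduct.map (LinearMap.mulRight k (s.coeff b i j)) LinearMap.id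
        ((∑ m, s.coeff b l m ⊗ₜ[k] TensorAlgebra.ι k (b m)) *
          s.tensorCoact (s.skewDer (b.coord i) x)) =
        (∑ m, s.coeff b l m ⊗ₜ[k] TensorAlgebra.ι k (b m)) *
        TensorProduct.map (LinearMap.mulRight k (s.coeff b i j)) LinearMap.id
          (s.tensorCoact (s.skewDer (b.coord i) x)) := by
      intro i
      rw [map_mulRight_id_eq, map_mulRight_id_eq, mul_assoc]
    simp only [e2, ← Finset.mul_sum, hx]
    generalize s.tensorCoact x = z
    induction z with
    | zero => simp
    | add x y hx hy =>
      simp only [map_add, mul_add, Finset.sum_add_distrib] at hx hy ⊢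
      rw [← hx, ← hy]
      abel
    | tmul g d =>
      have e3 : ∀ i, ∑ m, b.coord j (b m) • s.tensorAct (s.coeff b i m) d =
          s.tensorAct (s.coeff b i j) d := by
        intro i
        rw [Finset.sum_eq_single j]
        · simp
        · intro m _ hm; simp [hm]
        · simp
      simp only [TensorProduct.map_tmul, LinearMap.id_apply, Finset.sum_mul,
        Algebra.TensorProduct.tmul_mul_tmul, map_sum, s.skewDer_ι_mul b, e3,
        TensorProduct.tmul_add, Finset.sum_add_distrib, LinearMap.mulLeft_apply]

end YDData

end SkewDerivations

/-! ### The pairing of `T(*V)` and `T(V)` -/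

section Pairing

variable {k : Type u} {H : Type v} [Field k] [Ring H] [HopfAlgebra k H]
variable {ι : Type*} [Fintype ι] [DecidableEq ι]
variable {V : Type w} [AddCommGroup V] [Module k V]
variable {W : Type w₁} [AddCommGroup W] [Module k W]

namespace YDData

variable (s : YDData k H V) (κ : W →ₗ[k] Module.Dual k V)

/-- The action of `T(W)` on the dual of `T(V)` by transposes of skew derivations. -/
def pairEnd : TensorAlgebra k W →ₐ[k] Module.End k (Module.Dual k (TensorAlgebra k V)) :=
  TensorAlgebra.lift k (Module.Dual.transpose ∘ₗ s.skewDer ∘ₗ κ)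

/-- The pairing `⟨w₁ ⋯ wₙ, x⟩ = ε(∂_{wₙ} ⋯ ∂_{w₁} x)` of `T(W)` and `T(V)`, for a family of
functionals on `V` parametrized by `W`. -/
def pair : TensorAlgebra k W →ₗ[k] Module.Dual k (TensorAlgebra k V) :=
  LinearMap.applyₗ (TensorAlgebra.algebraMapInv (R := k)).toLinearMap ∘ₗ
    (s.pairEnd κ).toLinearMap

theorem pair_apply (F : TensorAlgebra k W) :
    s.pair κ F = s.pairEnd κ F TensorAlgebra.algebraMapInv.toLinearMap := rfl

@[simp]
theorem pair_one : s.pair κ 1 = TensorAlgebra.algebraMapInv.toLinearMap := by simp [pair_apply]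

theorem pair_ι_mul (w : W) (F : TensorAlgebra k W) (x : TensorAlgebra k V) :
    s.pair κ (TensorAlgebra.ι k w * F) x = s.pair κ F (s.skewDer (κ w) x) := by
  simp only [pair_apply, map_mul, Module.End.mul_apply]
  simp [pairEnd, Module.Dual.transpose_apply]

theorem pair_apply_one (F : TensorAlgebra k W) :
    s.pair κ F 1 = TensorAlgebra.algebraMapInv F := by
  induction F using tensorAlgebra_induction_left with
  | one => simp
  | add x y hx hy => simp only [map_add, LinearMap.add_apply, hx, hy]
  | smul c x hx => simp only [map_smul, LinearMap.smul_apply, hx]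
  | mul v x hx => simp [pair_ι_mul, algebraMapInv_ι]

variable {s} in
/-- `⟨F G, x⟩ = ⟨G, x₍₁₎⟩ ⟨F, x₍₂₎⟩`. -/
theorem IsYetterDrinfeld.pair_mul [Module.Finite k V] (hs : s.IsYetterDrinfeld)
    (F G : TensorAlgebra k W) (x : TensorAlgebra k V) :
    s.pair κ (F * G) x = LinearMap.mul' k k
      (TensorProduct.map (s.pair κ G) (s.pair κ F) (s.tensorComul x)) := by
  induction F using tensorAlgebra_induction_left generalizing x with
  | one =>
    rw [one_mul, pair_one]
    conv_lhs => rw [← s.tensorComul_counit x]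
    generalize s.tensorComul x = z
    induction z with
    | zero => simp
    | add x y hx hy => simp only [map_add, hx, hy]
    | tmul a c => simp [mul_comm]
  | add F F' hF hF' =>
    simp only [add_mul, map_add, LinearMap.add_apply, TensorProduct.map_add_right, hF, hF']
  | smul c F hF =>
    simp only [smul_mul_assoc, map_smul, LinearMap.smul_apply, TensorProduct.map_smul_right, hF]
  | mul w F hF =>
    rw [mul_assoc, pair_ι_mul, hF, hs.tensorComul_skewDer]
    generalize s.tensorComul x = z
    induction z with
    | zero => simp
    | add x y hx hy => simp only [map_add, hx, hy]
    | tmul a c => simp [pair_ι_mul]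

section Dual

variable [BijectiveAntipode k H] [Module.Finite k V]
variable {s}
variable (hs : s.IsYetterDrinfeld)
include hs

/-- `⟨S(h) · F, x⟩ = ⟨F, h · x⟩`. -/
theorem IsYetterDrinfeld.pair_act (h : H) (F : TensorAlgebra k (Module.Dual k V))
    (x : TensorAlgebra k V) :
    s.pair LinearMap.id (s.leftDual.tensorAct (HopfAlgebra.antipode k h) F) x =
      s.pair LinearMap.id F (s.tensorAct h x) := by
  -- The dual action of `H` on functionals on `T(V)`. Transposed skew derivations are covariant for
  -- it by `skewDer_act`, so the covariance principle applies to the orbit of `ε`.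
  let ρ : H →ₗ[k] Module.End k (Module.Dual k (TensorAlgebra k V)) :=
    Module.Dual.transpose ∘ₗ s.tensorAct ∘ₗ antipodeInv k H
  have hρ : ∀ h ξ x, ρ (HopfAlgebra.antipode k h) ξ x = ξ (s.tensorAct h x) := by
    intro h ξ x
    simp [ρ, Module.Dual.transpose_apply]
  revert h
  suffices hlin : (LinearMap.applyₗ x ∘ₗ s.pair LinearMap.id) ∘ₗ s.leftDual.tensorAct.flip F ∘ₗ
      HopfAlgebra.antipode k = s.pair LinearMap.id F ∘ₗ s.tensorAct.flip x from
    fun h => LinearMap.congr_fun hlin h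
  refine linearMap_ext_comatrix fun n t ht q p => ?_
  have hcov := s.leftDual.tensorAlgebra_covariant ht.antipode (s.pairEnd LinearMap.id) ρ ?_ F
    TensorAlgebra.algebraMapInv.toLinearMap p q
  · have h1 := LinearMap.congr_fun hcov x
    rw [← pair_apply, hρ] at h1
    refine Eq.trans ?_ h1.symm
    -- The functional `ε`, from which the pairing is generated, is invariant.
    have h2 : ∀ l, ρ (HopfAlgebra.antipode k (t q l))
        (TensorAlgebra.algebraMapInv (R := k) (M := V)).toLinearMap =
        (if q = l then (1 : k) else 0) • TensorAlgebra.algebraMapInv.toLinearMap := by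
      intro l
      ext x
      rw [hρ]
      simp only [AlgHom.toLinearMap_apply, algebraMapInv_tensorAct, ht.counit]
      split_ifs <;> simp
    simp only [h2, map_smul, ← pair_apply, LinearMap.sum_apply, LinearMap.smul_apply]
    simp
  · intro f ξ p q
    ext x
    have h3 : ∀ f ξ x, s.pairEnd LinearMap.id (TensorAlgebra.ι k f) ξ x = ξ (s.skewDer f x) := by
      intro f ξ x
      simp [pairEnd, Module.Dual.transpose_apply]
    rw [hρ, h3, hs.skewDer_act ht]
    simp only [map_sum, LinearMap.sum_apply, h3, hρ, leftDual_act_antipode]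

/-- `F₍₋₁₎ ⟨F₍₀₎, x⟩ = S(x₍₋₁₎) ⟨F, x₍₀₎⟩`. -/
theorem IsYetterDrinfeld.pair_coact (F : TensorAlgebra k (Module.Dual k V))
    (x : TensorAlgebra k V) :
    TensorProduct.rid k H (TensorProduct.map LinearMap.id
        ((s.pair LinearMap.id).flip x) (s.leftDual.tensorCoact F)) =
      antipodeEval H (s.pair LinearMap.id F) (s.tensorCoact x) := by
  set b := Module.finBasis k V
  have hb : ∀ j, s.leftDual.tensorCoact (TensorAlgebra.ι k (b.coord j)) =
      ∑ i, HopfAlgebra.antipode k (s.coeff b i j) ⊗ₜ TensorAlgebra.ι k (b.coord i) := by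
    intro j
    rw [tensorCoact_ι, s.leftDual_coact_coord]
    simp [map_sum]
  induction F using tensorAlgebra_induction_left generalizing x with
  | one =>
    have h := congrArg (fun z => TensorProduct.rid k H
      (TensorProduct.map (HopfAlgebra.antipode k) LinearMap.id z)) (s.coact_algebraMapInv x)
    simp only [TensorProduct.map_tmul, HopfAlgebra.antipode_one, LinearMap.id_apply,
      TensorProduct.rid_tmul] at h
    rw [tensorCoact_one]
    simp only [TensorProduct.map_tmul, LinearMap.id_apply, LinearMap.flip_apply, pair_one,
      TensorProduct.rid_tmul, AlgHom.toLinearMap_apply]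
    rw [← h]
    generalize s.tensorCoact x = z
    induction z with
    | zero => simp
    | add x y hx hy => simp only [map_add, hx, hy]
    | tmul a c => simp
  | add F F' hF hF' =>
    have e : ∀ z : H ⊗[k] TensorAlgebra k V, antipodeEval H (s.pair LinearMap.id (F + F')) z =
        antipodeEval H (s.pair LinearMap.id F) z + antipodeEval H (s.pair LinearMap.id F') z := by
      intro z
      simp [antipodeEval, TensorProduct.map_add_right]
    rw [e, ← hF, ← hF']
    simp only [map_add]
  | smul c F hF =>
    have e : ∀ z : H ⊗[k] TensorAlgebra k V, antipodeEval H (s.pair LinearMap.id (c • F)) z =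
        c • antipodeEval H (s.pair LinearMap.id F) z := by
      intro z
      simp [antipodeEval, TensorProduct.map_smul_right]
    rw [e, ← hF]
    simp only [map_smul]
  | mul f F hF =>
    have hlin : ∀ (A B : Module.Dual k V →ₗ[k] H), (∀ j, A (b.coord j) = B (b.coord j)) →
        A f = B f := by
      intro A B hAB
      have : A = B := b.dualBasis.ext fun j => by simpa using hAB j
      rw [this]
    let A : Module.Dual k V →ₗ[k] H := (TensorProduct.rid k H).toLinearMap ∘ₗ
      TensorProduct.map LinearMap.id ((s.pair LinearMap.id).flip x) ∘ₗ s.leftDual.tensorCoact ∘ₗ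
        LinearMap.mulRight k F ∘ₗ TensorAlgebra.ι k
    let B : Module.Dual k V →ₗ[k] H :=
      ((LinearMap.applyₗ (s.tensorCoact x) ∘ₗ (TensorProduct.rid k H).toLinearMap.compRight k) ∘ₗ
        TensorProduct.mapBilinear (RingHom.id k) _ _ _ _ (HopfAlgebra.antipode k)) ∘ₗ
          s.pair LinearMap.id ∘ₗ LinearMap.mulRight k F ∘ₗ TensorAlgebra.ι k
    refine hlin A B fun j => ?_
    change TensorProduct.rid k H (TensorProduct.map LinearMap.id
        ((s.pair LinearMap.id).flip x)
          (s.leftDual.tensorCoact (TensorAlgebra.ι k (b.coord j) * F))) =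
      antipodeEval H (s.pair LinearMap.id (TensorAlgebra.ι k (b.coord j) * F)) (s.tensorCoact x)
    have h1 : antipodeEval H (s.pair LinearMap.id (TensorAlgebra.ι k (b.coord j) * F))
        (s.tensorCoact x) = antipodeEval H (s.pair LinearMap.id F)
          (TensorProduct.map LinearMap.id (s.skewDer (b.coord j)) (s.tensorCoact x)) := by
      generalize s.tensorCoact x = z
      induction z with
      | zero => simp
      | add x y hx hy => simp only [map_add, hx, hy]
      | tmul a c => simp [pair_ι_mul]
    have h2 : ∀ (g : H) (z : H ⊗[k] TensorAlgebra k V), antipodeEval H (s.pair LinearMap.id F)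
        (TensorProduct.map (LinearMap.mulRight k g) LinearMap.id z) =
        HopfAlgebra.antipode k g * antipodeEval H (s.pair LinearMap.id F) z := by
      intro g z
      induction z with
      | zero => simp
      | add x y hx hy => simp only [map_add, mul_add, hx, hy]
      | tmul a c => simp [HopfAlgebra.antipode_mul_antidistrib]
    -- `skewDer_coact`, read from right to left, produces right factors `uᵢⱼ`; their antipodes are
    -- the coefficients of the coaction on the dual basis vector `bʲ`.
    rw [h1, ← hs.skewDer_coact b, map_sum, tensorCoact_mul, hb]
    simp only [h2, ← hF, Finset.sum_mul, map_sum]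
    refine Finset.sum_congr rfl fun i _ => ?_
    generalize s.leftDual.tensorCoact F = z
    induction z with
    | zero => simp
    | add x y hx hy => simp only [map_add, mul_add, hx, hy]
    | tmul a c => simp [pair_ι_mul]

/-- `⟨F, v x⟩ = ⟨∂_v F, x⟩`. -/
theorem IsYetterDrinfeld.pair_apply_ι_mul (F : TensorAlgebra k (Module.Dual k V)) (v : V)
    (x : TensorAlgebra k V) :
    s.pair LinearMap.id F (TensorAlgebra.ι k v * x) =
      s.pair LinearMap.id (s.leftDual.skewDer (Module.Dual.eval k V v) F) x := by
  set b := Module.finBasis k V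
  induction F using tensorAlgebra_induction_left generalizing v x with
  | one => simp [algebraMapInv_ι]
  | add F F' hF hF' => simp only [map_add, LinearMap.add_apply, hF, hF']
  | smul c F hF => simp only [map_smul, LinearMap.smul_apply, hF]
  | mul f F hF =>
    suffices h : ∀ j l, s.pair LinearMap.id (TensorAlgebra.ι k (b.dualBasis j) * F)
        (TensorAlgebra.ι k (b l) * x) = s.pair LinearMap.id (s.leftDual.skewDer
          (Module.Dual.eval k V (b l)) (TensorAlgebra.ι k (b.dualBasis j) * F)) x by
      have h1 : ∀ j, s.pair LinearMap.id (TensorAlgebra.ι k (b.dualBasis j) * F) ∘ₗ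
          LinearMap.mulRight k x ∘ₗ TensorAlgebra.ι k = (LinearMap.applyₗ x ∘ₗ
            s.pair LinearMap.id) ∘ₗ LinearMap.applyₗ (TensorAlgebra.ι k (b.dualBasis j) * F) ∘ₗ
              s.leftDual.skewDer ∘ₗ Module.Dual.eval k V := fun j => b.ext (h j)
      have h2 : LinearMap.applyₗ (TensorAlgebra.ι k v * x) ∘ₗ s.pair LinearMap.id ∘ₗ
          LinearMap.mulRight k F ∘ₗ TensorAlgebra.ι k = (LinearMap.applyₗ x ∘ₗ
            s.pair LinearMap.id) ∘ₗ s.leftDual.skewDer (Module.Dual.eval k V v) ∘ₗ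
              LinearMap.mulRight k F ∘ₗ TensorAlgebra.ι k :=
        b.dualBasis.ext fun j => LinearMap.congr_fun (h1 j) v
      exact LinearMap.congr_fun h2 f
    intro j l
    have hc : ∀ m, s.leftDual.coeff b.dualBasis j m = HopfAlgebra.antipode k (s.coeff b m j) := by
      intro m
      have h := s.leftDual_coact_coord b j
      rw [coeff, Module.Basis.coe_dualBasis, h, map_sum, map_sum]
      simp [Finsupp.single_apply]
    -- The left side becomes `⟨F, bₗ ∂ⱼx⟩ + ⟨F, uₗⱼ · x⟩`, the right side `⟨bʲ ∂ₗF, x⟩ + ⟨S(uₗⱼ) ·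
    -- F, x⟩`. The first terms agree by induction, the second by `pair_act`.
    rw [pair_ι_mul, s.skewDer_ι_mul b, s.leftDual.skewDer_ι_mul b.dualBasis]
    simp only [map_add, LinearMap.add_apply, map_sum, LinearMap.sum_apply, map_smul,
      LinearMap.smul_apply, hc, hs.pair_act, pair_ι_mul, hF]
    congr 1
    simp [Finsupp.single_apply]

/-- The pairing of `T(*V)` and `T(V)` is symmetric in the two arguments. -/
theorem IsYetterDrinfeld.pair_dual (F : TensorAlgebra k (Module.Dual k V))
    (x : TensorAlgebra k V) :
    s.pair LinearMap.id F x = s.leftDual.pair (Module.Dual.eval k V) x F := by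
  induction x using tensorAlgebra_induction_left generalizing F with
  | one => simp [pair_apply_one]
  | add x y hx hy => simp only [map_add, LinearMap.add_apply, hx, hy]
  | smul c x hx => simp only [map_smul, LinearMap.smul_apply, hx]
  | mul v x hx => rw [hs.pair_apply_ι_mul, pair_ι_mul, hx]

/-- `⟨F, x y⟩ = ⟨F₍₁₎, y⟩ ⟨F₍₂₎, x⟩`. -/
theorem IsYetterDrinfeld.pair_apply_mul (F : TensorAlgebra k (Module.Dual k V))
    (x y : TensorAlgebra k V) :
    s.pair LinearMap.id F (x * y) = LinearMap.mul' k k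
      (TensorProduct.map ((s.pair LinearMap.id).flip y) ((s.pair LinearMap.id).flip x)
        (s.leftDual.tensorComul F)) := by
  have h : ∀ x, (s.pair LinearMap.id).flip x = s.leftDual.pair (Module.Dual.eval k V) x :=
    fun x => LinearMap.ext fun F => hs.pair_dual F x
  rw [h, h, ← hs.leftDual.pair_mul, hs.pair_dual]

end Dual

end YDData

end Pairing

/-! ### Convolution of bilinear forms -/

section ConvolutionForms

variable {k : Type u} [Field k] {C : Type w} [AddCommGroup C] [Module k C] [Coalgebra k C]
variable {D : Type w₁} [AddCommGroup D] [Module k D] [Coalgebra k D]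

/-- `c ↦ (d ↦ Φ(c₍₁₎)(d₍₂₎) Ψ(c₍₂₎)(d₍₁₎))`. -/
def convForm (Φ Ψ : C →ₗ[k] Module.Dual k D) (c : C) (d : D) : k :=
  TensorProduct.dualDistrib k D D (TensorProduct.map Φ Ψ (Coalgebra.comul c))
    (TensorProduct.comm k D D (Coalgebra.comul d))

/-- A linear map with values in the dual of a coalgebra, as a map into the opposite of the
convolution algebra. -/
def toConvOp (Φ : C →ₗ[k] Module.Dual k D) :
    WithConv (C →ₗ[k] (WithConv (D →ₗ[k] k))ᵐᵒᵖ) :=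
  WithConv.toConv
    { toFun := fun c => MulOpposite.op (WithConv.toConv (Φ c))
      map_add' := fun _ _ => by rw [map_add]; rfl
      map_smul' := fun _ _ => by rw [map_smul]; rfl }

/-- Passing to the opposite algebra accounts for the crossed order in `convForm`, which is the order
in `pair_mul` and `pair_apply_mul`. -/
theorem toConvOp_mul_apply (Φ Ψ : C →ₗ[k] Module.Dual k D) (c : C) (d : D) :
    (MulOpposite.unop ((toConvOp Φ * toConvOp Ψ).ofConv c)).ofConv d = convForm Φ Ψ c d := by
  change (MulOpposite.unop (LinearMap.mul' k (WithConv (D →ₗ[k] k))ᵐᵒᵖ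
    (TensorProduct.map _ _ (Coalgebra.comul (R := k) c)))).ofConv d = _
  rw [convForm]
  generalize (Coalgebra.comul (R := k) c) = y
  induction y with
  | zero => simp
  | add x y hx hy =>
    simp only [map_add, LinearMap.add_apply, ← hx, ← hy]
    rfl
  | tmul a b =>
    change LinearMap.mul' k k (TensorProduct.map (Ψ b) (Φ a) (Coalgebra.comul d)) = _
    generalize (Coalgebra.comul (R := k) d) = z
    induction z with
    | zero => simp
    | add x y hx hy => simp only [map_add, hx, hy]
    | tmul a b => simp [mul_comm]

/-- One-sided inverses for the convolution of bilinear forms agree. -/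
theorem convForm_inverse_unique {P Q₁ Q₂ : C →ₗ[k] Module.Dual k D}
    (h₁ : ∀ c d, convForm Q₁ P c d = Coalgebra.counit (R := k) c * Coalgebra.counit (R := k) d)
    (h₂ : ∀ c d, convForm P Q₂ c d = Coalgebra.counit (R := k) c * Coalgebra.counit (R := k) d) :
    Q₁ = Q₂ := by
  have hone : ∀ c d, (MulOpposite.unop ((1 : WithConv (C →ₗ[k]
      (WithConv (D →ₗ[k] k))ᵐᵒᵖ)).ofConv c)).ofConv d =
      Coalgebra.counit (R := k) c * Coalgebra.counit (R := k) d := by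
    intro c d
    change (MulOpposite.unop (algebraMap k (WithConv (D →ₗ[k] k))ᵐᵒᵖ
      (Coalgebra.counit c))).ofConv d = _
    rw [Algebra.algebraMap_eq_smul_one]
    rfl
  have e : ∀ {A B : WithConv (C →ₗ[k] (WithConv (D →ₗ[k] k))ᵐᵒᵖ)},
      (∀ c d, (MulOpposite.unop (A.ofConv c)).ofConv d =
        (MulOpposite.unop (B.ofConv c)).ofConv d) → A = B := fun h =>
    WithConv.ext (LinearMap.ext fun c => MulOpposite.unop_injective
      (WithConv.ext (LinearMap.ext fun d => h c d)))
  -- A left and a right inverse of `P` in an associative convolution algebra are equal.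
  have h3 : toConvOp Q₁ = toConvOp Q₂ := left_inv_eq_right_inv (a := toConvOp P)
    (e fun c d => by rw [toConvOp_mul_apply, h₁, hone])
    (e fun c d => by rw [toConvOp_mul_apply, h₂, hone])
  ext c d
  exact congrArg (fun A => (MulOpposite.unop (WithConv.ofConv A c)).ofConv d) h3

end ConvolutionForms

/-! ### The pairing and the antipodes -/

section PairingAntipode

variable {k : Type u} {H : Type v} [Field k] [Ring H] [HopfAlgebra k H]
variable {V : Type w} [AddCommGroup V] [Module k V]

namespace YDData

/-- The coalgebra structure of `T(V)`. -/
abbrev IsYetterDrinfeld.tensorCoalgebra {s : YDData k H V} [Module.Finite k V]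
    (hs : s.IsYetterDrinfeld) : Coalgebra k (TensorAlgebra k V) where
  comul := s.tensorComul
  counit := TensorAlgebra.algebraMapInv.toLinearMap
  coassoc := LinearMap.ext fun x => hs.tensorComul_coassoc x
  rTensor_counit_comp_comul := LinearMap.ext fun x =>
    (TensorProduct.lid k _).injective <| by
      simpa [LinearMap.rTensor] using hs.counit_tensorComul x
  lTensor_counit_comp_comul := LinearMap.ext fun x =>
    (TensorProduct.rid k _).injective <| by
      simpa [LinearMap.lTensor] using s.tensorComul_counit x

variable {s : YDData k H V} [BijectiveAntipode k H] [Module.Finite k V]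

/-- `⟨S(F), x⟩ = ⟨F, S(x)⟩`: both sides are convolution inverse to the pairing. -/
theorem IsYetterDrinfeld.pair_antipode (hs : s.IsYetterDrinfeld)
    (F : TensorAlgebra k (Module.Dual k V)) (x : TensorAlgebra k V) :
    s.pair LinearMap.id (s.leftDual.tensorAntipode F) x =
      s.pair LinearMap.id F (s.tensorAntipode x) := by
  let _ : Coalgebra k (TensorAlgebra k V) := hs.tensorCoalgebra
  let _ : Coalgebra k (TensorAlgebra k (Module.Dual k V)) := hs.leftDual.tensorCoalgebra
  have h : s.pair LinearMap.id ∘ₗ s.leftDual.tensorAntipode =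
      s.tensorAntipode.dualMap ∘ₗ s.pair LinearMap.id := by
    refine convForm_inverse_unique (P := s.pair LinearMap.id) (fun F x => ?_) fun F x => ?_
    · have e : convForm (s.pair LinearMap.id ∘ₗ s.leftDual.tensorAntipode)
          (s.pair LinearMap.id) F x = s.pair LinearMap.id (LinearMap.mul' k _
            (TensorProduct.map s.leftDual.tensorAntipode LinearMap.id
              (s.leftDual.tensorComul F))) x := by
        change TensorProduct.dualDistrib k _ _ (TensorProduct.map _ _
          (s.leftDual.tensorComul F)) (TensorProduct.comm k _ _ (s.tensorComul x)) = _
        generalize s.leftDual.tensorComul F = z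
        induction z with
        | zero => simp
        | add x y hx hy => simp only [map_add, LinearMap.add_apply, hx, hy]
        | tmul a c =>
          simp only [TensorProduct.map_tmul, LinearMap.mul'_apply, LinearMap.id_apply]
          rw [hs.pair_mul]
          generalize s.tensorComul x = y
          induction y with
          | zero => simp
          | add x y hx hy => simp only [map_add, hx, hy]
          | tmul d d' => simp [mul_comm]
      rw [e, hs.leftDual.tensorAntipode_left, Algebra.algebraMap_eq_smul_one, map_smul, pair_one]
      rfl
    -- Because of the crossing, the left antipode axiom of `T(V)` provides the right inverse of the
    -- pairing, while that of `T(*V)` provided the left inverse.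
    · have e : convForm (s.pair LinearMap.id)
          (s.tensorAntipode.dualMap ∘ₗ s.pair LinearMap.id) F x =
          s.pair LinearMap.id F (LinearMap.mul' k _
            (TensorProduct.map s.tensorAntipode LinearMap.id (s.tensorComul x))) := by
        change TensorProduct.dualDistrib k _ _ (TensorProduct.map _ _
          (s.leftDual.tensorComul F)) (TensorProduct.comm k _ _ (s.tensorComul x)) = _
        generalize s.tensorComul x = z
        induction z with
        | zero => simp
        | add x y hx hy => simp only [map_add, hx, hy]
        | tmul a c =>
          simp only [TensorProduct.map_tmul, LinearMap.mul'_apply, LinearMap.id_apply]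
          rw [hs.pair_apply_mul]
          generalize s.leftDual.tensorComul F = y
          induction y with
          | zero => simp
          | add x y hx hy => simp only [map_add, LinearMap.add_apply, hx, hy]
          | tmul d d' => simp
      rw [e, hs.tensorAntipode_left, Algebra.algebraMap_eq_smul_one, map_smul, pair_apply_one,
        smul_eq_mul, mul_comm]
      rfl
  exact LinearMap.congr_fun (LinearMap.congr_fun h F) x

end YDData

end PairingAntipode

/-! ### Reduced words and insertion of the last letter -/

section PermutationRecursion

/-- The permutation of `{0, …, n}` with `n ↦ p` that induces `y` on the remaining elements. -/
def insertPerm {n : ℕ} (p : Fin (n + 1)) (y : Equiv.Perm (Fin n)) : Equiv.Perm (Fin (n + 1)) :=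
  (finSuccEquiv' (Fin.last n)).trans (y.optionCongr.trans (finSuccEquiv' p).symm)

@[simp]
theorem insertPerm_last {n : ℕ} (p : Fin (n + 1)) (y : Equiv.Perm (Fin n)) :
    insertPerm p y (Fin.last n) = p := by simp [insertPerm]

@[simp]
theorem insertPerm_castSucc {n : ℕ} (p : Fin (n + 1)) (y : Equiv.Perm (Fin n)) (i : Fin n) :
    insertPerm p y i.castSucc = p.succAbove (y i) := by
  simp [insertPerm, finSuccEquiv'_last_apply_castSucc]

theorem insertPerm_bijective (n : ℕ) : Function.Bijective
    fun a : Fin (n + 1) × Equiv.Perm (Fin n) => insertPerm a.1 a.2 := by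
  rw [Fintype.bijective_iff_injective_and_card]
  refine ⟨?_, by simp [Fintype.card_perm, Nat.factorial_succ]⟩
  rintro ⟨p, y⟩ ⟨q, z⟩ h
  obtain rfl : p = q := by simpa using Equiv.congr_fun h (Fin.last n)
  congr 1
  ext i : 1
  simpa using Equiv.congr_fun h i.castSucc

/-- Inverses appear because `reducedWord x` counts the inversions of `x⁻¹`. The earlier runs do not
see the new element; the last run has one letter for each of the `n - p` values above `p`. -/
theorem reducedWord_insertPerm {n : ℕ} (p : Fin (n + 1)) (y : Equiv.Perm (Fin n)) :
    reducedWord (insertPerm p y).symm =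
      reducedWord y.symm ++ (List.range (n - p)).map fun t => n - 1 - t := by
  have hc : (Finset.univ.filter fun i => i < Fin.last n ∧
      insertPerm p y (Fin.last n) < insertPerm p y i).card = n - p := by
    simp only [Finset.card_filter, Fin.sum_univ_castSucc, insertPerm_castSucc, insertPerm_last,
      Fin.castSucc_lt_last, true_and, lt_irrefl, and_false, if_false, add_zero]
    rw [Equiv.sum_comp y fun i => if p < p.succAbove i then 1 else 0]
    simp only [Fin.lt_succAbove_iff_le_castSucc, Fin.le_def, Fin.val_castSucc]
    rw [Fin.sum_univ_eq_sum_range (fun i => if (p : ℕ) ≤ i then 1 else 0) n,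
      ← Finset.card_filter]
    rw [show (Finset.range n).filter (fun i => (p : ℕ) ≤ i) = Finset.Ico (p : ℕ) n by
      ext; simp [and_comm], Nat.card_Ico]
  have hj : ∀ j : Fin n, (Finset.univ.filter fun i => i < j.castSucc ∧
      insertPerm p y j.castSucc < insertPerm p y i).card =
      (Finset.univ.filter fun i => i < j ∧ y j < y i).card := by
    intro j
    simp only [Finset.card_filter, Fin.sum_univ_castSucc, insertPerm_castSucc,
      Fin.castSucc_lt_castSucc_iff, Fin.succAbove_lt_succAbove_iff]
    simp [(Fin.castSucc_lt_last j).le]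
  simp only [reducedWord, List.finRange_succ_last, List.flatMap_append, List.flatMap_map,
    Equiv.symm_symm, hj, Fin.val_castSucc, List.flatMap_cons, List.flatMap_nil, List.append_nil,
    hc, Fin.val_last]

/-- Used to see that a word of `Sₙ`, read on `n + 1` factors, leaves the last factor alone. -/
theorem reducedWord_lt {n : ℕ} (x : Equiv.Perm (Fin n)) {i : ℕ} (hi : i ∈ reducedWord x) :
    i + 1 < n := by
  simp only [reducedWord, List.mem_flatMap, List.mem_map, List.mem_range] at hi
  obtain ⟨j, -, t, ht, rfl⟩ := hi
  have h : (Finset.univ.filter fun i => i < j ∧ x.symm j < x.symm i).card ≤ j := by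
    calc _ ≤ (Finset.Iio j).card := Finset.card_le_card fun i => by simp +contextual
      _ = j := by simp
  omega

end PermutationRecursion

/-! ### Factorization of the quantum symmetrizer -/

section SymmetrizerRecursion

variable {k : Type u} [Field k] {V : Type w} [AddCommGroup V] [Module k V]
variable (c : V ⊗[k] V →ₗ[k] V ⊗[k] V)

theorem braidGen_tprod {n i : ℕ} (h : i + 1 < n) (v : Fin n → V) :
    braidGen c n i (PiTensorProduct.tprod k v) =
      insertPair ⟨i, Nat.lt_of_succ_lt h⟩ ⟨i + 1, h⟩ (by simp) v
        (c (v ⟨i, Nat.lt_of_succ_lt h⟩ ⊗ₜ v ⟨i + 1, h⟩)) := by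
  simp [braidGen, h, applyAt]

@[simp]
theorem insertPair_tmul {n : ℕ} (a b : Fin n) (hab : a ≠ b) (v : Fin n → V) (x y : V) :
    insertPair a b hab v (x ⊗ₜ[k] y) =
      PiTensorProduct.tprod k (Function.update (Function.update v a x) b y) := rfl

/-- `v₀ ⊗ ⋯ ⊗ vₙ ↦ f(vₙ) v₀ ⊗ ⋯ ⊗ vₙ₋₁`. -/
def contractLast (n : ℕ) (f : Module.Dual k V) : ⨂[k]^(n + 1) V →ₗ[k] ⨂[k]^n V :=
  PiTensorProduct.lift (MultilinearMap.uncurryRight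
    ((LinearMap.lsmul k (⨂[k]^n V) ∘ₗ f).flip.compMultilinearMap (PiTensorProduct.tprod k)))

@[simp]
theorem contractLast_tprod {n : ℕ} (f : Module.Dual k V) (v : Fin (n + 1) → V) :
    contractLast n f (PiTensorProduct.tprod k v) =
      f (v (Fin.last n)) • PiTensorProduct.tprod k (Fin.init v : Fin n → V) := by
  simp [contractLast]

/-- `v₁ ⊗ ⋯ ⊗ vₙ ↦ v ⊗ v₁ ⊗ ⋯ ⊗ vₙ`. -/
def tensorCons (n : ℕ) (v : V) : ⨂[k]^n V →ₗ[k] ⨂[k]^(n + 1) V :=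
  PiTensorProduct.lift ((PiTensorProduct.tprod k (s := fun _ : Fin (n + 1) => V)).curryLeft v)

@[simp]
theorem tensorCons_tprod {n : ℕ} (v : V) (u : Fin n → V) :
    tensorCons n v (PiTensorProduct.tprod k u) =
      PiTensorProduct.tprod k (Fin.cons v u : Fin (n + 1) → V) := by
  simp [tensorCons]

/-- With a finite basis, a tensor is rebuilt from the contractions of its last factor with the
coordinate functionals. -/
theorem contractLast_ext {n : ℕ} [Module.Finite k V] {x : ⨂[k]^(n + 1) V}
    (h : ∀ f, contractLast n f x = 0) : x = 0 := by
  let b := Module.finBasis k V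
  -- `σ v` appends `v` as the last factor.
  let σ : V → ⨂[k]^n V →ₗ[k] ⨂[k]^(n + 1) V := fun v => PiTensorProduct.lift
    ((LinearMap.applyₗ v).compMultilinearMap
      (PiTensorProduct.tprod k (s := fun _ : Fin (n + 1) => V)).curryRight)
  have hσ : ∀ v u, σ v (PiTensorProduct.tprod k u) =
      PiTensorProduct.tprod k (Fin.snoc u v : Fin (n + 1) → V) := by
    intro v u
    simp [σ]
  have e : ∑ i, σ (b i) ∘ₗ contractLast n (b.coord i) = LinearMap.id := by
    refine PiTensorProduct.ext (MultilinearMap.ext fun v => ?_)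
    simp only [LinearMap.compMultilinearMap_apply, LinearMap.sum_apply, LinearMap.comp_apply,
      contractLast_tprod, map_smul, hσ, LinearMap.id_apply]
    have h1 := congrArg ((PiTensorProduct.tprod k
      (s := fun _ : Fin (n + 1) => V)).curryRight (Fin.init v)) (b.sum_repr (v (Fin.last n)))
    rw [map_sum] at h1
    simpa only [map_smul, MultilinearMap.curryRight_apply, Fin.snoc_init_self,
      Module.Basis.coord_apply] using h1
  have h1 := LinearMap.congr_fun e x
  simpa [h] using h1.symm

theorem contractLast_braidGen {n i : ℕ} (h : i + 1 < n) (f : Module.Dual k V)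
    (x : ⨂[k]^(n + 1) V) :
    contractLast n f (braidGen c (n + 1) i x) = braidGen c n i (contractLast n f x) := by
  revert x
  suffices contractLast n f ∘ₗ braidGen c (n + 1) i = braidGen c n i ∘ₗ contractLast n f from
    fun x => LinearMap.congr_fun this x
  refine PiTensorProduct.ext (MultilinearMap.ext fun v => ?_)
  simp only [LinearMap.compMultilinearMap_apply, LinearMap.comp_apply, contractLast_tprod, map_smul,
    braidGen_tprod c h, braidGen_tprod c (h.trans (Nat.lt_succ_self n))]
  change contractLast n f (insertPair (Fin.castSucc ⟨i, Nat.lt_of_succ_lt h⟩) (Fin.castSucc ⟨i + 1, h⟩) _ v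
    (c (Fin.init v ⟨i, Nat.lt_of_succ_lt h⟩ ⊗ₜ[k] Fin.init v ⟨i + 1, h⟩))) = _
  generalize c _ = z
  induction z with
  | zero => simp
  | add x y hx hy => simp only [map_add, smul_add, hx, hy]
  | tmul x y =>
    rw [insertPair_tmul, insertPair_tmul, contractLast_tprod, Fin.init_update_castSucc,
      Fin.init_update_castSucc, Function.update_of_ne (Fin.castSucc_lt_last _).ne',
      Function.update_of_ne (Fin.castSucc_lt_last _).ne']

theorem braidGen_tensorCons {n i : ℕ} (h : i + 1 < n) (v : V) (x : ⨂[k]^n V) :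
    braidGen c (n + 1) (i + 1) (tensorCons n v x) = tensorCons n v (braidGen c n i x) := by
  revert x
  suffices braidGen c (n + 1) (i + 1) ∘ₗ tensorCons n v = tensorCons n v ∘ₗ braidGen c n i from
    fun x => LinearMap.congr_fun this x
  refine PiTensorProduct.ext (MultilinearMap.ext fun u => ?_)
  simp only [LinearMap.compMultilinearMap_apply, LinearMap.comp_apply, tensorCons_tprod,
    braidGen_tprod c h, braidGen_tprod c (Nat.succ_lt_succ h)]
  change insertPair (Fin.succ ⟨i, Nat.lt_of_succ_lt h⟩) (Fin.succ ⟨i + 1, h⟩) _ _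
    (c ((Fin.cons v u : Fin (n + 1) → V) (Fin.succ ⟨i, Nat.lt_of_succ_lt h⟩) ⊗ₜ[k]
      (Fin.cons v u : Fin (n + 1) → V) (Fin.succ ⟨i + 1, h⟩))) = _
  rw [Fin.cons_succ, Fin.cons_succ]
  generalize c _ = z
  induction z with
  | zero => simp
  | add x y hx hy => simp only [map_add, hx, hy]
  | tmul x y =>
    rw [insertPair_tmul, insertPair_tmul, tensorCons_tprod, Fin.cons_update, Fin.cons_update]

theorem contractLast_tensorCons {n : ℕ} (f : Module.Dual k V) (v : V) (x : ⨂[k]^(n + 1) V) :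
    contractLast (n + 1) f (tensorCons (n + 1) v x) = tensorCons n v (contractLast n f x) := by
  revert x
  suffices contractLast (n + 1) f ∘ₗ tensorCons (n + 1) v = tensorCons n v ∘ₗ contractLast n f from
    fun x => LinearMap.congr_fun this x
  refine PiTensorProduct.ext (MultilinearMap.ext fun u => ?_)
  simp only [LinearMap.compMultilinearMap_apply, LinearMap.comp_apply, tensorCons_tprod,
    contractLast_tprod, map_smul]
  congr 2
  funext i
  cases i using Fin.cases with
  | zero => rfl
  | succ i => simp [Fin.init]

/-- The endomorphism `σᵢ₊ᵣ₋₁ ⋯ σᵢ₊₁ σᵢ` of `V^{⊗n}`. -/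
def braidRun (n i r : ℕ) : Module.End k (⨂[k]^n V) :=
  ((List.range r).map fun t => braidGen c n (i + r - 1 - t)).prod

/-- The endomorphism `1 + σₙ₋₁ + σₙ₋₁ σₙ₋₂ + ⋯ + σₙ₋₁ ⋯ σ₀` of `V^{⊗(n + 1)}`. -/
def braidShuffle (n : ℕ) : Module.End k (⨂[k]^(n + 1) V) :=
  ∑ r ∈ Finset.range (n + 1), braidRun c (n + 1) (n - r) r

/-- The coset decomposition of `Sₙ₊₁` over `Sₙ`, compatible with the chosen reduced words. The left
factor is `𝔖ⁿ ⊗ id`, written with the generators on `n + 1` factors. -/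
theorem symmetrizer_succ (n : ℕ) : symmetrizer c (n + 1) =
    (∑ y : Equiv.Perm (Fin n), ((reducedWord y).map (braidGen c (n + 1))).prod) *
      braidShuffle c n := by
  -- The sums are taken over inverses to match `reducedWord_insertPerm`.
  have h1 : symmetrizer c (n + 1) = ∑ x : Equiv.Perm (Fin (n + 1)), braidLift c x.symm :=
    (Equiv.sum_comp (Equiv.inv (Equiv.Perm (Fin (n + 1)))) (braidLift c)).symm
  have h2 : ∑ y : Equiv.Perm (Fin n), ((reducedWord y).map (braidGen c (n + 1))).prod =
      ∑ y : Equiv.Perm (Fin n), ((reducedWord y.symm).map (braidGen c (n + 1))).prod :=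
    (Equiv.sum_comp (Equiv.inv (Equiv.Perm (Fin n)))
      fun y => ((reducedWord y).map (braidGen c (n + 1))).prod).symm
  rw [h1, h2, ← (insertPerm_bijective n).sum_comp, Fintype.sum_prod_type, Finset.sum_comm,
    Finset.sum_mul]
  refine Finset.sum_congr rfl fun y _ => ?_
  simp only [braidLift, reducedWord_insertPerm, List.map_append, List.prod_append, List.map_map]
  -- The run attached to `p` has length `r = n - p`, whence the reflection of the range.
  rw [← Finset.mul_sum, braidShuffle,
    Fin.sum_univ_eq_sum_range (fun p => ((List.range (n - p)).map
      (braidGen c (n + 1) ∘ fun t => n - 1 - t)).prod) (n + 1),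
    ← Finset.sum_range_reflect (fun r => braidRun c (n + 1) (n - r) r)]
  congr 1
  refine Finset.sum_congr rfl fun p hp => ?_
  rw [Finset.mem_range] at hp
  rw [braidRun, show n + 1 - 1 - p = n - p by omega, show n - (n - p) + (n - p) - 1 = n - 1 by omega]
  rfl

/-- The left factor in `symmetrizer_succ` does not touch the last tensor factor, so the contraction
passes through it. This is the inductive step from degree `n` to `n + 1`. -/
theorem contractLast_symmetrizer (n : ℕ) (f : Module.Dual k V) (x : ⨂[k]^(n + 1) V) :
    contractLast n f (symmetrizer c (n + 1) x) =
      symmetrizer c n (contractLast n f (braidShuffle c n x)) := by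
  have h : ∀ (l : List ℕ), (∀ i ∈ l, i + 1 < n) → ∀ x : ⨂[k]^(n + 1) V,
      contractLast n f ((l.map (braidGen c (n + 1))).prod x) =
        (l.map (braidGen c n)).prod (contractLast n f x) := by
    intro l
    induction l with
    | nil => simp
    | cons i l ih =>
      intro hl x
      rw [List.map_cons, List.map_cons, List.prod_cons, List.prod_cons, Module.End.mul_apply,
        Module.End.mul_apply, contractLast_braidGen c (hl i (by simp)),
        ih fun j hj => hl j (by simp [hj])]
  rw [symmetrizer_succ, Module.End.mul_apply, LinearMap.sum_apply, map_sum, symmetrizer,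
    LinearMap.sum_apply]
  exact Finset.sum_congr rfl fun y _ => h _ (fun i hi => reducedWord_lt y hi) _

theorem braidRun_tensorCons {n i r : ℕ} (h : i + r < n) (v : V) (x : ⨂[k]^n V) :
    braidRun c (n + 1) (i + 1) r (tensorCons n v x) = tensorCons n v (braidRun c n i r x) := by
  have key : ∀ l : List ℕ, (∀ t ∈ l, t < r) →
      (l.map fun t => braidGen c (n + 1) (i + 1 + r - 1 - t)).prod (tensorCons n v x) =
        tensorCons n v ((l.map fun t => braidGen c n (i + r - 1 - t)).prod x) := by
    intro l
    induction l with
    | nil => simp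
    | cons t l ih =>
      intro hl
      have ht := hl t (by simp)
      rw [List.map_cons, List.map_cons, List.prod_cons, List.prod_cons, Module.End.mul_apply,
        Module.End.mul_apply, ih fun j hj => hl j (by simp [hj]), ← braidGen_tensorCons c (by omega)]
      congr 2
      omega
  exact key _ fun t ht => List.mem_range.1 ht

theorem braidRun_succ (n i r : ℕ) :
    braidRun c n i (r + 1) = braidRun c n (i + 1) r * braidGen c n i := by
  rw [braidRun, List.range_succ, List.map_append, List.prod_append, braidRun]
  congr 2
  · refine List.map_congr_left fun t _ => ?_
    congr 1
    omega
  · simp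

/-- Every run except the longest avoids the first factor. The two summands correspond to those of
the twisted Leibniz rule. -/
theorem braidShuffle_tensorCons (n : ℕ) (v : V) (x : ⨂[k]^(n + 1) V) :
    braidShuffle c (n + 1) (tensorCons (n + 1) v x) =
      tensorCons (n + 1) v (braidShuffle c n x) +
        braidRun c (n + 2) 0 (n + 1) (tensorCons (n + 1) v x) := by
  rw [braidShuffle, Finset.sum_range_succ, LinearMap.add_apply, LinearMap.sum_apply, braidShuffle,
    LinearMap.sum_apply, map_sum, Nat.sub_self]
  congr 1
  refine Finset.sum_congr rfl fun r hr => ?_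
  rw [Finset.mem_range] at hr
  rw [← braidRun_tensorCons c (by omega)]
  congr 2
  omega

end SymmetrizerRecursion

/-! ### Tensor powers inside the tensor algebra -/

section Radical

variable {k : Type u} [Field k] {V : Type w} [AddCommGroup V] [Module k V]

/-- The first factor is restricted to basis vectors, for which the Leibniz rule and the braiding are
expressed by coefficients. -/
theorem linearMap_ext_tensorCons {X ι : Type*} [AddCommGroup X] [Module k X] {n : ℕ}
    {F G : ⨂[k]^(n + 1) V →ₗ[k] X} (b : Module.Basis ι k V)
    (h : ∀ j y, F (tensorCons n (b j) y) = G (tensorCons n (b j) y)) : F = G := by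
  refine PiTensorProduct.ext (MultilinearMap.ext fun u => ?_)
  have e : F ∘ₗ (PiTensorProduct.tprod k).toLinearMap u 0 =
      G ∘ₗ (PiTensorProduct.tprod k).toLinearMap u 0 := by
    refine b.ext fun j => ?_
    have h1 := h j (PiTensorProduct.tprod k (Fin.tail u))
    rw [tensorCons_tprod, ← Fin.update_cons_zero (u 0), Fin.cons_self_tail] at h1
    exact h1
  simpa using LinearMap.congr_fun e (u 0)

theorem toTensorAlgebra_tensorCons {n : ℕ} (v : V) (x : ⨂[k]^n V) :
    TensorPower.toTensorAlgebra (tensorCons n v x) =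
      TensorAlgebra.ι k v * TensorPower.toTensorAlgebra x := by
  revert x
  suffices TensorPower.toTensorAlgebra ∘ₗ tensorCons n v =
      LinearMap.mulLeft k (TensorAlgebra.ι k v) ∘ₗ TensorPower.toTensorAlgebra from
    fun x => LinearMap.congr_fun this x
  refine PiTensorProduct.ext (MultilinearMap.ext fun u => ?_)
  simp [TensorPower.toTensorAlgebra_tprod, TensorAlgebra.tprod_apply]

theorem toTensorAlgebra_zero_eq (x : ⨂[k]^0 V) :
    ∃ a : k, x = a • PiTensorProduct.tprod k Fin.elim0 ∧
      TensorPower.toTensorAlgebra x = a • (1 : TensorAlgebra k V) := by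
  suffices ∃ a : k, x = a • PiTensorProduct.tprod k Fin.elim0 by
    obtain ⟨a, rfl⟩ := this
    exact ⟨a, rfl, by simp [TensorPower.toTensorAlgebra_tprod, TensorAlgebra.tprod_apply]⟩
  induction x using PiTensorProduct.induction_on with
  | smul_tprod a u => exact ⟨a, by rw [Subsingleton.elim u Fin.elim0]⟩
  | add x y hx hy =>
    obtain ⟨a, rfl⟩ := hx
    obtain ⟨c, rfl⟩ := hy
    exact ⟨a + c, (add_smul _ _ _).symm⟩

/-- Every element of the tensor algebra is a finite sum of homogeneous elements. -/
theorem exists_sum_toTensorAlgebra (x : TensorAlgebra k V) :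
    ∃ (N : ℕ) (y : ∀ n, ⨂[k]^n V),
      x = ∑ n ∈ Finset.range N, TensorPower.toTensorAlgebra (y n) := by
  classical
  let d := TensorAlgebra.toDirectSum x
  obtain ⟨N, hN⟩ := d.support.bddAbove
  refine ⟨N + 1, fun n => d n, ?_⟩
  rw [← TensorAlgebra.ofDirectSum_toDirectSum x]
  change TensorAlgebra.ofDirectSum d = _
  conv_lhs => rw [← DirectSum.sum_support_of d]
  rw [map_sum]
  have h : ∀ n (z : ⨂[k]^n V), TensorAlgebra.ofDirectSum (DirectSum.of _ n z) =
      TensorPower.toTensorAlgebra z := fun n z => DirectSum.toAddMonoid_of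
      (fun _ => LinearMap.toAddMonoidHom TensorPower.toTensorAlgebra) n z
  simp only [h]
  refine Finset.sum_subset (fun n hn => ?_) fun n _ hn => ?_
  · exact Finset.mem_range.2 (Nat.lt_succ_of_le (hN hn))
  · rw [DFinsupp.notMem_support_iff.1 hn, map_zero]

end Radical

/-! ### The Nichols ideal as the radical of the pairing -/

section Symmetrizer

variable {k : Type u} {H : Type v} [Field k] [Ring H] [HopfAlgebra k H]
variable {ι : Type*} [Fintype ι] [DecidableEq ι]
variable {V : Type w} [AddCommGroup V] [Module k V]
variable {W : Type w₁} [AddCommGroup W] [Module k W]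

namespace YDData

theorem algebraMapInv_toTensorAlgebra_succ {n : ℕ} (x : ⨂[k]^(n + 1) V) :
    TensorAlgebra.algebraMapInv (TensorPower.toTensorAlgebra x) = 0 := by
  have h : (TensorAlgebra.algebraMapInv (R := k) (M := V)).toLinearMap ∘ₗ
      TensorPower.toTensorAlgebra (n := n + 1) = 0 :=
    linearMap_ext_tensorCons (Module.Free.chooseBasis k V) fun j y => by
      simp [toTensorAlgebra_tensorCons, algebraMapInv_ι]
  exact LinearMap.congr_fun h x

theorem braiding_basis (s : YDData k H V) (b : Module.Basis ι k V) (j : ι) (v : V) :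
    s.braiding s (b j ⊗ₜ v) = ∑ i, s.act (s.coeff b j i) v ⊗ₜ b i := by
  rw [braiding_tmul, coact_basis, TensorProduct.sum_tmul, map_sum]
  simp

theorem braidGen_zero_tensorCons (s : YDData k H V) (b : Module.Basis ι k V) {n : ℕ} (j : ι)
    (v : V) (x : ⨂[k]^n V) :
    braidGen (s.braiding s) (n + 2) 0 (tensorCons (n + 1) (b j) (tensorCons n v x)) =
      ∑ i, tensorCons (n + 1) (s.act (s.coeff b j i) v) (tensorCons n (b i) x) := by
  revert x
  suffices braidGen (s.braiding s) (n + 2) 0 ∘ₗ tensorCons (n + 1) (b j) ∘ₗ tensorCons n v =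
      ∑ i, tensorCons (n + 1) (s.act (s.coeff b j i) v) ∘ₗ tensorCons n (b i) from
    fun x => by simpa using LinearMap.congr_fun this x
  refine PiTensorProduct.ext (MultilinearMap.ext fun u => ?_)
  simp only [LinearMap.compMultilinearMap_apply, LinearMap.comp_apply, tensorCons_tprod,
    LinearMap.sum_apply]
  rw [braidGen_tprod _ (by omega)]
  change insertPair _ _ _ _ (s.braiding s (b j ⊗ₜ v)) = _
  rw [braiding_basis, map_sum]
  refine Finset.sum_congr rfl fun i _ => ?_
  rw [insertPair_tmul]
  congr 1
  change Function.update (Function.update _ 0 _) (Fin.succ 0) _ = _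
  rw [Fin.update_cons_zero, ← Fin.cons_update, Fin.update_cons_zero]

variable {s : YDData k H V} (hs : s.IsYetterDrinfeld)
include hs

/-- The longest run carries `bⱼ` past all other factors to the last position, where `f` evaluates
it; its coefficients act on the factors crossed, which adds up to the diagonal action. -/
theorem IsYetterDrinfeld.contractLast_braidRun (b : Module.Basis ι k V) {n : ℕ}
    (f : Module.Dual k V) (j : ι) (x : ⨂[k]^n V) :
    TensorPower.toTensorAlgebra (contractLast n f
        (braidRun (s.braiding s) (n + 1) 0 n (tensorCons n (b j) x))) =
      ∑ i, f (b i) • s.tensorAct (s.coeff b j i) (TensorPower.toTensorAlgebra x) := by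
  have hb := hs.isComatrix_coeff b
  induction n generalizing j with
  | zero =>
    obtain ⟨a, rfl, h⟩ := toTensorAlgebra_zero_eq x
    rw [h]
    simp [braidRun, tensorAct_one, hb.counit, TensorPower.toTensorAlgebra_tprod,
      TensorAlgebra.tprod_apply]
    exact smul_comm _ _ _
  | succ n ih =>
    revert x
    suffices TensorPower.toTensorAlgebra ∘ₗ contractLast (n + 1) f ∘ₗ
        braidRun (s.braiding s) (n + 2) 0 (n + 1) ∘ₗ tensorCons (n + 1) (b j) =
        ∑ i, f (b i) • (s.tensorAct (s.coeff b j i) ∘ₗ TensorPower.toTensorAlgebra) from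
      fun x => by simpa using LinearMap.congr_fun this x
    refine linearMap_ext_tensorCons b fun p x => ?_
    simp only [LinearMap.comp_apply, LinearMap.sum_apply, LinearMap.smul_apply, braidRun_succ,
      Module.End.mul_apply, braidGen_zero_tensorCons, map_sum,
      braidRun_tensorCons _ (show 0 + n < n + 1 by omega), contractLast_tensorCons,
      toTensorAlgebra_tensorCons, ih, s.tensorAct_mul_comatrix hb, tensorAct_ι, Finset.mul_sum,
      Finset.smul_sum, mul_smul_comm]
    exact Finset.sum_comm

/-- Both sides satisfy the same recursion in the first factor: `braidShuffle_tensorCons` with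
`contractLast_braidRun` on one side, `skewDer_ι_mul` on the other. -/
theorem IsYetterDrinfeld.contractLast_braidShuffle [Module.Finite k V] {n : ℕ}
    (f : Module.Dual k V) (x : ⨂[k]^(n + 1) V) :
    TensorPower.toTensorAlgebra (contractLast n f (braidShuffle (s.braiding s) n x)) =
      s.skewDer f (TensorPower.toTensorAlgebra x) := by
  let b := Module.finBasis k V
  revert x
  suffices TensorPower.toTensorAlgebra ∘ₗ contractLast n f ∘ₗ braidShuffle (s.braiding s) n =
      s.skewDer f ∘ₗ TensorPower.toTensorAlgebra from fun x => LinearMap.congr_fun this x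
  induction n with
  | zero =>
    refine linearMap_ext_tensorCons b fun j x => ?_
    have h := hs.contractLast_braidRun b f j x
    simp only [LinearMap.comp_apply, toTensorAlgebra_tensorCons, skewDer_ι_mul, ← h]
    obtain ⟨a, rfl, h0⟩ := toTensorAlgebra_zero_eq x
    simp [h0, skewDer_one, braidShuffle]
  | succ n ih =>
    refine linearMap_ext_tensorCons b fun j x => ?_
    have h := hs.contractLast_braidRun b f j x
    have h1 := LinearMap.congr_fun ih x
    simp only [LinearMap.comp_apply] at h1
    simp only [LinearMap.comp_apply, toTensorAlgebra_tensorCons, skewDer_ι_mul, ← h, ← h1,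
      braidShuffle_tensorCons, map_add, contractLast_tensorCons]

variable [Module.Finite k V] {κ : W →ₗ[k] Module.Dual k V}

/-- Removing the first letter of `F` applies a skew derivation to `x`, which by
`contractLast_symmetrizer` maps `ker 𝔖ⁿ⁺¹` into `ker 𝔖ⁿ`. -/
theorem IsYetterDrinfeld.pair_eq_zero_of_symmetrizer {n : ℕ} {x : ⨂[k]^n V}
    (hx : symmetrizer (s.braiding s) n x = 0) (F : TensorAlgebra k W) :
    s.pair κ F (TensorPower.toTensorAlgebra x) = 0 := by
  induction n generalizing F with
  | zero =>
    have : symmetrizer (s.braiding s) 0 x = x := by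
      simp [symmetrizer, braidLift, reducedWord]
    rw [← this, hx, map_zero, map_zero]
  | succ n ih =>
    induction F using tensorAlgebra_induction_left with
    | one =>
      rw [pair_one]
      exact algebraMapInv_toTensorAlgebra_succ x
    | add F G hF hG => rw [map_add, LinearMap.add_apply, hF, hG, add_zero]
    | smul a F hF => rw [map_smul, LinearMap.smul_apply, hF, smul_zero]
    | mul w F _ =>
      rw [pair_ι_mul, ← hs.contractLast_braidShuffle]
      refine ih ?_ F
      rw [← contractLast_symmetrizer, hx, map_zero]

/-- The converse is stated for inhomogeneous sums, since the radical is not known beforehand to be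
graded. Surjectivity of `κ` makes every contraction available. -/
theorem IsYetterDrinfeld.symmetrizer_eq_zero_of_pair (hκ : Function.Surjective κ) {n N : ℕ}
    (hn : n < N) {x : ∀ m, ⨂[k]^m V}
    (hx : ∀ F, s.pair κ F (∑ m ∈ Finset.range N, TensorPower.toTensorAlgebra (x m)) = 0) :
    symmetrizer (s.braiding s) n (x n) = 0 := by
  obtain ⟨a, h0, h0'⟩ := toTensorAlgebra_zero_eq (x 0)
  induction n generalizing N x a with
  | zero =>
    obtain ⟨N, rfl⟩ : ∃ M, N = M + 1 := ⟨N - 1, by omega⟩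
    -- Pairing with `1` is the counit, which isolates the scalar component.
    have h1 := hx 1
    rw [pair_one, Finset.sum_range_succ', h0'] at h1
    simp [algebraMapInv_toTensorAlgebra_succ] at h1
    rw [h0, h1, zero_smul, map_zero]
  | succ n ih =>
    obtain ⟨N, rfl⟩ : ∃ M, N = M + 1 := ⟨N - 1, by omega⟩
    refine contractLast_ext fun f => ?_
    obtain ⟨w, rfl⟩ := hκ f
    rw [contractLast_symmetrizer]
    obtain ⟨a', h1, h1'⟩ := toTensorAlgebra_zero_eq
      (contractLast 0 (κ w) (braidShuffle (s.braiding s) 0 (x 1)))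
    -- The new family consists of the components of `∂_w` applied to the sum: degrees drop by one
    -- and the scalar component disappears.
    refine ih (N := N) (x := fun m => contractLast m (κ w) (braidShuffle (s.braiding s) m (x (m + 1))))
      (by omega) (fun F => ?_) a' h1 h1'
    have h2 := hx (TensorAlgebra.ι k w * F)
    rw [pair_ι_mul, Finset.sum_range_succ', h0'] at h2
    simp only [map_add, map_smul, skewDer_one, smul_zero, add_zero] at h2
    simp only [hs.contractLast_braidShuffle, ← map_sum]
    exact h2

/-- The Nichols ideal is the radical of the pairing. -/
theorem IsYetterDrinfeld.mem_nicholsIdeal (hκ : Function.Surjective κ) {x : TensorAlgebra k V} :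
    x ∈ s.nicholsIdeal ↔ ∀ F, s.pair κ F x = 0 := by
  constructor
  · intro hx F
    have : s.nicholsIdeal ≤ LinearMap.ker (s.pair κ F) := by
      refine iSup_le fun n => ?_
      rintro _ ⟨y, hy, rfl⟩
      exact hs.pair_eq_zero_of_symmetrizer hy F
    exact this hx
  · intro hx
    obtain ⟨N, y, rfl⟩ := exists_sum_toTensorAlgebra x
    refine Submodule.sum_mem _ fun n hn => ?_
    exact Submodule.mem_iSup_of_mem n ⟨y n,
      hs.symmetrizer_eq_zero_of_pair hκ (Finset.mem_range.1 hn) hx, rfl⟩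

end YDData

end Symmetrizer

/-! ### Separating families and tensor products -/

section Separation

variable {k : Type u} [Field k]

/-- A family of functionals that separates the points of `Q` separates the points of `A ⊗ Q`. -/
theorem tensor_eq_zero_of_separating {A : Type v} [AddCommGroup A] [Module k A] {Q : Type w}
    [AddCommGroup Q] [Module k Q] {X : Type*} {φ : X → Module.Dual k Q}
    (hφ : ∀ q, (∀ x, φ x q = 0) → q = 0) {z : A ⊗[k] Q}
    (hz : ∀ x, TensorProduct.rid k A (TensorProduct.map LinearMap.id (φ x) z) = 0) : z = 0 := by
  let b := Module.Free.chooseBasis k A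
  refine (TensorProduct.equivFinsuppOfBasisLeft b).injective ?_
  rw [map_zero]
  ext i
  refine hφ _ fun x => ?_
  have e : φ x ∘ₗ Finsupp.lapply i ∘ₗ (TensorProduct.equivFinsuppOfBasisLeft (N := Q) b).toLinearMap =
      b.coord i ∘ₗ (TensorProduct.rid k A).toLinearMap ∘ₗ TensorProduct.map LinearMap.id (φ x) := by
    ext a q
    simp [mul_comm]
  have h := LinearMap.congr_fun e z
  simp only [LinearMap.comp_apply, LinearEquiv.coe_coe, hz, map_zero] at h
  exact h

end Separation

/-! ### The Nichols ideal is a Hopf ideal -/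

section HopfIdeal

variable {k : Type u} {H : Type v} [Field k] [Ring H] [HopfAlgebra k H]
variable {V : Type w} [AddCommGroup V] [Module k V] [Module.Finite k V]

namespace YDData

variable {s : YDData k H V} (hs : s.IsYetterDrinfeld)
include hs

theorem IsYetterDrinfeld.mem_nicholsIdeal_iff {x : TensorAlgebra k V} :
    x ∈ s.nicholsIdeal ↔ (s.pair LinearMap.id).flip x = 0 := by
  rw [hs.mem_nicholsIdeal (κ := LinearMap.id) Function.surjective_id, LinearMap.ext_iff]
  rfl

/-- The pairing of `T(*V)` with the quotient of `T(V)` by its radical. -/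
def IsYetterDrinfeld.nicholsPair :
    TensorAlgebra k (Module.Dual k V) →ₗ[k] Module.Dual k s.NicholsSpace :=
  LinearMap.flip (s.nicholsIdeal.liftQ (s.pair LinearMap.id).flip
    fun _ hx => hs.mem_nicholsIdeal_iff.1 hx)

@[simp]
theorem IsYetterDrinfeld.nicholsPair_mk (F : TensorAlgebra k (Module.Dual k V))
    (x : TensorAlgebra k V) :
    hs.nicholsPair F (Submodule.Quotient.mk x) = s.pair LinearMap.id F x := rfl

theorem IsYetterDrinfeld.nicholsPair_separating (q : s.NicholsSpace)
    (hq : ∀ F, hs.nicholsPair F q = 0) : q = 0 := by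
  obtain ⟨x, rfl⟩ := s.nicholsIdeal.mkQ_surjective q
  exact (Submodule.Quotient.mk_eq_zero _).2
    (hs.mem_nicholsIdeal_iff.2 (LinearMap.ext fun F => hq F))

/-- The functionals `⟨F, ·⟩` separate the points of a finite-dimensional space, so they exhaust its
dual. -/
theorem IsYetterDrinfeld.nicholsPair_surjective [Module.Finite k s.NicholsSpace] :
    Function.Surjective hs.nicholsPair := by
  have h : (LinearMap.range hs.nicholsPair).dualCoannihilator = ⊥ := by
    rw [eq_bot_iff]
    intro q hq
    refine hs.nicholsPair_separating q fun F => ?_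
    exact (Submodule.mem_dualCoannihilator q).1 hq _ ⟨F, rfl⟩
  rw [← LinearMap.range_eq_top, ← Subspace.dualCoannihilator_dualAnnihilator_eq
    (W := LinearMap.range hs.nicholsPair), h, Submodule.dualAnnihilator_bot]

variable [BijectiveAntipode k H]

/-- By `pair_dual` this is `mem_nicholsIdeal` for `*V`, with `κ` the evaluation map from `V` onto
the dual of `*V`. -/
theorem IsYetterDrinfeld.mem_nicholsIdeal_leftDual {F : TensorAlgebra k (Module.Dual k V)} :
    F ∈ s.leftDual.nicholsIdeal ↔ s.pair LinearMap.id F = 0 := by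
  rw [hs.leftDual.mem_nicholsIdeal (κ := Module.Dual.eval k V)
    (Module.evalEquiv k V).surjective, LinearMap.ext_iff]
  simp only [hs.pair_dual, LinearMap.zero_apply]

theorem IsYetterDrinfeld.ker_nicholsPair :
    LinearMap.ker hs.nicholsPair = s.leftDual.nicholsIdeal := by
  ext F
  rw [hs.mem_nicholsIdeal_leftDual, LinearMap.mem_ker]
  refine ⟨fun h => LinearMap.ext fun x => LinearMap.congr_fun h (Submodule.Quotient.mk x),
    fun h => LinearMap.ext fun q => ?_⟩
  obtain ⟨x, rfl⟩ := s.nicholsIdeal.mkQ_surjective q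
  exact LinearMap.congr_fun h x

/-- The sum of the kernels of the quantum symmetrizers is a Hopf ideal. -/
theorem IsYetterDrinfeld.isHopfIdeal_nicholsIdeal :
    s.tensorHopf.IsHopfIdeal s.nicholsIdeal where
  act_mem h x hx := by
    rw [hs.mem_nicholsIdeal_iff] at hx ⊢
    ext F
    change s.pair LinearMap.id F (s.tensorAct h x) = 0
    rw [← hs.pair_act]
    exact LinearMap.congr_fun hx _
  coact_mem x hx := by
    rw [hs.mem_nicholsIdeal_iff] at hx
    refine tensor_eq_zero_of_separating hs.nicholsPair_separating fun F => ?_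
    -- `pair_coact` controls the coaction only after applying `S`, so injectivity of `S` is needed
    -- here.
    refine antipode_injective (k := k) ?_
    have h := hs.pair_coact F x
    rw [hx, TensorProduct.map_zero_right, LinearMap.zero_apply, map_zero] at h
    rw [map_zero, h]
    change _ = antipodeEval H (s.pair LinearMap.id F) (s.tensorCoact x)
    change HopfAlgebra.antipode k (TensorProduct.rid k H (TensorProduct.map _ _
      (TensorProduct.map LinearMap.id s.nicholsIdeal.mkQ (s.tensorCoact x)))) = _
    generalize s.tensorCoact x = z
    induction z with
    | zero => simp
    | add x y hx hy => simp only [map_add, hx, hy]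
    | tmul a c => simp
  mul_mem_left x y hy := by
    rw [hs.mem_nicholsIdeal_iff] at hy ⊢
    ext F
    change s.pair LinearMap.id F (x * y) = 0
    rw [hs.pair_apply_mul, hy, TensorProduct.map_zero_left, LinearMap.zero_apply, map_zero]
  mul_mem_right x hx y := by
    rw [hs.mem_nicholsIdeal_iff] at hx ⊢
    ext F
    change s.pair LinearMap.id F (x * y) = 0
    rw [hs.pair_apply_mul, hx, TensorProduct.map_zero_right, LinearMap.zero_apply, map_zero]
  comul_mem x hx := by
    rw [hs.mem_nicholsIdeal_iff] at hx
    -- The two legs are tested separately, `F` on the right and `G` on the left; the result is `⟨FG,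
    -- x⟩`.
    refine tensor_eq_zero_of_separating hs.nicholsPair_separating fun F => ?_
    refine hs.nicholsPair_separating _ fun G => ?_
    have h := hs.pair_mul LinearMap.id F G x
    rw [show s.pair LinearMap.id (F * G) x = 0 from LinearMap.congr_fun hx _] at h
    rw [h]
    change hs.nicholsPair G (TensorProduct.rid k _ (TensorProduct.map _ _
      (TensorProduct.map _ _ (s.tensorComul x)))) = _
    generalize s.tensorComul x = z
    induction z with
    | zero => simp
    | add x y hx hy => simp only [map_add, hx, hy]
    | tmul a c => simp [mul_comm]
  counit_mem x hx := by
    rw [hs.mem_nicholsIdeal_iff] at hx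
    have h := LinearMap.congr_fun hx 1
    rwa [LinearMap.flip_apply, pair_one] at h
  antipode_mem x hx := by
    rw [hs.mem_nicholsIdeal_iff] at hx ⊢
    ext F
    change s.pair LinearMap.id F (s.tensorAntipode x) = 0
    rw [← hs.pair_antipode]
    exact LinearMap.congr_fun hx _

end YDData

end HopfIdeal

/-! ### Transport of structure along surjective morphisms -/

section Transport

variable {k : Type u} {H : Type v} [Field k] [Ring H] [HopfAlgebra k H]
variable {M : Type w} [AddCommGroup M] [Module k M]
variable {N : Type w₁} [AddCommGroup N] [Module k N]

theorem map_map_congr {X₁ X₂ Y₁ Y₂ Z₁ Z₂ W₁ W₂ : Type*} [AddCommGroup X₁] [Module k X₁]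
    [AddCommGroup X₂] [Module k X₂] [AddCommGroup Y₁] [Module k Y₁] [AddCommGroup Y₂] [Module k Y₂]
    [AddCommGroup Z₁] [Module k Z₁] [AddCommGroup Z₂] [Module k Z₂] [AddCommGroup W₁] [Module k W₁]
    [AddCommGroup W₂] [Module k W₂] {f₁ : X₁ →ₗ[k] Y₁} {f₂ : X₂ →ₗ[k] Y₂} {g₁ : Y₁ →ₗ[k] Z₁}
    {g₂ : Y₂ →ₗ[k] Z₂} {p₁ : X₁ →ₗ[k] W₁} {p₂ : X₂ →ₗ[k] W₂} {q₁ : W₁ →ₗ[k] Z₁}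
    {q₂ : W₂ →ₗ[k] Z₂} (h₁ : g₁ ∘ₗ f₁ = q₁ ∘ₗ p₁) (h₂ : g₂ ∘ₗ f₂ = q₂ ∘ₗ p₂) (z : X₁ ⊗[k] X₂) :
    TensorProduct.map g₁ g₂ (TensorProduct.map f₁ f₂ z) =
      TensorProduct.map q₁ q₂ (TensorProduct.map p₁ p₂ z) := by
  rw [TensorProduct.map_map, TensorProduct.map_map, h₁, h₂]

namespace YDData

variable {s : YDData k H M} {t : YDData k H N} {f : M →ₗ[k] N}

theorem IsHom.coact_apply (hf : s.IsHom t f) (m : M) :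
    t.coact (f m) = TensorProduct.map LinearMap.id f (s.coact m) :=
  LinearMap.congr_fun hf.coact_map m

theorem IsHom.tensor (hf : s.IsHom t f) :
    (s.tensor s).IsHom (t.tensor t) (TensorProduct.map f f) where
  map_act h z := by
    change TensorProduct.map f f (TensorProduct.homTensorHomMap (RingHom.id k) M M M M
      (TensorProduct.map s.act s.act (Coalgebra.comul h)) z) =
      TensorProduct.homTensorHomMap (RingHom.id k) N N N N
      (TensorProduct.map t.act t.act (Coalgebra.comul h)) (TensorProduct.map f f z)
    generalize (Coalgebra.comul (R := k) h) = y
    induction y with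
    | zero => simp
    | add x y hx hy => simp only [map_add, LinearMap.add_apply, hx, hy]
    | tmul a c =>
      induction z with
      | zero => simp
      | add x y hx hy => simp only [map_add, hx, hy]
      | tmul m n => simp [hf.map_act]
  coact_map := by
    refine TensorProduct.ext' fun m n => ?_
    simp only [LinearMap.comp_apply, TensorProduct.map_tmul, tensor_coact_tmul, hf.coact_apply]
    generalize s.coact m = y
    generalize s.coact n = z
    induction y with
    | zero => simp
    | add x y hx hy => simp only [map_add, TensorProduct.add_tmul, hx, hy]
    | tmul a c =>
      induction z with
      | zero => simp
      | add x y hx hy => simp only [map_add, TensorProduct.tmul_add, hx, hy]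
      | tmul m n => simp

theorem IsHom.braiding (hf : s.IsHom t f) (z : M ⊗[k] M) :
    t.braiding t (TensorProduct.map f f z) = TensorProduct.map f f (s.braiding s z) := by
  induction z with
  | zero => simp
  | add x y hx hy => simp only [map_add, hx, hy]
  | tmul m n =>
    simp only [TensorProduct.map_tmul, braiding_tmul, hf.coact_apply]
    generalize s.coact m = y
    induction y with
    | zero => simp
    | add x y hx hy => simp only [map_add, TensorProduct.add_tmul, hx, hy]
    | tmul a c => simp [hf.map_act]

theorem IsHom.isYetterDrinfeld (hf : s.IsHom t f) (hsurj : Function.Surjective f)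
    (hs : s.IsYetterDrinfeld) : t.IsYetterDrinfeld where
  one_act m := by
    obtain ⟨m, rfl⟩ := hsurj m
    rw [← hf.map_act, hs.one_act]
  mul_act g h m := by
    obtain ⟨m, rfl⟩ := hsurj m
    simp only [← hf.map_act, hs.mul_act]
  coassoc := by
    rw [← LinearMap.cancel_right hsurj]
    ext m
    have h := congrArg (TensorProduct.map LinearMap.id (TensorProduct.map LinearMap.id f))
      (LinearMap.congr_fun hs.coassoc m)
    simp only [LinearMap.comp_apply, LinearEquiv.coe_coe, hf.coact_apply] at h ⊢
    refine Eq.trans ?_ (h.trans ?_)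
    · generalize s.coact m = z
      induction z with
      | zero => simp
      | add x y hx hy => simp only [map_add, hx, hy]
      | tmul a c =>
        simp only [TensorProduct.map_tmul, LinearMap.id_apply]
        generalize (Coalgebra.comul (R := k) a) = y
        induction y with
        | zero => simp
        | add x y hx hy => simp only [map_add, TensorProduct.add_tmul, hx, hy]
        | tmul p q => simp
    · generalize s.coact m = z
      induction z with
      | zero => simp
      | add x y hx hy => simp only [map_add, hx, hy]
      | tmul a c => simp [hf.coact_apply]
  counit_coact := by
    rw [← LinearMap.cancel_right hsurj]
    ext m
    have h := congrArg f (LinearMap.congr_fun hs.counit_coact m)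
    simp only [LinearMap.comp_apply, LinearEquiv.coe_coe, hf.coact_apply, LinearMap.id_apply] at h ⊢
    refine Eq.trans ?_ h
    generalize s.coact m = z
    induction z with
    | zero => simp
    | add x y hx hy => simp only [map_add, hx, hy]
    | tmul a c => simp
  coact_act h m := by
    obtain ⟨m, rfl⟩ := hsurj m
    rw [← hf.map_act, hf.coact_apply, hs.coact_act, hf.coact_apply]
    generalize TensorProduct.map LinearMap.id Coalgebra.comul (Coalgebra.comul (R := k) h) = y
    generalize s.coact m = z
    induction z with
    | zero => simp
    | add x y hx hy => simp only [map_add, TensorProduct.tmul_add, hx, hy]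
    | tmul g n =>
      induction y with
      | zero => simp
      | add x y hx hy => simp only [map_add, TensorProduct.add_tmul, hx, hy]
      | tmul a y =>
        induction y with
        | zero => simp
        | add x y hx hy => simp only [map_add, TensorProduct.tmul_add, TensorProduct.add_tmul, hx, hy]
        | tmul b c => simp [sandwich_tmul, hf.map_act]

end YDData

namespace HopfData

variable {A : HopfData k H M} {B : HopfData k H N} {f : M →ₗ[k] N}

theorem middle_map {c : M ⊗[k] M →ₗ[k] M ⊗[k] M} {d : N ⊗[k] N →ₗ[k] N ⊗[k] N}
    (h : ∀ z, d (TensorProduct.map f f z) = TensorProduct.map f f (c z))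
    (z : (M ⊗[k] M) ⊗[k] (M ⊗[k] M)) :
    middle d (TensorProduct.map (TensorProduct.map f f) (TensorProduct.map f f) z) =
      TensorProduct.map (TensorProduct.map f f) (TensorProduct.map f f) (middle c z) := by
  induction z with
  | zero => simp
  | add x y hx hy => simp only [map_add, hx, hy]
  | tmul x y =>
    induction x with
    | zero => simp
    | add x y hx hy => simp only [map_add, TensorProduct.add_tmul, hx, hy]
    | tmul m n =>
      induction y with
      | zero => simp
      | add x y hx hy => simp only [map_add, TensorProduct.tmul_add, hx, hy]
      | tmul p q =>
        have e : d (f n ⊗ₜ f p) = TensorProduct.map f f (c (n ⊗ₜ p)) := by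
          rw [← h, TensorProduct.map_tmul]
        simp only [middle, TensorProduct.map_tmul, LinearMap.comp_apply, LinearEquiv.coe_coe,
          TensorProduct.assoc_tmul, TensorProduct.assoc_symm_tmul, LinearMap.id_apply, e]
        generalize c (n ⊗ₜ p) = z
        induction z with
        | zero => simp
        | add x y hx hy => simp only [map_add, TensorProduct.add_tmul, TensorProduct.tmul_add, hx, hy]
        | tmul x y => simp

theorem IsHom.mul_apply (hf : A.IsHom B f) (z : M ⊗[k] M) :
    B.mul (TensorProduct.map f f z) = f (A.mul z) := (LinearMap.congr_fun hf.map_mul z).symm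

theorem IsHom.mul_tmul (hf : A.IsHom B f) (x y : M) :
    B.mul (f x ⊗ₜ f y) = f (A.mul (x ⊗ₜ y)) := hf.mul_apply (x ⊗ₜ y)

theorem IsHom.comul_apply (hf : A.IsHom B f) (x : M) :
    B.comul (f x) = TensorProduct.map f f (A.comul x) := LinearMap.congr_fun hf.map_comul x

theorem IsHom.unit_apply (hf : A.IsHom B f) (a : k) : B.unit a = f (A.unit a) :=
  (LinearMap.congr_fun hf.map_unit a).symm

theorem IsHom.counit_apply (hf : A.IsHom B f) (x : M) : B.counit (f x) = A.counit x :=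
  LinearMap.congr_fun hf.map_counit x

theorem IsHom.antipode_apply (hf : A.IsHom B f) (x : M) :
    B.antipode (f x) = f (A.antipode x) := (LinearMap.congr_fun hf.map_antipode x).symm

/-- The image of a Hopf algebra under a surjective morphism is a Hopf algebra. -/
theorem IsHom.isHopfAlgebra (hf : A.IsHom B f) (hsurj : Function.Surjective f)
    (hA : A.IsHopfAlgebra) : B.IsHopfAlgebra where
  isYetterDrinfeld := hf.yd_hom.isYetterDrinfeld hsurj hA.isYetterDrinfeld
  mul_hom := {
    map_act := fun h z => by
      obtain ⟨z, rfl⟩ := TensorProduct.map_surjective hsurj hsurj z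
      rw [← hf.yd_hom.tensor.map_act, hf.mul_apply, hf.mul_apply, hA.mul_hom.map_act,
        hf.yd_hom.map_act]
    coact_map := by
      rw [← LinearMap.cancel_right (TensorProduct.map_surjective hsurj hsurj)]
      refine LinearMap.ext fun z => ?_
      simp only [LinearMap.comp_apply]
      rw [hf.mul_apply, hf.yd_hom.coact_apply, hA.mul_hom.coact_apply,
        hf.yd_hom.tensor.coact_apply]
      exact map_map_congr rfl hf.map_mul _ }
  unit_hom := {
    map_act := fun h a => by
      rw [hf.unit_apply, hf.unit_apply, hA.unit_hom.map_act, hf.yd_hom.map_act]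
    coact_map := by
      rw [← hf.map_unit, ← LinearMap.comp_assoc, hf.yd_hom.coact_map, LinearMap.comp_assoc,
        hA.unit_hom.coact_map, ← LinearMap.comp_assoc, ← TensorProduct.map_comp,
        LinearMap.id_comp] }
  comul_hom := {
    map_act := fun h x => by
      obtain ⟨x, rfl⟩ := hsurj x
      rw [← hf.yd_hom.map_act, hf.comul_apply, hf.comul_apply, hA.comul_hom.map_act,
        hf.yd_hom.tensor.map_act]
    coact_map := by
      rw [← LinearMap.cancel_right hsurj]
      refine LinearMap.ext fun x => ?_
      simp only [LinearMap.comp_apply]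
      rw [hf.comul_apply, hf.yd_hom.tensor.coact_apply, hf.yd_hom.coact_apply,
        hA.comul_hom.coact_apply]
      exact map_map_congr rfl hf.map_comul.symm _ }
  counit_hom := {
    map_act := fun h x => by
      obtain ⟨x, rfl⟩ := hsurj x
      rw [← hf.yd_hom.map_act, hf.counit_apply, hf.counit_apply, hA.counit_hom.map_act]
    coact_map := by
      rw [← LinearMap.cancel_right hsurj, LinearMap.comp_assoc, hf.map_counit,
        hA.counit_hom.coact_map, LinearMap.comp_assoc, hf.yd_hom.coact_map, ← LinearMap.comp_assoc,
        ← TensorProduct.map_comp, LinearMap.id_comp, hf.map_counit] }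
  antipode_hom := {
    map_act := fun h x => by
      obtain ⟨x, rfl⟩ := hsurj x
      rw [← hf.yd_hom.map_act, hf.antipode_apply, hf.antipode_apply, hA.antipode_hom.map_act,
        hf.yd_hom.map_act]
    coact_map := by
      rw [← LinearMap.cancel_right hsurj]
      refine LinearMap.ext fun x => ?_
      simp only [LinearMap.comp_apply]
      rw [hf.antipode_apply, hf.yd_hom.coact_apply, hf.yd_hom.coact_apply,
        hA.antipode_hom.coact_apply]
      exact map_map_congr rfl hf.map_antipode _ }
  mul_assoc := by
    refine TensorProduct.ext_threefold fun x y z => ?_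
    obtain ⟨x, rfl⟩ := hsurj x
    obtain ⟨y, rfl⟩ := hsurj y
    obtain ⟨z, rfl⟩ := hsurj z
    have h := LinearMap.congr_fun hA.mul_assoc ((x ⊗ₜ y) ⊗ₜ z)
    simp only [LinearMap.comp_apply, TensorProduct.map_tmul, LinearMap.id_apply,
      LinearEquiv.coe_coe, TensorProduct.assoc_tmul] at h ⊢
    simp only [hf.mul_tmul, h]
  unit_mul x := by
    obtain ⟨x, rfl⟩ := hsurj x
    rw [hf.unit_apply, hf.mul_tmul, hA.unit_mul]
  mul_unit x := by
    obtain ⟨x, rfl⟩ := hsurj x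
    rw [hf.unit_apply, hf.mul_tmul, hA.mul_unit]
  coassoc := by
    rw [← LinearMap.cancel_right hsurj]
    refine LinearMap.ext fun x => ?_
    have h := congrArg (TensorProduct.map f (TensorProduct.map f f))
      (LinearMap.congr_fun hA.coassoc x)
    simp only [LinearMap.comp_apply, LinearEquiv.coe_coe, hf.comul_apply] at h ⊢
    refine Eq.trans ?_ (h.trans ?_)
    · generalize A.comul x = z
      induction z with
      | zero => simp
      | add x y hx hy => simp only [map_add, hx, hy]
      | tmul a c =>
        simp only [TensorProduct.map_tmul, LinearMap.id_apply, hf.comul_apply]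
        generalize A.comul a = y
        induction y with
        | zero => simp
        | add x y hx hy => simp only [map_add, TensorProduct.add_tmul, hx, hy]
        | tmul p q => simp
    · generalize A.comul x = z
      induction z with
      | zero => simp
      | add x y hx hy => simp only [map_add, hx, hy]
      | tmul a c => simp [hf.comul_apply]
  counit_comul := by
    rw [← LinearMap.cancel_right hsurj]
    refine LinearMap.ext fun x => ?_
    have h := congrArg f (LinearMap.congr_fun hA.counit_comul x)
    simp only [LinearMap.comp_apply, LinearEquiv.coe_coe, hf.comul_apply, LinearMap.id_apply] at h ⊢
    refine Eq.trans ?_ h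
    generalize A.comul x = z
    induction z with
    | zero => simp
    | add x y hx hy => simp only [map_add, hx, hy]
    | tmul a c => simp [hf.counit_apply]
  comul_counit := by
    rw [← LinearMap.cancel_right hsurj]
    refine LinearMap.ext fun x => ?_
    have h := congrArg f (LinearMap.congr_fun hA.comul_counit x)
    simp only [LinearMap.comp_apply, LinearEquiv.coe_coe, hf.comul_apply, LinearMap.id_apply] at h ⊢
    refine Eq.trans ?_ h
    generalize A.comul x = z
    induction z with
    | zero => simp
    | add x y hx hy => simp only [map_add, hx, hy]
    | tmul a c => simp [hf.counit_apply]
  counit_unit := by rw [hf.unit_apply, hf.counit_apply, hA.counit_unit]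
  counit_mul x y := by
    obtain ⟨x, rfl⟩ := hsurj x
    obtain ⟨y, rfl⟩ := hsurj y
    simp only [hf.mul_tmul, hf.counit_apply, hA.counit_mul]
  comul_unit := by
    rw [hf.unit_apply, hf.comul_apply, hA.comul_unit, TensorProduct.map_tmul]
  comul_mul := by
    rw [← LinearMap.cancel_right (TensorProduct.map_surjective hsurj hsurj)]
    refine LinearMap.ext fun z => ?_
    have e : ∀ z, TensorProduct.map B.comul B.comul (TensorProduct.map f f z) =
        TensorProduct.map (TensorProduct.map f f) (TensorProduct.map f f)
          (TensorProduct.map A.comul A.comul z) :=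
      map_map_congr hf.map_comul hf.map_comul
    have e' : ∀ z, TensorProduct.map B.mul B.mul
        (TensorProduct.map (TensorProduct.map f f) (TensorProduct.map f f) z) =
        TensorProduct.map f f (TensorProduct.map A.mul A.mul z) :=
      map_map_congr hf.map_mul.symm hf.map_mul.symm
    have h := LinearMap.congr_fun hA.comul_mul z
    simp only [LinearMap.comp_apply] at h ⊢
    rw [hf.mul_apply, hf.comul_apply, h, e, middle_map hf.yd_hom.braiding, e']
  antipode_left := by
    rw [← LinearMap.cancel_right hsurj]
    refine LinearMap.ext fun x => ?_
    have h := congrArg f (LinearMap.congr_fun hA.antipode_left x)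
    simp only [LinearMap.comp_apply, hf.comul_apply, hf.counit_apply, hf.unit_apply] at h ⊢
    rw [← h, ← hf.mul_apply]
    exact congrArg B.mul (map_map_congr hf.map_antipode.symm
      (show LinearMap.id ∘ₗ f = f ∘ₗ LinearMap.id from rfl) _)
  antipode_right := by
    rw [← LinearMap.cancel_right hsurj]
    refine LinearMap.ext fun x => ?_
    have h := congrArg f (LinearMap.congr_fun hA.antipode_right x)
    simp only [LinearMap.comp_apply, hf.comul_apply, hf.counit_apply, hf.unit_apply] at h ⊢
    rw [← h, ← hf.mul_apply]
    exact congrArg B.mul (map_map_congr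
      (show LinearMap.id ∘ₗ f = f ∘ₗ LinearMap.id from rfl) hf.map_antipode.symm _)

theorem isHom_mkQ (A : HopfData k H M) (I : Submodule k M) (hI : A.IsHopfIdeal I) :
    A.IsHom (A.quotient I hI) I.mkQ where
  yd_hom := ⟨fun _ _ => rfl, rfl⟩
  map_mul := TensorProduct.ext' fun _ _ => rfl
  map_unit := rfl
  map_comul := rfl
  map_counit := rfl
  map_antipode := rfl

/-- Lets a morphism defined on `T(*V)` descend to the quotient `𝔅(*V)`. -/
theorem IsHom.of_comp_surjective {P : Type w₂} [AddCommGroup P] [Module k P] {C : HopfData k H P}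
    (hf : A.IsHom B f) (hsurj : Function.Surjective f) {g : N →ₗ[k] P}
    (hgf : A.IsHom C (g ∘ₗ f)) : B.IsHom C g where
  yd_hom := {
    map_act := fun h x => by
      obtain ⟨x, rfl⟩ := hsurj x
      rw [← hf.yd_hom.map_act]
      exact hgf.yd_hom.map_act h x
    coact_map := by
      rw [← LinearMap.cancel_right hsurj, LinearMap.comp_assoc, hgf.yd_hom.coact_map,
        LinearMap.comp_assoc, hf.yd_hom.coact_map, ← LinearMap.comp_assoc,
        ← TensorProduct.map_comp, LinearMap.id_comp] }
  map_mul := by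
    rw [← LinearMap.cancel_right (TensorProduct.map_surjective hsurj hsurj), LinearMap.comp_assoc,
      ← hf.map_mul, LinearMap.comp_assoc, ← TensorProduct.map_comp, ← hgf.map_mul,
      LinearMap.comp_assoc]
  map_unit := by rw [← hf.map_unit, ← LinearMap.comp_assoc, hgf.map_unit]
  map_comul := by
    rw [← LinearMap.cancel_right hsurj, LinearMap.comp_assoc, hgf.map_comul,
      LinearMap.comp_assoc, hf.map_comul, ← LinearMap.comp_assoc, ← TensorProduct.map_comp]
  map_counit := by
    rw [← LinearMap.cancel_right hsurj, LinearMap.comp_assoc, hgf.map_counit, hf.map_counit]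
  map_antipode := by
    rw [← LinearMap.cancel_right hsurj, LinearMap.comp_assoc, ← hf.map_antipode,
      ← LinearMap.comp_assoc, hgf.map_antipode, LinearMap.comp_assoc]

end HopfData

end Transport

/-! ### The morphism from `T(*V)` to the dual of the Nichols algebra -/

section DualNichols

variable {k : Type u} {H : Type v} [Field k] [Ring H] [HopfAlgebra k H]

namespace HopfData

variable [BijectiveAntipode k H] {R : Type w} [AddCommGroup R] [Module k R] [Module.Finite k R] {A : HopfData k H R}

@[simp]
theorem dualTensor_tmul_tmul (f g : Module.Dual k R) (x y : R) :
    dualTensor k R R (f ⊗ₜ g) (x ⊗ₜ y) = g x * f y := rfl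

/-- The multiplication of `(*R)ᵇᵒᵖ` is the transpose of the comultiplication of `R`. -/
theorem leftDual_bop_mul_apply (hA : A.toYDData.IsYetterDrinfeld)
    (z : Module.Dual k R ⊗[k] Module.Dual k R) (x : R) :
    A.leftDual.bop.mul z x = dualTensor k R R z (A.comul x) :=
  -- The braiding introduced by `bop` cancels the inverse braiding in `σ = φ ∘ c⁻¹`.
  congrArg (fun y => dualTensor k R R y (A.comul x))
    (YDData.braidingInv_braiding hA.leftDual hA.leftDual z)

/-- The comultiplication of `(*R)ᵇᵒᵖ` is the transpose of the multiplication of `R`. -/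
theorem leftDual_bop_comul (hA : A.toYDData.IsYetterDrinfeld) :
    A.leftDual.bop.comul = (dualTensor k R R).symm.toLinearMap ∘ₗ A.mul.dualMap :=
  LinearMap.ext fun _ => YDData.braidingInv_braiding hA.leftDual hA.leftDual _

end HopfData

namespace YDData

variable {V : Type w} [AddCommGroup V] [Module k V] [Module.Finite k V]
variable {s : YDData k H V} (hs : s.IsYetterDrinfeld)
include hs

theorem IsYetterDrinfeld.isHopfAlgebra_nichols (hV : s.tensorHopf.IsHopfIdeal s.nicholsIdeal) :
    (s.nichols hV).IsHopfAlgebra :=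
  (HopfData.isHom_mkQ _ _ hV).isHopfAlgebra (Submodule.mkQ_surjective _)
    hs.isHopfAlgebra_tensorHopf

variable [BijectiveAntipode k H] [Module.Finite k s.NicholsSpace]
  (hV : s.tensorHopf.IsHopfIdeal s.nicholsIdeal)

theorem IsYetterDrinfeld.nicholsPair_act (h : H) (F : TensorAlgebra k (Module.Dual k V)) :
    hs.nicholsPair (s.leftDual.tensorAct h F) =
      (s.nichols hV).toYDData.leftDual.act h (hs.nicholsPair F) := by
  refine LinearMap.ext fun q => ?_
  obtain ⟨x, rfl⟩ := s.nicholsIdeal.mkQ_surjective q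
  have e := hs.pair_act (antipodeInv k H h) F x
  rw [antipode_antipodeInv] at e
  exact e

theorem IsYetterDrinfeld.nicholsPair_coact :
    (s.nichols hV).toYDData.leftDual.coact ∘ₗ hs.nicholsPair =
      TensorProduct.map LinearMap.id hs.nicholsPair ∘ₗ s.leftDual.tensorCoact := by
  refine LinearMap.ext fun F => evalRight_ext fun q => ?_
  obtain ⟨x, rfl⟩ := s.nicholsIdeal.mkQ_surjective q
  have e := hs.pair_coact F x
  change evalRight H (s.nicholsIdeal.mkQ x)
    ((s.nichols hV).toYDData.leftDual.coact (hs.nicholsPair F)) = evalRight H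
      (s.nicholsIdeal.mkQ x) (TensorProduct.map LinearMap.id hs.nicholsPair
        (s.leftDual.tensorCoact F))
  rw [evalRight_leftDual_coact]
  change antipodeEval H (hs.nicholsPair F) (TensorProduct.map LinearMap.id
    s.nicholsIdeal.mkQ (s.tensorCoact x)) = _
  trans antipodeEval H (s.pair LinearMap.id F) (s.tensorCoact x)
  · generalize s.tensorCoact x = z
    induction z with
    | zero => simp
    | add x y hx hy => simp only [map_add, hx, hy]
    | tmul a c => simp
  · rw [← e]
    generalize s.leftDual.tensorCoact F = z
    induction z with
    | zero => simp
    | add x y hx hy => simp only [map_add, hx, hy]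
    | tmul a c => simp

theorem IsYetterDrinfeld.nicholsPair_mul :
    hs.nicholsPair ∘ₗ LinearMap.mul' k (TensorAlgebra k (Module.Dual k V)) =
      (s.nichols hV).leftDual.bop.mul ∘ₗ TensorProduct.map hs.nicholsPair hs.nicholsPair := by
  refine TensorProduct.ext' fun F G => LinearMap.ext fun q => ?_
  obtain ⟨x, rfl⟩ := s.nicholsIdeal.mkQ_surjective q
  rw [LinearMap.comp_apply, LinearMap.comp_apply, TensorProduct.map_tmul, LinearMap.mul'_apply,
    HopfData.leftDual_bop_mul_apply (hs.isHopfAlgebra_nichols hV).isYetterDrinfeld]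
  have e : (s.nichols hV).comul (s.nicholsIdeal.mkQ x) =
      TensorProduct.map s.nicholsIdeal.mkQ s.nicholsIdeal.mkQ (s.tensorComul x) := rfl
  rw [e, Submodule.mkQ_apply, nicholsPair_mk, hs.pair_mul]
  generalize s.tensorComul x = z
  induction z with
  | zero => simp
  | add x y hx hy => simp only [map_add, hx, hy]
  | tmul a c => simp

theorem IsYetterDrinfeld.nicholsPair_unit :
    hs.nicholsPair ∘ₗ Algebra.linearMap k (TensorAlgebra k (Module.Dual k V)) =
      (s.nichols hV).leftDual.bop.unit := by
  refine LinearMap.ext_ring (LinearMap.ext fun q => ?_)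
  obtain ⟨x, rfl⟩ := s.nicholsIdeal.mkQ_surjective q
  change s.pair LinearMap.id (algebraMap k _ 1) x = _
  rw [map_one, pair_one]
  change _ = (1 : k) * TensorAlgebra.algebraMapInv x
  rw [one_mul]
  rfl

theorem IsYetterDrinfeld.nicholsPair_comul :
    (s.nichols hV).leftDual.bop.comul ∘ₗ hs.nicholsPair =
      TensorProduct.map hs.nicholsPair hs.nicholsPair ∘ₗ s.leftDual.tensorComul := by
  rw [HopfData.leftDual_bop_comul (hs.isHopfAlgebra_nichols hV).isYetterDrinfeld]
  refine LinearMap.ext fun F => (HopfData.dualTensor k _ _).injective ?_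
  simp only [LinearMap.comp_apply, LinearEquiv.coe_coe, LinearEquiv.apply_symm_apply]
  refine TensorProduct.ext' fun p q => ?_
  obtain ⟨x, rfl⟩ := s.nicholsIdeal.mkQ_surjective p
  obtain ⟨y, rfl⟩ := s.nicholsIdeal.mkQ_surjective q
  refine (hs.pair_apply_mul F x y).trans ?_
  change _ = HopfData.dualTensor k _ _ (TensorProduct.map hs.nicholsPair hs.nicholsPair
    (s.leftDual.tensorComul F)) _
  generalize s.leftDual.tensorComul F = z
  induction z with
  | zero => simp
  | add x y hx hy => simp only [map_add, LinearMap.add_apply, hx, hy]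
  | tmul a c => simp [mul_comm]

theorem IsYetterDrinfeld.nicholsPair_antipode :
    hs.nicholsPair ∘ₗ s.leftDual.tensorAntipode =
      (s.nichols hV).leftDual.bop.antipode ∘ₗ hs.nicholsPair := by
  refine LinearMap.ext fun F => LinearMap.ext fun q => ?_
  obtain ⟨x, rfl⟩ := s.nicholsIdeal.mkQ_surjective q
  exact hs.pair_antipode F x


theorem IsYetterDrinfeld.nicholsPair_counit :
    (s.nichols hV).leftDual.bop.counit ∘ₗ hs.nicholsPair =
      TensorAlgebra.algebraMapInv.toLinearMap := by
  refine LinearMap.ext fun F => Eq.trans ?_ (s.pair_apply_one LinearMap.id F)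
  change s.pair LinearMap.id F (algebraMap k _ 1) = _
  rw [map_one]

/-- The pairing is a morphism of Hopf algebras `T(*V) → (*𝔅(V))ᵇᵒᵖ`. -/
theorem IsYetterDrinfeld.isHom_nicholsPair :
    s.leftDual.tensorHopf.IsHom (s.nichols hV).leftDual.bop hs.nicholsPair where
  yd_hom := ⟨hs.nicholsPair_act hV, hs.nicholsPair_coact hV⟩
  map_mul := hs.nicholsPair_mul hV
  map_unit := hs.nicholsPair_unit hV
  map_comul := hs.nicholsPair_comul hV
  map_counit := hs.nicholsPair_counit hV
  map_antipode := hs.nicholsPair_antipode hV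

end YDData

end DualNichols

end BraidedHopf

end

theorem mainTheorem7 {k : Type*} {H : Type*} {V : Type*} [Field k] [Ring H] [HopfAlgebra k H]
    [BraidedHopf.BijectiveAntipode k H] [AddCommGroup V] [Module k V] [Module.Finite k V]
    (s : BraidedHopf.YDData k H V) (hs : s.IsYetterDrinfeld)
    [Module.Finite k s.NicholsSpace] :
    ∃ (hV : s.tensorHopf.IsHopfIdeal s.nicholsIdeal)
      (hV' : s.leftDual.tensorHopf.IsHopfIdeal s.leftDual.nicholsIdeal),
      (s.nichols hV).IsHopfAlgebra ∧
      (s.leftDual.nichols hV').IsHopfAlgebra ∧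
      (s.nichols hV).leftDual.bop.IsHopfAlgebra ∧
      (s.leftDual.nichols hV').Isomorphic (s.nichols hV).leftDual.bop := by
  have hV := hs.isHopfIdeal_nicholsIdeal
  have hV' := hs.leftDual.isHopfIdeal_nicholsIdeal
  -- The axioms for `(*𝔅(V))ᵇᵒᵖ` are not verified on the dual: they are inherited from `T(*V)`
  -- through the surjection `nicholsPair`.
  refine ⟨hV, hV', hs.isHopfAlgebra_nichols hV, hs.leftDual.isHopfAlgebra_nichols hV',
    (hs.isHom_nicholsPair hV).isHopfAlgebra hs.nicholsPair_surjective
      hs.leftDual.isHopfAlgebra_tensorHopf, ?_⟩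
  let e := (Submodule.quotEquivOfEq _ _ hs.ker_nicholsPair.symm).trans
    (hs.nicholsPair.quotKerEquivOfSurjective hs.nicholsPair_surjective)
  -- Composed with the quotient map, `e` is `nicholsPair` by definition.
  exact ⟨e, (BraidedHopf.HopfData.isHom_mkQ _ _ hV').of_comp_surjective
    (Submodule.mkQ_surjective _) (hs.isHom_nicholsPair hV)⟩
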